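/- Let $d\ge 1$ and let $\mu$ be a compactly supported finite (positive) Borel measure on $\mathbb R^{2d}=\mathbb R^d\times\mathbb R^d$ that is $a$-admissible, i.e. $a>d/2$ and $\hat\mu(\xi,\eta)=\int e^{-2\pi i(y\cdot\xi+z\cdot\eta)}\,d\mu(y,z)$ satisfies $|\hat\mu(\xi,\eta)|\le C(1+|\xi|+|\eta|)^{-a}$ for some $C$ and all $\xi,\eta\in\mathbb R^d$. For a nonempty set $E\subset[1,2]$ let $N(E,\delta)$ be the minimal number of closed intervals of length $\delta$ that cover $E$, and let $\dim_M(E)=\limsup_{\delta\to0^+}\log N(E,\delta)/\log(1/\delta)$ be its upper Minkowski dimension. For nonempty $E,E_1,E_2\subset[1,2]$ and functions $f,g:\mathbb R^d\to\mathbb C$ put $$\mathcal M_{\hat\mu,E}(f,g)(x)=\sup_{l\in\mathbb Z}\sup_{t\in E}\Big|\int f(x-2^l t y)\,g(x-2^l t z)\,d\mu(y,z)\Big|,$$ $$\mathcal M^{(2)}_{\hat\mu,E_1,E_2}(f,g)(x)=\sup_{l\in\mathbb Z}\sup_{t_1\in E_1,\,t_2\in E_2}\Big|\int f(x-2^l t_1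 y)\,g(x-2^l t_2 z)\,d\mu(y,z)\Big|,$$ $$\mathcal M^{bip}_{\hat\mu,E_1,E_2}(f,g)(x)=\sup_{k,l\in\mathbb Z}\sup_{t_1\in E_1,\,t_2\in E_2}\Big|\int f(x-2^k t_1 y)\,g(x-2^l t_2 z)\,d\mu(y,z)\Big|.$$ We say that such an operator $\mathcal M$ is bounded $L^p\times L^q\to L^r$ if there is $C<\infty$ such that for all $f\in L^p(\mathbb R^d)$, $g\in L^q(\mathbb R^d)$: for almost every $x$ all the integrals in the supremum converge absolutely, $\mathcal M(f,g)$ is Lebesgue measurable, and $\|\mathcal M(f,g)\|_{L^r}\le C\|f\|_{L^p}\|g\|_{L^q}$. (i) If $2a\ge d+\dim_M(E)$, then $\mathcal M_{\hat\mu,E}$ is bounded $L^p\times L^q\to L^r$ for all $1<p,q\le\infty$ with $1/r=1/p+1/q<1$ (where $1/\infty=0$). (ii) If $2a\ge d+\max\{\dim_M(E_1),\dim_M(E_2)\}$, then $\mathcal M^{(2)}_{\hat\mu,E_1,E_2}$ and $\mathcal M^{bip}_{\hat\mu,E_1,E_2}$ are bounded $L^p\times L^q\to L^r$ for all such $p,q,r$.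 -/

import Mathlib

open MeasureTheory Set Filter Topology
open scoped ENNReal NNReal

noncomputable section

/-- The minimal number `N(E, δ)` of closed intervals of length `δ` needed to cover `E`. -/
def intervalCoveringNumber (E : Set ℝ) (δ : ℝ) : ℕ :=
  sInf {n : ℕ | ∃ c : Fin n → ℝ, E ⊆ ⋃ i, Icc (c i) (c i + δ)}

/-- The upper Minkowski dimension `limsup_{δ → 0+} log N(E, δ) / log (1 / δ)`. It is only used for
nonempty `E ⊆ [1, 2]`, where `1 ≤ N(E, δ) ≤ 1 / δ + 1`, so that the quotient stays bounded. -/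
def upperMinkowskiDim (E : Set ℝ) : ℝ :=
  limsup (fun δ : ℝ => Real.log (intervalCoveringNumber E δ) / Real.log (1 / δ)) (𝓝[>] 0)

/-- The Fourier transform `μ̂(ξ, η) = ∫ exp (-2πi (y·ξ + z·η)) dμ(y, z)` of a measure on
`ℝᵈ × ℝᵈ = ℝ²ᵈ`. -/
def measureFourier {d : ℕ} (μ : Measure (EuclideanSpace ℝ (Fin d) × EuclideanSpace ℝ (Fin d)))
    (ξ η : EuclideanSpace ℝ (Fin d)) : ℂ :=
  ∫ w, Complex.exp (-2 * Real.pi * Complex.I * ((inner ℝ w.1 ξ + inner ℝ w.2 η : ℝ) : ℂ)) ∂μ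

/-- `μ̂` is `a`-admissible: `a > d / 2` and `|μ̂(ξ, η)| ≲ (1 + |ξ| + |η|)^(-a)`. -/
def IsAdmissibleMeasure {d : ℕ}
    (μ : Measure (EuclideanSpace ℝ (Fin d) × EuclideanSpace ℝ (Fin d))) (a : ℝ) : Prop :=
  (d : ℝ) / 2 < a ∧ ∃ C : ℝ, ∀ ξ η : EuclideanSpace ℝ (Fin d),
    ‖measureFourier μ ξ η‖ ≤ C * (1 + ‖ξ‖ + ‖η‖) ^ (-a)

/-- The integrand `(y, z) ↦ f(x - s y) g(x - t z)` of the bilinear average. -/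
def averageIntegrand {d : ℕ} (s t : ℝ) (f g : EuclideanSpace ℝ (Fin d) → ℂ)
    (x : EuclideanSpace ℝ (Fin d)) (w : EuclideanSpace ℝ (Fin d) × EuclideanSpace ℝ (Fin d)) : ℂ :=
  f (x - s • w.1) * g (x - t • w.2)

/-- The bilinear maximal function
`x ↦ sup_{(s, t) ∈ S} |∫ f(x - s y) g(x - t z) dμ(y, z)|` over a set `S` of pairs of dilations. -/
def bilinearMaximal {d : ℕ}
    (μ : Measure (EuclideanSpace ℝ (Fin d) × EuclideanSpace ℝ (Fin d))) (S : Set (ℝ × ℝ))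
    (f g : EuclideanSpace ℝ (Fin d) → ℂ) (x : EuclideanSpace ℝ (Fin d)) : ℝ≥0∞ :=
  ⨆ τ ∈ S, ‖∫ w, averageIntegrand τ.1 τ.2 f g x w ∂μ‖ₑ

/-- The pairs `(2ˡ t, 2ˡ t)`, `l ∈ ℤ`, `t ∈ E`: `bilinearMaximal μ (oneParamDilations E)` is the
multi-scale maximal operator `M_{μ̂,E}`. -/
def oneParamDilations (E : Set ℝ) : Set (ℝ × ℝ) :=
  {τ | ∃ l : ℤ, ∃ t ∈ E, τ = ((2 : ℝ) ^ l * t, (2 : ℝ) ^ l * t)}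

/-- The pairs `(2ˡ t₁, 2ˡ t₂)`, `l ∈ ℤ`, `t₁ ∈ E₁`, `t₂ ∈ E₂`, with a common dyadic scale:
the dilations of the maximal operator `M⁽²⁾_{μ̂,E₁,E₂}`. -/
def commonScaleDilations (E₁ E₂ : Set ℝ) : Set (ℝ × ℝ) :=
  {τ | ∃ l : ℤ, ∃ t₁ ∈ E₁, ∃ t₂ ∈ E₂, τ = ((2 : ℝ) ^ l * t₁, (2 : ℝ) ^ l * t₂)}

/-- The pairs `(2ᵏ t₁, 2ˡ t₂)`, `k, l ∈ ℤ`, `t₁ ∈ E₁`, `t₂ ∈ E₂`, with independent dyadic scales: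
the dilations of the maximal operator `Mᵇⁱᵖ_{μ̂,E₁,E₂}`. -/
def biparamDilations (E₁ E₂ : Set ℝ) : Set (ℝ × ℝ) :=
  {τ | ∃ k l : ℤ, ∃ t₁ ∈ E₁, ∃ t₂ ∈ E₂, τ = ((2 : ℝ) ^ k * t₁, (2 : ℝ) ^ l * t₂)}

/-- Boundedness `Lᵖ × L^q → Lʳ` of the maximal operator over the dilations `S`: for `f ∈ Lᵖ` and
`g ∈ L^q` the averages at almost every point `x` are given by absolutely convergent integrals for
all dilations in `S` simultaneously, the maximal function is measurable, and its `Lʳ` norm is at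
most `C ‖f‖_p ‖g‖_q` with `C` independent of `f` and `g`. -/
def MaximalBounded {d : ℕ}
    (μ : Measure (EuclideanSpace ℝ (Fin d) × EuclideanSpace ℝ (Fin d))) (S : Set (ℝ × ℝ))
    (p q r : ℝ≥0∞) : Prop :=
  ∃ C : ℝ≥0, ∀ f g : EuclideanSpace ℝ (Fin d) → ℂ, MemLp f p volume → MemLp g q volume →
    (∀ᵐ x, ∀ τ ∈ S, Integrable (averageIntegrand τ.1 τ.2 f g x) μ) ∧
    AEMeasurable (bilinearMaximal μ S f g) volume ∧
    eLpNorm (bilinearMaximal μ S f g) r volume ≤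
      C * eLpNorm f p volume * eLpNorm g q volume

/-- Boundedness `Lᵖ × L^q → Lʳ` for all `1 < p, q ≤ ∞` and `1 / r = 1 / p + 1 / q < 1`
(including infinite exponents, with `1 / ∞ = 0`). -/
def HolderBanachBounded {d : ℕ}
    (μ : Measure (EuclideanSpace ℝ (Fin d) × EuclideanSpace ℝ (Fin d)))
    (S : Set (ℝ × ℝ)) : Prop :=
  ∀ p q r : ℝ≥0∞, 1 < p → 1 < q → r⁻¹ = p⁻¹ + q⁻¹ → r⁻¹ < 1 → MaximalBounded μ S p q r

end

/-! The bilinear problem reduces to a linear one for the two marginals of `μ`, whose Fourier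
transforms are `μ̂(ξ, 0)` and `μ̂(0, η)` and so inherit the decay of order `a`. For finite `p, q`,
Hölder's inequality inside the average with exponents `p/r` and `q/r` bounds it by `(∫ |f(x -
sy)|^(p/r))^(r/p)` times the analogous factor for `g`. The suprema in `s` and `t` then decouple, so
independent dyadic scales cost nothing, and Hölder in `x` leaves the linear maximal operators of the
marginals on `Lʳ`; here `r > 1` is exactly what is needed (`exists_bilinear_majorant`). Infinite
exponents use the essential supremum.

The linear statement (`dilMaxBounded_dyadicDilates`) concerns a measure `ν` with `|ν̂| ≲ (1 +
|ξ|)^(-(d+b)/2)`, `0 < b ≤ 1`, and a set `E` having `δ`-nets of `O(δ^(-b-ε))` points. Write `ν` as a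
mollification at scale `2^(-J)` plus pieces `ν_j`, `j ≥ J`, living at frequency about `2ʲ`, and at
level `j` replace `E` by a net of mesh `2^(-(1+κ)j)`, of cardinality `2^((b+O(κ))j)`. On `L²`,
Plancherel and `Σ_l |ν̂_j(2ˡξ)|² ≲ 2^(-(b+1/2)j)` beat the cardinality (`lintegral_netMax_sq_le`).
Near `L¹`, `‖ν_j‖₂² ≲ 2^(-(b-κ)j)` and Cauchy–Schwarz show that the supremum of the dilates of `ν_j`
over the net has integral `2^(O(κ)j)`; shifted maximal functions, whose constants grow
logarithmically in the shift, turn this into a bound with an equally small loss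
(`exists_lintegral_netMax_rpow_le`). Interpolation gives geometric decay in `j` for every `1 < p <
2` (`exists_lintegral_netMax_piece_le`). The `ε`-losses are paid by the gain on `L²`, which is why
equality `2a = d + dim` is allowed.

Passing from `E` to the net produces an error `2^(-κj)` times the same maximal operator applied to
the Hardy–Littlewood maximal function. For large `J` the errors sum to at most half of the unknown
norm, so any finite a priori constant `c` improves to `A + c/2` (`exists_dilBound_improve`).
Starting from finite sets of dilations, iterating, and exhausting a countable dense set gives the
full bound (`exists_dilBound`). Jensen's inequality raises `p` to all finite exponents.

Since `2a > d`, the marginals have square integrable Fourier transforms and are absolutely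
continuous; hence functions known only almost everywhere can be averaged at every point `x`. Suprema
over uncountable sets of dilations are lower semicontinuous for continuous data, and measurability
in general follows by approximation with summable majorants (`aemeasurable_bilinearMaximal`). -/

set_option linter.unusedSectionVars false

/-! ### Plancherel's identity for functions in `L¹ ∩ L²`. -/

section Plancherel

open scoped FourierTransform SchwartzMap

variable {V : Type*} [NormedAddCommGroup V] [InnerProductSpace ℝ V] [FiniteDimensional ℝ V]
  [MeasurableSpace V] [BorelSpace V]

/-- The `L²` Fourier transform of an integrable square-integrable function is given by the
Fourier integral. -/
theorem coeFn_fourier_toLp_ae_eq {f : V → ℂ} (hf : Integrable f) (hf2 : MemLp f 2) :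
    (𝓕 (hf2.toLp f) : Lp ℂ 2 (volume : Measure V)) =ᵐ[volume] 𝓕 f := by
  apply ae_eq_of_integral_contDiff_smul_eq
  · exact (Lp.memLp _).locallyIntegrable (by norm_num)
  · have : Continuous (𝓕 f) :=
      VectorFourier.fourierIntegral_continuous Real.continuous_fourierChar
        (by exact continuous_inner) hf
    exact this.locallyIntegrable
  intro g hg hgc
  have hgC : HasCompactSupport (fun x => (g x : ℂ)) := hgc.comp_left Complex.ofReal_zero
  have hgD : ContDiff ℝ ((⊤ : ℕ∞) : WithTop ℕ∞) (fun x => (g x : ℂ)) := Complex.ofRealCLM.contDiff.comp hg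
  let G : 𝓢(V, ℂ) := hgC.toSchwartzMap hgD
  have hG : ∀ x, G x = g x := fun x => rfl
  -- The `L²` transform agrees with the distributional one, so pairing with a test function moves
  -- the transform onto it; the exchange formula `h3` moves it back onto the Fourier integral of
  -- `f`.
  have h1 := congrArg (fun u => u G) (Lp.fourier_toTemperedDistribution_eq (hf2.toLp f))
  simp only [TemperedDistribution.fourier_apply, Lp.toTemperedDistribution_apply] at h1
  have h2 : ∫ x, (𝓕 G) x • (hf2.toLp f) x = ∫ x, (𝓕 G) x • f x := by
    apply integral_congr_ae
    filter_upwards [hf2.coeFn_toLp] with x hx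
    rw [hx]
  have h3 := VectorFourier.integral_fourierIntegral_smul_eq_flip (μ := volume) (ν := volume)
    (L := innerₗ V) Real.continuous_fourierChar (by exact continuous_inner) G.integrable hf
  rw [flip_innerₗ] at h3
  calc ∫ x, g x • (𝓕 (hf2.toLp f) : Lp ℂ 2 (volume : Measure V)) x
      = ∫ x, G x • (𝓕 (hf2.toLp f) : Lp ℂ 2 (volume : Measure V)) x := by
        simp [hG]
    _ = ∫ x, (𝓕 G) x • f x := by rw [← h1, h2]
    _ = ∫ x, G x • 𝓕 f x := h3
    _ = ∫ x, g x • 𝓕 f x := by simp [hG]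

theorem lintegral_enorm_sq_fourier {f : V → ℂ} (hf : Integrable f) (hf2 : MemLp f 2) :
    ∫⁻ ξ, ‖𝓕 f ξ‖ₑ ^ (2 : ℝ) = ∫⁻ x, ‖f x‖ₑ ^ (2 : ℝ) := by
  have h := Lp.norm_fourier_eq (hf2.toLp f)
  have h' : eLpNorm (𝓕 f) 2 volume = eLpNorm f 2 volume := by
    rw [← eLpNorm_congr_ae (coeFn_fourier_toLp_ae_eq hf hf2),
      ← eLpNorm_congr_ae hf2.coeFn_toLp]
    rw [Lp.norm_def, Lp.norm_def] at h
    exact (ENNReal.toReal_eq_toReal_iff' (Lp.eLpNorm_ne_top _) (Lp.eLpNorm_ne_top _)).1 h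
  rw [eLpNorm_eq_lintegral_rpow_enorm_toReal (by norm_num) (by norm_num),
    eLpNorm_eq_lintegral_rpow_enorm_toReal (by norm_num) (by norm_num)] at h'
  simp only [ENNReal.toReal_ofNat] at h'
  exact (ENNReal.rpow_left_injective (by norm_num : (1 / 2 : ℝ) ≠ 0)) h'

end Plancherel

/-! ### Integral inequalities and real interpolation. -/

section Lp

variable {α : Type*} [MeasurableSpace α] {μ : Measure α}

/-- Jensen's inequality for the power `p ≥ 1` and a not necessarily normalized measure. -/
theorem lintegral_rpow_le_measure_univ_rpow_mul {p : ℝ} (hp : 1 ≤ p) {f : α → ℝ≥0∞}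
    (hf : AEMeasurable f μ) :
    (∫⁻ x, f x ∂μ) ^ p ≤ μ univ ^ (p - 1) * ∫⁻ x, f x ^ p ∂μ := by
  have h := eLpNorm'_le_eLpNorm'_mul_rpow_measure_univ (μ := μ) (f := f) one_pos hp
    hf.aestronglyMeasurable
  have hp0 : 0 < p := by linarith
  simp only [eLpNorm', enorm_eq_self, ENNReal.rpow_one, div_one] at h
  calc (∫⁻ x, f x ∂μ) ^ p
      ≤ ((∫⁻ x, f x ^ p ∂μ) ^ (1 / p) * μ univ ^ (1 - 1 / p)) ^ p := by gcongr
    _ = μ univ ^ (p - 1) * ∫⁻ x, f x ^ p ∂μ := by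
        rw [ENNReal.mul_rpow_of_nonneg _ _ hp0.le, ← ENNReal.rpow_mul, ← ENNReal.rpow_mul, mul_comm]
        congr 1
        · congr 1; field_simp
        · rw [one_div_mul_cancel hp0.ne', ENNReal.rpow_one]

/-- Minkowski's inequality for series. -/
theorem lintegral_rpow_tsum_le {p : ℝ} (hp : 1 ≤ p) {f : ℕ → α → ℝ≥0∞}
    (hf : ∀ n, AEMeasurable (f n) μ) :
    (∫⁻ x, (∑' n, f n x) ^ p ∂μ) ^ (1 / p) ≤ ∑' n, (∫⁻ x, f n x ^ p ∂μ) ^ (1 / p) := by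
  have hp0 : 0 < p := by linarith
  have hfin : ∀ N : ℕ, (∫⁻ x, (∑ n ∈ Finset.range N, f n x) ^ p ∂μ) ^ (1 / p) ≤
      ∑ n ∈ Finset.range N, (∫⁻ x, f n x ^ p ∂μ) ^ (1 / p) := by
    intro N
    induction N with
    | zero => simp [hp0]
    | succ N ih =>
      simp only [Finset.sum_range_succ]
      refine (ENNReal.lintegral_Lp_add_le (Finset.aemeasurable_fun_sum _ fun n _ => hf n)
        (hf N) hp).trans ?_
      gcongr
  have hmono : ∀ x, Monotone fun N => ∑ n ∈ Finset.range N, f n x := fun x =>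
    monotone_nat_of_le_succ fun N => by simp [Finset.sum_range_succ]
  have hlim : ∫⁻ x, (∑' n, f n x) ^ p ∂μ = ⨆ N, ∫⁻ x, (∑ n ∈ Finset.range N, f n x) ^ p ∂μ := by
    rw [← lintegral_iSup' (fun N => (Finset.aemeasurable_fun_sum _ fun n _ => hf n).pow_const p)
      (Eventually.of_forall fun x N M h => ENNReal.rpow_le_rpow (hmono x h) hp0.le)]
    refine lintegral_congr fun x => ?_
    rw [ENNReal.tsum_eq_iSup_nat]
    exact (ENNReal.orderIsoRpow p hp0).map_iSup _
  rw [hlim, one_div, ENNReal.rpow_inv_le_iff hp0]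
  refine iSup_le fun N => ?_
  rw [← ENNReal.rpow_inv_le_iff hp0, ← one_div]
  exact (hfin N).trans (ENNReal.sum_le_tsum _)

theorem lintegral_Ioo_zero_rpow {q : ℝ} (hq : 0 < q) {h : ℝ} (hh : 0 ≤ h) :
    ∫⁻ t in Ioo 0 h, ENNReal.ofReal (t ^ (q - 1)) = ENNReal.ofReal (h ^ q / q) := by
  have hint : IntegrableOn (fun t : ℝ => t ^ (q - 1)) (Ioc 0 h) :=
    (intervalIntegrable_iff_integrableOn_Ioc_of_le hh).1
      (intervalIntegral.intervalIntegrable_rpow' (by linarith))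
  rw [Measure.restrict_congr_set Ioo_ae_eq_Ioc, ← ofReal_integral_eq_lintegral_ofReal hint
    ((ae_restrict_iff' measurableSet_Ioc).2 (Eventually.of_forall fun t ht =>
      Real.rpow_nonneg ht.1.le _)), ← intervalIntegral.integral_of_le hh,
    integral_rpow (Or.inl (by linarith))]
  simp [Real.zero_rpow hq.ne']

/-- `∫ t^{q-1} dt` over `0 < t < h` for an extended nonnegative `h`. -/
theorem lintegral_indicator_lt_rpow {q : ℝ} (hq : 0 < q) (h : ℝ≥0∞) :
    ∫⁻ t in Ioi (0 : ℝ), ({t | ENNReal.ofReal t < h} : Set ℝ).indicator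
      (fun t => ENNReal.ofReal (t ^ (q - 1))) t = h ^ q / ENNReal.ofReal q := by
  have hfin : ∀ h : ℝ≥0, ∫⁻ t in Ioi (0 : ℝ), ({t | ENNReal.ofReal t < h} : Set ℝ).indicator
      (fun t => ENNReal.ofReal (t ^ (q - 1))) t = (h : ℝ≥0∞) ^ q / ENNReal.ofReal q := by
    intro h
    have hm : MeasurableSet ({t | ENNReal.ofReal t < h} : Set ℝ) :=
      measurableSet_lt ENNReal.measurable_ofReal measurable_const
    rw [lintegral_indicator hm, Measure.restrict_restrict hm]
    have : ({t | ENNReal.ofReal t < h} : Set ℝ) ∩ Ioi 0 = Ioo 0 (h : ℝ) := by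
      ext t
      simp only [mem_inter_iff, mem_ofPred_eq, mem_Ioi, mem_Ioo]
      constructor
      · rintro ⟨h1, h2⟩
        refine ⟨h2, ?_⟩
        rw [← ENNReal.ofReal_coe_nnreal] at h1
        exact (ENNReal.ofReal_lt_ofReal_iff_of_nonneg h2.le).1 h1
      · rintro ⟨h1, h2⟩
        refine ⟨?_, h1⟩
        rw [← ENNReal.ofReal_coe_nnreal]
        exact (ENNReal.ofReal_lt_ofReal_iff_of_nonneg h1.le).2 h2
    rw [this]
    refine (lintegral_Ioo_zero_rpow hq h.coe_nonneg).trans ?_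
    rw [ENNReal.ofReal_div_of_pos hq, ← ENNReal.ofReal_rpow_of_nonneg h.coe_nonneg hq.le, ENNReal.ofReal_coe_nnreal]
  induction h with
  | coe h => exact hfin h
  | top =>
    rw [ENNReal.top_rpow_of_pos hq, ENNReal.top_div_of_ne_top ENNReal.ofReal_ne_top]
    refine ENNReal.eq_top_of_forall_nnreal_le fun r => ?_
    -- The finite height at which the integral equals `r`; monotonicity in the height then gives the
    -- value at `∞`.
    let s : ℝ≥0 := (r * q.toNNReal) ^ (1 / q)
    have hs : (s : ℝ≥0∞) ^ q / ENNReal.ofReal q = r := by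
      rw [← ENNReal.coe_rpow_of_nonneg _ hq.le, ← NNReal.rpow_mul, one_div_mul_cancel hq.ne',
        NNReal.rpow_one, ENNReal.coe_mul]
      exact ENNReal.mul_div_cancel_right (by simpa using hq) (by simp)
    rw [← hs, ← hfin s]
    refine lintegral_mono fun t => indicator_le_indicator_of_subset ?_ (fun _ => zero_le) t
    intro t _
    simp

/-- `∫ t^{-q-1} dt` over `t ≥ h` for an extended positive `h`. -/
theorem lintegral_indicator_ge_rpow {q : ℝ} (hq : 0 < q) {h : ℝ≥0∞} (h0 : h ≠ 0) :
    ∫⁻ t in Ioi (0 : ℝ), ({t | h ≤ ENNReal.ofReal t} : Set ℝ).indicator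
      (fun t => ENNReal.ofReal (t ^ (-q - 1))) t = h ^ (-q) / ENNReal.ofReal q := by
  induction h with
  | top => simp [hq]
  | coe h =>
    have hpos : 0 < (h : ℝ) := by
      have : h ≠ 0 := by simpa using h0
      positivity
    have hm : MeasurableSet ({t | h ≤ ENNReal.ofReal t} : Set ℝ) :=
      measurableSet_le measurable_const ENNReal.measurable_ofReal
    rw [lintegral_indicator hm, Measure.restrict_restrict hm]
    have : ({t | h ≤ ENNReal.ofReal t} : Set ℝ) ∩ Ioi 0 = Ici (h : ℝ) := by
      ext t
      simp only [mem_inter_iff, mem_ofPred_eq, mem_Ioi, mem_Ici]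
      constructor
      · rintro ⟨h1, h2⟩
        rw [← ENNReal.ofReal_coe_nnreal] at h1
        exact (ENNReal.ofReal_le_ofReal_iff h2.le).1 h1
      · intro h1
        refine ⟨?_, hpos.trans_le h1⟩
        rw [← ENNReal.ofReal_coe_nnreal]
        exact ENNReal.ofReal_le_ofReal h1
    rw [this, Measure.restrict_congr_set Ioi_ae_eq_Ici.symm, ← ofReal_integral_eq_lintegral_ofReal
      (integrableOn_Ioi_rpow_of_lt (by linarith) hpos) ((ae_restrict_iff' measurableSet_Ioi).2
        (Eventually.of_forall fun t ht => Real.rpow_nonneg (hpos.trans ht).le _)),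
      integral_Ioi_rpow_of_lt (by linarith) hpos]
    rw [← ENNReal.ofReal_coe_nnreal, ENNReal.ofReal_rpow_of_pos hpos,
      ← ENNReal.ofReal_div_of_pos hq]
    congr 1
    rw [show -q - 1 + 1 = -q by ring, neg_div_neg_eq]

variable [SFinite μ]

/-- Layer cake: `H^p = p ∫ t^(p-1) dt` over `0 < t < H`, followed by Tonelli. Infinite values of `H`
are permitted. -/
theorem lintegral_rpow_eq_lintegral_meas_lt {p : ℝ} (hp : 0 < p) {H : α → ℝ≥0∞}
    (hH : Measurable H) :
    ∫⁻ x, H x ^ p ∂μ = ENNReal.ofReal p *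
      ∫⁻ t in Ioi (0 : ℝ), μ {x | ENNReal.ofReal t < H x} * ENNReal.ofReal (t ^ (p - 1)) := by
  have hpt : ∀ x, H x ^ p = ENNReal.ofReal p * ∫⁻ t in Ioi (0 : ℝ),
      ({y : α × ℝ | ENNReal.ofReal y.2 < H y.1}).indicator
        (fun y => ENNReal.ofReal (y.2 ^ (p - 1))) (x, t) := by
    intro x
    have := lintegral_indicator_lt_rpow hp (H x)
    simp only [indicator, mem_ofPred_eq] at this ⊢
    rw [this, ENNReal.mul_div_cancel (by simpa using hp) (by simp)]
  have hm : Measurable (({y : α × ℝ | ENNReal.ofReal y.2 < H y.1}).indicator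
        (fun y => ENNReal.ofReal (y.2 ^ (p - 1)))) :=
    Measurable.indicator (by fun_prop) (measurableSet_lt (by fun_prop) (by fun_prop))
  simp_rw [hpt]
  rw [lintegral_const_mul _ hm.lintegral_prod_right']
  congr 1
  rw [lintegral_lintegral_swap (f := fun x t => ({y : α × ℝ | ENNReal.ofReal y.2 < H y.1}).indicator
    (fun y => ENNReal.ofReal (y.2 ^ (p - 1))) (x, t)) hm.aemeasurable]
  refine lintegral_congr fun t => ?_
  rw [mul_comm, ← lintegral_indicator_const (measurableSet_lt measurable_const hH)]
  rfl

/-- Real interpolation between weak type bounds with exponents `q < 2`, in the form of a bound for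
the distribution function by truncations. -/
theorem lintegral_rpow_le_of_meas_lt_le {p q K : ℝ} (hq : 0 < q) (hqp : q < p) (hp2 : p < 2)
    (hK : 0 < K) {F H : α → ℝ≥0∞} (hF : Measurable F) (hH : Measurable H) (c₁ c₂ : ℝ≥0∞)
    (h : ∀ t : ℝ, 0 < t → μ {x | ENNReal.ofReal t < H x} ≤
      c₁ * ENNReal.ofReal (t ^ (-2 : ℝ)) * (∫⁻ x in {x | F x ≤ ENNReal.ofReal (K * t)}, F x ^ (2 : ℝ) ∂μ) +
      c₂ * ENNReal.ofReal (t ^ (-q)) * ∫⁻ x in {x | ENNReal.ofReal (K * t) < F x}, F x ^ q ∂μ) :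
    ∫⁻ x, H x ^ p ∂μ ≤ ENNReal.ofReal p *
      (c₁ * ENNReal.ofReal (K ^ (2 - p) / (2 - p)) + c₂ * ENNReal.ofReal (K ^ (q - p) / (p - q))) *
        ∫⁻ x, F x ^ p ∂μ := by
  have hp : 0 < p := hq.trans hqp
  have hK' : ∀ t : ℝ, ENNReal.ofReal (K * t) = ENNReal.ofReal K * ENNReal.ofReal t := fun t =>
    ENNReal.ofReal_mul hK.le
  have hK0 : ENNReal.ofReal K ≠ 0 := by simpa using hK
  have hKt : ENNReal.ofReal K ≠ ∞ := by simp
  have hm1 : Measurable (({y : α × ℝ | F y.1 ≤ ENNReal.ofReal (K * y.2)}).indicator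
        (fun y => F y.1 ^ (2 : ℝ) * ENNReal.ofReal (y.2 ^ (-(2 - p) - 1)))) :=
    Measurable.indicator (by fun_prop) (measurableSet_le (by fun_prop) (by fun_prop))
  have hm2 : Measurable (({y : α × ℝ | ENNReal.ofReal (K * y.2) < F y.1}).indicator
        (fun y => F y.1 ^ q * ENNReal.ofReal (y.2 ^ (p - q - 1)))) :=
    Measurable.indicator (by fun_prop) (measurableSet_lt (by fun_prop) (by fun_prop))
  -- For fixed `x` the integral runs over `t ≥ F x / K`, where the power is integrable at infinity
  -- because `p < 2`; the companion `e2` runs over `t < F x / K` and converges at `0` because `q <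
  -- p`.
  have e1 : ∀ x, ∫⁻ t in Ioi (0 : ℝ), ({y : α × ℝ | F y.1 ≤ ENNReal.ofReal (K * y.2)}).indicator
        (fun y => F y.1 ^ (2 : ℝ) * ENNReal.ofReal (y.2 ^ (-(2 - p) - 1))) (x, t) ≤
        ENNReal.ofReal (K ^ (2 - p) / (2 - p)) * F x ^ p := by
    intro x
    rcases eq_or_ne (F x) 0 with h0 | h0
    · simp [indicator, h0]
    have hs : ∀ t : ℝ, ({y : α × ℝ | F y.1 ≤ ENNReal.ofReal (K * y.2)}).indicator
        (fun y => F y.1 ^ (2 : ℝ) * ENNReal.ofReal (y.2 ^ (-(2 - p) - 1))) (x, t) =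
        F x ^ (2 : ℝ) * ({t | F x / ENNReal.ofReal K ≤ ENNReal.ofReal t} : Set ℝ).indicator
        (fun t => ENNReal.ofReal (t ^ (-(2 - p) - 1))) t := by
      intro t
      have : F x / ENNReal.ofReal K ≤ ENNReal.ofReal t ↔ F x ≤ ENNReal.ofReal (K * t) := by
        rw [hK', ENNReal.div_le_iff hK0 hKt, mul_comm]
      by_cases hh : F x ≤ ENNReal.ofReal (K * t) <;> simp [indicator, this, hh]
    simp_rw [hs]
    have hmm : Measurable (({t | F x / ENNReal.ofReal K ≤ ENNReal.ofReal t} : Set ℝ).indicator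
        (fun t => ENNReal.ofReal (t ^ (-(2 - p) - 1)))) :=
      Measurable.indicator (by fun_prop) (measurableSet_le (by fun_prop) (by fun_prop))
    rw [lintegral_const_mul _ hmm, lintegral_indicator_ge_rpow (by linarith)
      (ENNReal.div_ne_zero.2 ⟨h0, hKt⟩)]
    rcases eq_or_ne (F x) ∞ with ht | ht
    · rw [ht, ENNReal.top_div_of_ne_top hKt, ENNReal.top_rpow_of_neg (by linarith : -(2 - p) < 0)]
      simp
    · lift F x to ℝ≥0 using ht with y
      have hy : 0 < y := by
        rw [pos_iff_ne_zero]; simpa using h0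
      have hy' : (0 : ℝ) < y := hy
      rw [← ENNReal.ofReal_coe_nnreal, ← ENNReal.ofReal_div_of_pos hK,
        ENNReal.ofReal_rpow_of_pos hy', ENNReal.ofReal_rpow_of_pos hy',
        ENNReal.ofReal_rpow_of_pos (by positivity), ← ENNReal.ofReal_div_of_pos (by linarith),
        ← ENNReal.ofReal_mul (by positivity),
        ← ENNReal.ofReal_mul (div_nonneg (by positivity) (by linarith))]
      refine le_of_eq (congrArg _ ?_)
      rw [Real.div_rpow hy'.le hK.le, Real.rpow_neg hK.le, Real.rpow_neg hy'.le,
        Real.rpow_sub hy']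
      have := (Real.rpow_pos_of_pos hy' p).ne'
      have := (Real.rpow_pos_of_pos hy' 2).ne'
      have := (Real.rpow_pos_of_pos hK (2 - p)).ne'
      have : 2 - p ≠ 0 := by linarith
      field_simp
  have e2 : ∀ x, ∫⁻ t in Ioi (0 : ℝ), ({y : α × ℝ | ENNReal.ofReal (K * y.2) < F y.1}).indicator
        (fun y => F y.1 ^ q * ENNReal.ofReal (y.2 ^ (p - q - 1))) (x, t) ≤
        ENNReal.ofReal (K ^ (q - p) / (p - q)) * F x ^ p := by
    intro x
    have hs : ∀ t : ℝ, ({y : α × ℝ | ENNReal.ofReal (K * y.2) < F y.1}).indicator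
        (fun y => F y.1 ^ q * ENNReal.ofReal (y.2 ^ (p - q - 1))) (x, t) =
        F x ^ q * ({t | ENNReal.ofReal t < F x / ENNReal.ofReal K} : Set ℝ).indicator
        (fun t => ENNReal.ofReal (t ^ (p - q - 1))) t := by
      intro t
      have : ENNReal.ofReal t < F x / ENNReal.ofReal K ↔ ENNReal.ofReal (K * t) < F x := by
        rw [hK', ENNReal.lt_div_iff_mul_lt (Or.inl hK0) (Or.inl hKt), mul_comm]
      by_cases hh : ENNReal.ofReal (K * t) < F x <;> simp [indicator, this, hh]
    simp_rw [hs]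
    have hmm : Measurable (({t | ENNReal.ofReal t < F x / ENNReal.ofReal K} : Set ℝ).indicator
        (fun t => ENNReal.ofReal (t ^ (p - q - 1)))) :=
      Measurable.indicator (by fun_prop) (measurableSet_lt (by fun_prop) (by fun_prop))
    rw [lintegral_const_mul _ hmm, lintegral_indicator_lt_rpow (by linarith)]
    rcases eq_or_ne (F x) ∞ with ht | ht
    · rw [ht, ENNReal.top_rpow_of_pos hp, ENNReal.mul_top]
      · exact le_top
      · rw [ENNReal.ofReal_ne_zero_iff]
        exact div_pos (by positivity) (by linarith)
    · lift F x to ℝ≥0 using ht with y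
      rcases eq_or_ne y 0 with hy | hy
      · simp [hy, hq, hp]
      have hy' : (0 : ℝ) < y := by positivity
      rw [← ENNReal.ofReal_coe_nnreal, ← ENNReal.ofReal_div_of_pos hK,
        ENNReal.ofReal_rpow_of_pos hy', ENNReal.ofReal_rpow_of_pos hy',
        ENNReal.ofReal_rpow_of_pos (by positivity), ← ENNReal.ofReal_div_of_pos (by linarith),
        ← ENNReal.ofReal_mul (by positivity),
        ← ENNReal.ofReal_mul (div_nonneg (by positivity) (by linarith))]
      refine le_of_eq (congrArg _ ?_)
      rw [show q - p = -(p - q) by ring, Real.div_rpow hy'.le hK.le, Real.rpow_neg hK.le,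
        Real.rpow_sub hy']
      have := (Real.rpow_pos_of_pos hy' p).ne'
      have := (Real.rpow_pos_of_pos hy' q).ne'
      have := (Real.rpow_pos_of_pos hK (p - q)).ne'
      have : p - q ≠ 0 := by linarith
      field_simp
  have i1 : ∀ t : ℝ, (∫⁻ x in {x | F x ≤ ENNReal.ofReal (K * t)}, F x ^ (2 : ℝ) ∂μ) *
      ENNReal.ofReal (t ^ (-(2 - p) - 1)) =
      ∫⁻ x, ({y : α × ℝ | F y.1 ≤ ENNReal.ofReal (K * y.2)}).indicator
        (fun y => F y.1 ^ (2 : ℝ) * ENNReal.ofReal (y.2 ^ (-(2 - p) - 1))) (x, t) ∂μ := by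
    intro t
    rw [← lintegral_mul_const _ (by fun_prop),
      ← lintegral_indicator (measurableSet_le hF measurable_const)]
    rfl
  have i2 : ∀ t : ℝ, (∫⁻ x in {x | ENNReal.ofReal (K * t) < F x}, F x ^ q ∂μ) *
      ENNReal.ofReal (t ^ (p - q - 1)) =
      ∫⁻ x, ({y : α × ℝ | ENNReal.ofReal (K * y.2) < F y.1}).indicator
        (fun y => F y.1 ^ q * ENNReal.ofReal (y.2 ^ (p - q - 1))) (x, t) ∂μ := by
    intro t
    rw [← lintegral_mul_const _ (by fun_prop),
      ← lintegral_indicator (measurableSet_lt measurable_const hF)]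
    rfl
  rw [lintegral_rpow_eq_lintegral_meas_lt hp hH, mul_assoc]
  gcongr
  calc ∫⁻ t in Ioi (0 : ℝ), μ {x | ENNReal.ofReal t < H x} * ENNReal.ofReal (t ^ (p - 1))
      ≤ ∫⁻ t in Ioi (0 : ℝ),
        (c₁ * ∫⁻ x, ({y : α × ℝ | F y.1 ≤ ENNReal.ofReal (K * y.2)}).indicator
        (fun y => F y.1 ^ (2 : ℝ) * ENNReal.ofReal (y.2 ^ (-(2 - p) - 1))) (x, t) ∂μ) +
        c₂ * ∫⁻ x, ({y : α × ℝ | ENNReal.ofReal (K * y.2) < F y.1}).indicator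
        (fun y => F y.1 ^ q * ENNReal.ofReal (y.2 ^ (p - q - 1))) (x, t) ∂μ := by
        refine setLIntegral_mono' measurableSet_Ioi fun t ht => ?_
        have ht : 0 < t := ht
        rw [← i1, ← i2]
        refine (mul_le_mul_left (h t ht) _).trans (le_of_eq ?_)
        rw [add_mul, show -(2 - p) - 1 = -2 + (p - 1) by ring,
          show p - q - 1 = -q + (p - 1) by ring, Real.rpow_add ht (-2), Real.rpow_add ht (-q),
          ENNReal.ofReal_mul (by positivity : 0 ≤ t ^ (-2 : ℝ)),
          ENNReal.ofReal_mul (by positivity : 0 ≤ t ^ (-q))]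
        ring
    _ = c₁ * (∫⁻ x, (∫⁻ t in Ioi (0 : ℝ), ({y : α × ℝ | F y.1 ≤ ENNReal.ofReal (K * y.2)}).indicator
        (fun y => F y.1 ^ (2 : ℝ) * ENNReal.ofReal (y.2 ^ (-(2 - p) - 1))) (x, t)) ∂μ) +
        c₂ * ∫⁻ x, (∫⁻ t in Ioi (0 : ℝ), ({y : α × ℝ | ENNReal.ofReal (K * y.2) < F y.1}).indicator
        (fun y => F y.1 ^ q * ENNReal.ofReal (y.2 ^ (p - q - 1))) (x, t)) ∂μ := by
        rw [lintegral_add_left (hm1.lintegral_prod_left'.const_mul _),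
          lintegral_const_mul _ hm1.lintegral_prod_left',
          lintegral_const_mul _ hm2.lintegral_prod_left',
          lintegral_lintegral_swap (f := fun x t => ({y : α × ℝ | F y.1 ≤ ENNReal.ofReal (K * y.2)}).indicator
        (fun y => F y.1 ^ (2 : ℝ) * ENNReal.ofReal (y.2 ^ (-(2 - p) - 1))) (x, t))
            hm1.aemeasurable,
          lintegral_lintegral_swap (f := fun x t => ({y : α × ℝ | ENNReal.ofReal (K * y.2) < F y.1}).indicator
        (fun y => F y.1 ^ q * ENNReal.ofReal (y.2 ^ (p - q - 1))) (x, t))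
            hm2.aemeasurable]
    _ ≤ c₁ * (∫⁻ x, ENNReal.ofReal (K ^ (2 - p) / (2 - p)) * F x ^ p ∂μ) +
        c₂ * ∫⁻ x, ENNReal.ofReal (K ^ (q - p) / (p - q)) * F x ^ p ∂μ := by
        gcongr
        · exact e1 _
        · exact e2 _
    _ = _ := by
        rw [lintegral_const_mul _ (by fun_prop), lintegral_const_mul _ (by fun_prop)]
        ring

end Lp

/-! ### Shifted dyadic maximal functions. -/

noncomputable section

section ShiftedMaximal

open Module Metric

variable {V : Type*} [NormedAddCommGroup V] [InnerProductSpace ℝ V] [FiniteDimensional ℝ V]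
  [MeasurableSpace V] [BorelSpace V]

/-- The dyadic maximal function along balls of relative radius `ρ`, shifted by `z`:
`sup_l (2ˡρ)⁻ᵈ ∫_{B(x - 2ˡz, 2ˡρ)} F`. -/
def shiftedMax (z : V) (ρ : ℝ) (F : V → ℝ≥0∞) (x : V) : ℝ≥0∞ :=
  ⨆ l : ℤ, (ENNReal.ofReal (((2 : ℝ) ^ l * ρ) ^ finrank ℝ V))⁻¹ *
    ∫⁻ y in closedBall (x - (2 : ℝ) ^ l • z) ((2 : ℝ) ^ l * ρ), F y

/-- Joint measurability in shift and point is needed because kernels are later averaged over shifts,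
and Tonelli exchanges that average with the integral in `x`. -/
theorem measurable_shiftedMax_prod (ρ : ℝ) {F : V → ℝ≥0∞} (hF : Measurable F) :
    Measurable fun q : V × V => shiftedMax q.1 ρ F q.2 := by
  refine Measurable.iSup fun l => Measurable.const_mul ?_ _
  have hm : Measurable (({q : (V × V) × V |
      dist q.2 (q.1.2 - (2 : ℝ) ^ l • q.1.1) ≤ (2 : ℝ) ^ l * ρ}).indicator fun q => F q.2) :=
    (hF.comp measurable_snd).indicator (measurableSet_le (by fun_prop) (by fun_prop))
  convert hm.lintegral_prod_right' (ν := (volume : Measure V)) using 2 with q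
  rw [← lintegral_indicator measurableSet_closedBall]
  rfl

theorem measurable_shiftedMax (z : V) (ρ : ℝ) {F : V → ℝ≥0∞} (hF : Measurable F) :
    Measurable (shiftedMax z ρ F) := by
  change Measurable ((fun q : V × V => shiftedMax q.1 ρ F q.2) ∘ Prod.mk z)
  exact (measurable_shiftedMax_prod ρ hF).comp measurable_prodMk_left

theorem measurable_shiftedMax_left (x : V) (ρ : ℝ) {F : V → ℝ≥0∞} (hF : Measurable F) :
    Measurable fun z => shiftedMax z ρ F x := by
  change Measurable ((fun q : V × V => shiftedMax q.1 ρ F q.2) ∘ fun z => (z, x))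
  exact (measurable_shiftedMax_prod ρ hF).comp measurable_prodMk_right

theorem shiftedMax_mono (z : V) (ρ : ℝ) {F G : V → ℝ≥0∞} (h : ∀ x, F x ≤ G x) (x : V) :
    shiftedMax z ρ F x ≤ shiftedMax z ρ G x := by
  unfold shiftedMax
  gcongr
  exact h _

theorem shiftedMax_add_le (z : V) (ρ : ℝ) {F G : V → ℝ≥0∞} (hF : Measurable F) (x : V) :
    shiftedMax z ρ (fun y => F y + G y) x ≤ shiftedMax z ρ F x + shiftedMax z ρ G x := by
  refine iSup_le fun l => ?_
  rw [lintegral_add_left hF, mul_add]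
  exact add_le_add (le_iSup_of_le l le_rfl) (le_iSup_of_le l le_rfl)

theorem volume_closedBall_eq_ofReal_pow (x : V) {r : ℝ} (hr : 0 ≤ r) :
    volume (closedBall x r) = ENNReal.ofReal (r ^ finrank ℝ V) * volume (closedBall (0 : V) 1) := by
  have := Measure.addHaar_closedBall_mul (volume : Measure V) x hr (zero_le_one)
  simpa using this

theorem shiftedMax_le_of_le (z : V) {ρ : ℝ} (hρ : 0 < ρ) {F : V → ℝ≥0∞} {M : ℝ≥0∞}
    (h : ∀ x, F x ≤ M) (x : V) :
    shiftedMax z ρ F x ≤ volume (closedBall (0 : V) 1) * M := by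
  refine iSup_le fun l => ?_
  have hr : 0 < (2 : ℝ) ^ l * ρ := by positivity
  calc _ ≤ (ENNReal.ofReal (((2 : ℝ) ^ l * ρ) ^ finrank ℝ V))⁻¹ *
        ∫⁻ y in closedBall (x - (2 : ℝ) ^ l • z) ((2 : ℝ) ^ l * ρ), M := by
        gcongr
        exact h _
    _ = volume (closedBall (0 : V) 1) * M := by
        rw [setLIntegral_const, volume_closedBall_eq_ofReal_pow _ hr.le, mul_comm M, mul_assoc,
          ← mul_assoc, ENNReal.inv_mul_cancel, one_mul]
        · simpa using by positivity
        · simp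

/-- The weak type `(1, 1)` bound of the shifted maximal function, with a constant depending
logarithmically on the eccentricity `‖z‖ / ρ` of the shift. -/
theorem meas_lt_shiftedMax_le [Nontrivial V] {z : V} {ρ : ℝ} (hρ : 0 < ρ) {m : ℕ}
    (hz : ‖z‖ ≤ 2 ^ m * ρ) {F : V → ℝ≥0∞} {t : ℝ} (ht : 0 < t) :
    volume {x | ENNReal.ofReal t < shiftedMax z ρ F x} ≤
      ((m + 3 : ℕ) * (ENNReal.ofReal (4 ^ finrank ℝ V) * volume (closedBall (0 : V) 1))) *
        (ENNReal.ofReal t)⁻¹ * ∫⁻ x, F x := by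
  set v := volume (closedBall (0 : V) 1) with hv
  have hv0 : v ≠ 0 := (measure_closedBall_pos volume _ one_pos).ne'
  have hvt : v ≠ ∞ := measure_closedBall_lt_top.ne
  have ht0 : ENNReal.ofReal t ≠ 0 := by simpa using ht
  rcases eq_or_ne (∫⁻ x, F x) ∞ with hA | hA
  · rw [hA, ENNReal.mul_top]
    · exact le_top
    · refine mul_ne_zero (mul_ne_zero (by simp) (mul_ne_zero ?_ hv0)) (by simp)
      simp
  set d := finrank ℝ V with hd
  have hd0 : d ≠ 0 := finrank_pos.ne'
  set A := (∫⁻ x, F x).toReal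
  let r : V × ℤ → ℝ := fun a => (2 : ℝ) ^ a.2 * ρ
  have hr : ∀ a, 0 < r a := fun a => by positivity
  let B : V × ℤ → Set V := fun a => closedBall a.1 (r a)
  -- The balls are recorded by their shifted centre: a point `x` of the level set lies `2ˡ z` away
  -- from the centre of its ball.
  let T : Set (V × ℤ) := {a | ENNReal.ofReal t * ENNReal.ofReal (r a ^ d) < ∫⁻ y in B a, F y}
  -- Vitali's lemma needs bounded radii. If `r ≥ 1`, then `t r ≤ t rᵈ ≤ ∫ F` since `d ≥ 1`.
  have hT : ∀ a ∈ T, r a ≤ max 1 (A / t) := by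
    intro a ha
    rcases le_total (r a) 1 with h | h
    · exact h.trans (le_max_left _ _)
    refine le_trans ?_ (le_max_right _ _)
    have h1 : ENNReal.ofReal t * ENNReal.ofReal (r a ^ d) < ∫⁻ y, F y :=
      lt_of_lt_of_le ha (setLIntegral_le_lintegral _ _)
    rw [← ENNReal.ofReal_mul ht.le, ← ENNReal.ofReal_toReal hA] at h1
    have h2 : t * r a ^ d ≤ A := (ENNReal.ofReal_lt_ofReal_iff_of_nonneg
      (by have := hr a; positivity)).1 h1 |>.le
    rw [le_div_iff₀ ht, mul_comm]
    exact le_trans (by gcongr; exact le_self_pow₀ h hd0) h2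
  obtain ⟨u, huT, hdisj, hcov⟩ := Vitali.exists_disjoint_subfamily_covering_enlargement
    B T r 2 one_lt_two (fun a _ => (hr a).le) _ hT
    (fun a _ => ⟨a.1, mem_closedBall_self (hr a).le⟩)
  have hucount : u.Countable := hdisj.countable_of_nonempty_interior fun a _ =>
    ⟨a.1, interior_mono ball_subset_closedBall (by
      rw [isOpen_ball.interior_eq]; exact mem_ball_self (hr a))⟩
  -- A selected ball of scale `b.2` must absorb points coming from all scales `l ≤ b.2 + 1`. If `l +
  -- m < b.2`, the shift is shorter than the selected radius and plain enlargement (`i = 0`)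
  -- suffices. The remaining `m + 2` scales, coded as `l = b.2 + 2 - i`, each require one shifted
  -- copy; this is the source of the factor `m + 3`.
  let D : V × ℤ → Set V := fun b => ⋃ i ∈ Finset.range (m + 3),
    closedBall (b.1 + (if i = 0 then (0 : V) else (2 : ℝ) ^ (b.2 + 2 - (i : ℤ)) • z)) (4 * r b)
  have hsub : {x | ENNReal.ofReal t < shiftedMax z ρ F x} ⊆ ⋃ b ∈ u, D b := by
    intro x hx
    obtain ⟨l, hl⟩ := lt_iSup_iff.1 (show ENNReal.ofReal t < shiftedMax z ρ F x from hx)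
    let a : V × ℤ := (x - (2 : ℝ) ^ l • z, l)
    have ha : a ∈ T := by
      have h0 : ENNReal.ofReal (r a ^ d) ≠ 0 := by
        have := hr a
        simpa using by positivity
      rw [← ENNReal.div_eq_inv_mul, ENNReal.lt_div_iff_mul_lt (Or.inl h0) (Or.inl (by simp))] at hl
      exact hl
    obtain ⟨b, hb, ⟨w, hwa, hwb⟩, hab⟩ := hcov a ha
    refine mem_iUnion₂.2 ⟨b, hb, ?_⟩
    have hdist : ‖x - (2 : ℝ) ^ l • z - b.1‖ ≤ 3 * r b := by
      have h1 := mem_closedBall.1 hwa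
      have h2 := mem_closedBall.1 hwb
      rw [← dist_eq_norm]
      calc dist a.1 b.1 ≤ dist a.1 w + dist w b.1 := dist_triangle _ _ _
        _ ≤ r a + r b := by rw [dist_comm a.1]; gcongr
        _ ≤ 3 * r b := by linarith
    have hlb : l ≤ b.2 + 1 := by
      have h1 : (2 : ℝ) ^ l ≤ (2 : ℝ) ^ (b.2 + 1) := by
        rw [zpow_add_one₀ two_ne_zero]
        have h2 : (2 : ℝ) ^ l * ρ ≤ 2 * ((2 : ℝ) ^ b.2 * ρ) := hab
        nlinarith
      exact (zpow_le_zpow_iff_right₀ one_lt_two).1 h1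
    by_cases hlm : l + m < b.2
    · refine mem_iUnion₂.2 ⟨0, by simp, ?_⟩
      rw [mem_closedBall, dist_eq_norm]
      simp only [if_true, add_zero]
      have h3 : ‖(2 : ℝ) ^ l • z‖ ≤ r b := by
        rw [norm_smul, Real.norm_of_nonneg (by positivity)]
        calc (2 : ℝ) ^ l * ‖z‖ ≤ (2 : ℝ) ^ l * (2 ^ m * ρ) := by gcongr
          _ = (2 : ℝ) ^ (l + m) * ρ := by rw [zpow_add₀ two_ne_zero, zpow_natCast, mul_assoc]
          _ ≤ (2 : ℝ) ^ b.2 * ρ := by gcongr; norm_num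
      calc ‖x - b.1‖ = ‖(x - (2 : ℝ) ^ l • z - b.1) + (2 : ℝ) ^ l • z‖ := by congr 1; abel
        _ ≤ 3 * r b + r b := (norm_add_le _ _).trans (add_le_add hdist h3)
        _ = 4 * r b := by ring
    · refine mem_iUnion₂.2 ⟨(b.2 + 2 - l).toNat, ?_, ?_⟩
      · simp only [Finset.mem_range]; omega
      · rw [if_neg (by omega), Int.toNat_of_nonneg (by omega), mem_closedBall, dist_eq_norm]
        have : b.2 + 2 - (b.2 + 2 - l) = l := by ring
        rw [this]
        calc ‖x - (b.1 + (2 : ℝ) ^ l • z)‖ = ‖x - (2 : ℝ) ^ l • z - b.1‖ := by congr 1; abel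
          _ ≤ 4 * r b := by linarith [hr b]
  have hD : ∀ b ∈ u, volume (D b) ≤ ((m + 3 : ℕ) * (ENNReal.ofReal (4 ^ d) * v)) *
      ((ENNReal.ofReal t)⁻¹ * ∫⁻ y in B b, F y) := by
    intro b hb
    have h1 : ENNReal.ofReal (r b ^ d) ≤ (ENNReal.ofReal t)⁻¹ * ∫⁻ y in B b, F y := by
      rw [← ENNReal.div_eq_inv_mul, ENNReal.le_div_iff_mul_le (Or.inl ht0) (Or.inl (by simp)),
        mul_comm]
      exact (huT hb).le
    calc volume (D b) ≤ ∑ i ∈ Finset.range (m + 3), volume (closedBall (b.1 + (if i = 0 then (0 : V)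
            else (2 : ℝ) ^ (b.2 + 2 - (i : ℤ)) • z)) (4 * r b)) := measure_biUnion_finset_le _ _
      _ = (m + 3 : ℕ) * (ENNReal.ofReal ((4 * r b) ^ d) * v) := by
          have h4 : 0 ≤ 4 * r b := by linarith [hr b]
          simp_rw [volume_closedBall_eq_ofReal_pow _ h4]
          rw [Finset.sum_const, Finset.card_range, nsmul_eq_mul]
      _ = ((m + 3 : ℕ) * (ENNReal.ofReal (4 ^ d) * v)) * ENNReal.ofReal (r b ^ d) := by
          rw [mul_pow, ENNReal.ofReal_mul (by positivity)]; ring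
      _ ≤ _ := by gcongr
  calc volume {x | ENNReal.ofReal t < shiftedMax z ρ F x} ≤ volume (⋃ b ∈ u, D b) :=
        measure_mono hsub
    _ ≤ ∑' b : u, volume (D b) := measure_biUnion_le _ hucount _
    _ ≤ ∑' b : u, ((m + 3 : ℕ) * (ENNReal.ofReal (4 ^ d) * v)) *
        ((ENNReal.ofReal t)⁻¹ * ∫⁻ y in B b, F y) := by
        gcongr with b
        exact hD b b.2
    _ = ((m + 3 : ℕ) * (ENNReal.ofReal (4 ^ d) * v)) * (ENNReal.ofReal t)⁻¹ *
        ∫⁻ y in ⋃ b ∈ u, B b, F y := by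
        rw [ENNReal.tsum_mul_left, ENNReal.tsum_mul_left,
          lintegral_biUnion hucount (fun _ _ => measurableSet_closedBall) hdisj]
        simp only [mul_assoc]
        rfl
    _ ≤ _ := by
        gcongr
        exact Measure.restrict_le_self

/-- The strong type bound of the shifted maximal function. -/
theorem exists_lintegral_shiftedMax_rpow_le [Nontrivial V] {p : ℝ} (hp : 1 < p) (hp2 : p < 2) :
    ∃ C : ℝ≥0, ∀ (z : V) (ρ : ℝ) (m : ℕ) (F : V → ℝ≥0∞), 0 < ρ → ‖z‖ ≤ 2 ^ m * ρ → Measurable F →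
      ∫⁻ x, shiftedMax z ρ F x ^ p ≤ C * (m + 3 : ℕ) * ∫⁻ x, F x ^ p := by
  set v := volume (closedBall (0 : V) 1) with hv
  have hv0 : v ≠ 0 := (measure_closedBall_pos volume _ one_pos).ne'
  have hvt : v ≠ ∞ := measure_closedBall_lt_top.ne
  have hvr : 0 < v.toReal := ENNReal.toReal_pos hv0 hvt
  -- With this threshold the part of `F` below `K t` contributes at most `v K t = t / 2` to the
  -- maximal function.
  set K : ℝ := 1 / (2 * v.toReal) with hK
  have hK0 : 0 < K := by positivity
  set c : ℝ≥0∞ := ENNReal.ofReal p * ((ENNReal.ofReal (4 ^ finrank ℝ V) * v * ENNReal.ofReal 2) *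
    ENNReal.ofReal (K ^ (1 - p) / (p - 1))) with hc
  have hct : c ≠ ∞ := by
    refine ENNReal.mul_ne_top (by simp) (ENNReal.mul_ne_top (ENNReal.mul_ne_top
      (ENNReal.mul_ne_top (by simp) hvt) (by simp)) (by simp))
  refine ⟨c.toNNReal, fun z ρ m F hρ hz hF => ?_⟩
  rw [ENNReal.coe_toNNReal hct]
  -- The low part is absorbed by the sup bound, so the `L²` coefficient in the interpolation is `0`.
  have key := lintegral_rpow_le_of_meas_lt_le (μ := (volume : Measure V)) one_pos hp hp2 hK0 hF
    (measurable_shiftedMax z ρ hF) 0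
    ((m + 3 : ℕ) * (ENNReal.ofReal (4 ^ finrank ℝ V) * v) * ENNReal.ofReal 2) ?_
  · refine key.trans (le_of_eq ?_)
    rw [hc]
    ring
  intro t ht
  let G : V → ℝ≥0∞ := ({x | ENNReal.ofReal (K * t) < F x}).indicator F
  have hG : Measurable G := hF.indicator (measurableSet_lt measurable_const hF)
  have hFG : ∀ x, F x ≤ G x + ENNReal.ofReal (K * t) := by
    intro x
    by_cases hx : ENNReal.ofReal (K * t) < F x
    · simp [G, hx]
    · rw [show G x = 0 from indicator_of_notMem
        (s := {x | ENNReal.ofReal (K * t) < F x}) hx F, zero_add]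
      exact not_lt.1 hx
  have hsub : {x | ENNReal.ofReal t < shiftedMax z ρ F x} ⊆
      {x | ENNReal.ofReal (t / 2) < shiftedMax z ρ G x} := by
    intro x hx
    by_contra hcon
    simp only [mem_ofPred_eq, not_lt] at hcon hx
    refine absurd hx (not_lt.2 ?_)
    calc shiftedMax z ρ F x ≤ shiftedMax z ρ (fun y => G y + ENNReal.ofReal (K * t)) x :=
          shiftedMax_mono z ρ hFG x
      _ ≤ shiftedMax z ρ G x + shiftedMax z ρ (fun _ => ENNReal.ofReal (K * t)) x :=
          shiftedMax_add_le z ρ hG x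
      _ ≤ ENNReal.ofReal (t / 2) + v * ENNReal.ofReal (K * t) :=
          add_le_add hcon (shiftedMax_le_of_le z hρ (fun _ => le_rfl) x)
      _ = ENNReal.ofReal t := by
          rw [← ENNReal.ofReal_toReal hvt, ← ENNReal.ofReal_mul hvr.le,
            ← ENNReal.ofReal_add (by positivity) (by positivity)]
          congr 1
          rw [hK]
          field_simp
          norm_num
  refine (measure_mono hsub).trans ((meas_lt_shiftedMax_le hρ hz (half_pos ht)).trans ?_)
  rw [lintegral_indicator (measurableSet_lt measurable_const hF)]
  simp only [zero_mul, zero_add, ENNReal.rpow_one]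
  gcongr ?_ * _
  rw [mul_assoc _ (ENNReal.ofReal 2)]
  gcongr
  rw [← ENNReal.ofReal_mul (by norm_num), ← ENNReal.ofReal_inv_of_pos (by positivity),
    Real.rpow_neg_one]
  refine ENNReal.ofReal_le_ofReal (le_of_eq ?_)
  field_simp

/-- The dyadic Hardy–Littlewood maximal function (up to a normalizing factor). -/
def hlMax (F : V → ℝ≥0∞) (x : V) : ℝ≥0∞ := shiftedMax 0 1 F x

/-- The ball lies in the ball about `u` of any radius at least `2r`, and a dyadic radius exists in
`[2r, 4r)`; this costs the factor `4` and passes from dyadic centred averages to arbitrary ones. -/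
theorem lintegral_closedBall_le_hlMax (F : V → ℝ≥0∞) {x u : V} {r : ℝ} (hr : 0 < r)
    (h : ‖x - u‖ ≤ r) :
    ∫⁻ y in closedBall x r, F y ≤ ENNReal.ofReal ((4 * r) ^ finrank ℝ V) * hlMax F u := by
  obtain ⟨n, hn1, hn2⟩ := exists_mem_Ioc_zpow (x := 2 * r) (by positivity) (one_lt_two (α := ℝ))
  have hpos : (0 : ℝ) < 2 ^ (n + 1) := by positivity
  have h1 : ∫⁻ y in closedBall x r, F y ≤ ∫⁻ y in closedBall u (2 ^ (n + 1)), F y := by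
    refine lintegral_mono_set (closedBall_subset_closedBall' ?_)
    rw [dist_eq_norm]
    linarith
  have h2 : (ENNReal.ofReal ((2 : ℝ) ^ (n + 1)) ^ finrank ℝ V)⁻¹ *
      ∫⁻ y in closedBall u (2 ^ (n + 1)), F y ≤ hlMax F u := by
    refine le_iSup_of_le (n + 1) (le_of_eq ?_)
    rw [ENNReal.ofReal_pow (by positivity)]
    simp
  rw [ENNReal.inv_mul_le_iff] at h2
  · refine h1.trans (h2.trans ?_)
    gcongr
    rw [← ENNReal.ofReal_pow (by positivity)]
    refine ENNReal.ofReal_le_ofReal (pow_le_pow_left₀ hpos.le ?_ _)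
    rw [zpow_add_one₀ two_ne_zero]
    linarith
  · exact pow_ne_zero _ (by simpa using hpos)
  · exact ENNReal.pow_ne_top (by simp)

end ShiftedMaximal

end

/-! ### Characters, mollifiers and the frequency decomposition of a measure. -/

noncomputable section

section Mollify

open Module Metric
open scoped FourierTransform RealInnerProductSpace

variable {V : Type*} [NormedAddCommGroup V] [InnerProductSpace ℝ V] [FiniteDimensional ℝ V]
  [MeasurableSpace V] [BorelSpace V]

/-- The character `exp (-2πi v·ξ)`. -/
def fourierKernel (v ξ : V) : ℂ := Complex.exp ((-2 * Real.pi * ⟪v, ξ⟫ : ℝ) * Complex.I)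

theorem norm_fourierKernel (v ξ : V) : ‖fourierKernel v ξ‖ = 1 :=
  Complex.norm_exp_ofReal_mul_I _

theorem measurable_fourierKernel (ξ : V) : Measurable fun x : V => fourierKernel x ξ := by
  unfold fourierKernel
  exact Continuous.measurable (by fun_prop)

theorem fourierKernel_add_left (v w ξ : V) :
    fourierKernel (v + w) ξ = fourierKernel v ξ * fourierKernel w ξ := by
  unfold fourierKernel
  rw [← Complex.exp_add, inner_add_left]
  congr 1
  push_cast
  ring

theorem fourierKernel_smul_left (s : ℝ) (v ξ : V) :
    fourierKernel (s • v) ξ = fourierKernel v (s • ξ) := by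
  unfold fourierKernel
  rw [real_inner_smul_left, real_inner_smul_right]

theorem fourier_eq_integral_mul (f : V → ℂ) (ξ : V) :
    𝓕 f ξ = ∫ x, fourierKernel x ξ * f x := by
  rw [Real.fourier_eq']
  rfl

theorem integrable_fourierKernel_mul {σ : Measure V} {f : V → ℂ} (hf : Integrable f σ) (ξ : V) :
    Integrable (fun x => fourierKernel x ξ * f x) σ :=
  hf.bdd_mul (c := 1) (measurable_fourierKernel ξ).aestronglyMeasurable
    (Eventually.of_forall fun q => (norm_fourierKernel q ξ).le)

/-- The Fourier transform of a measure. -/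
def fourierMeasure (ν : Measure V) (ξ : V) : ℂ := ∫ v, fourierKernel v ξ ∂ν

/-- The Fourier transform of an average of translates. -/
theorem fourier_integral_translates {σ : Measure V} [SFinite σ] {F : V → ℂ} (hFm : Measurable F)
    (hF : Integrable F) {φ : V → ℂ} (hφ : Integrable φ σ) (s : ℝ) (ξ : V) :
    𝓕 (fun x => ∫ v, F (x - s • v) * φ v ∂σ) ξ =
      𝓕 F ξ * ∫ v, fourierKernel v (s • ξ) * φ v ∂σ := by
  have hint : Integrable (fun q : V × V => F (q.1 - s • q.2) * φ q.2) (volume.prod σ) := by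
    rw [integrable_prod_iff']
    · refine ⟨Eventually.of_forall fun v =>
        ((hF.comp_sub_right (s • v)).mul_const (φ v) :
          Integrable (fun x => F (x - s • v) * φ v)), ?_⟩
      have : ∀ v, ∫ x, ‖F (x - s • v) * φ v‖ = (∫ x, ‖F x‖) * ‖φ v‖ := by
        intro v
        simp_rw [norm_mul]
        rw [integral_mul_const, integral_sub_right_eq_self (fun x => ‖F x‖) (s • v)]
      simp only [this]
      exact hφ.norm.const_mul _
    · exact (hFm.comp (by fun_prop)).aestronglyMeasurable.mul hφ.1.comp_snd
  have hchar : Measurable fun q : V × V => fourierKernel q.1 ξ :=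
    (measurable_fourierKernel ξ).comp measurable_fst
  have hint2 : Integrable (fun q : V × V => fourierKernel q.1 ξ * (F (q.1 - s • q.2) * φ q.2))
      (volume.prod σ) :=
    hint.bdd_mul (c := 1) hchar.aestronglyMeasurable (Eventually.of_forall fun q =>
      (norm_fourierKernel q.1 ξ).le)
  rw [fourier_eq_integral_mul]
  simp only [← integral_const_mul]
  rw [integral_integral_swap hint2]
  refine integral_congr_ae (Eventually.of_forall fun v => ?_)
  simp only
  calc ∫ x, fourierKernel x ξ * (F (x - s • v) * φ v)
      = ∫ x, (fun x => fourierKernel (x + s • v) ξ * (F x * φ v)) (x - s • v) := by simp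
    _ = ∫ x, fourierKernel (x + s • v) ξ * (F x * φ v) :=
        integral_sub_right_eq_self (fun x => fourierKernel (x + s • v) ξ * (F x * φ v)) (s • v)
    _ = ∫ x, (fourierKernel x ξ * F x) * (fourierKernel v (s • ξ) * φ v) := by
        congr 1 with x
        rw [fourierKernel_add_left, fourierKernel_smul_left]
        ring
    _ = 𝓕 F ξ * (fourierKernel v (s • ξ) * φ v) := by
        rw [integral_mul_const, fourier_eq_integral_mul]

/-- Only nonnegativity, the Lipschitz bound and compact support of this bump are used. No decay of
its Fourier transform enters, so smoothness is unnecessary. -/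
def tent (x : V) : ℝ := max 0 (1 - ‖x‖)

theorem continuous_tent : Continuous (tent : V → ℝ) := by unfold tent; fun_prop

theorem tent_nonneg (x : V) : 0 ≤ tent x := le_max_left _ _

theorem tent_le_one (x : V) : tent x ≤ 1 := max_le zero_le_one (by simp)

theorem tent_eq_zero {x : V} (h : 1 ≤ ‖x‖) : tent x = 0 := max_eq_left (by linarith)

theorem abs_tent_sub_le (x y : V) : |tent x - tent y| ≤ ‖x - y‖ := by
  unfold tent
  refine (abs_max_sub_max_le_max _ _ _ _).trans ?_
  rw [sub_self, abs_zero, show 1 - ‖x‖ - (1 - ‖y‖) = ‖y‖ - ‖x‖ by ring, norm_sub_rev]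
  exact max_le (norm_nonneg _) (abs_norm_sub_norm_le _ _)

theorem hasCompactSupport_of_eq_zero {E : Type*} [Zero E] {f : V → E} {R : ℝ}
    (h : ∀ x, R < ‖x‖ → f x = 0) : HasCompactSupport f :=
  HasCompactSupport.intro (isCompact_closedBall (0 : V) R) fun x hx => h x (by simpa using hx)

theorem hasCompactSupport_tent : HasCompactSupport (tent : V → ℝ) :=
  hasCompactSupport_of_eq_zero (R := 1) fun _ hx => tent_eq_zero hx.le

theorem integral_tent_pos : 0 < ∫ x : V, tent x := by
  refine (continuous_tent.integral_pos_of_hasCompactSupport_nonneg_nonzero hasCompactSupport_tent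
    tent_nonneg (x := 0) ?_)
  simp [tent]

/-- The normalizing factor of the tent function. -/
def tentFactor (V : Type*) [NormedAddCommGroup V] [InnerProductSpace ℝ V] [FiniteDimensional ℝ V]
  [MeasurableSpace V] [BorelSpace V] : ℝ := (∫ x : V, tent x)⁻¹

theorem tentFactor_pos : 0 < tentFactor V := inv_pos.2 integral_tent_pos

/-- An approximate identity at scale `2⁻ⁿ`. -/
def mollifier (n : ℕ) (x : V) : ℝ :=
  tentFactor V * ((2 : ℝ) ^ n) ^ finrank ℝ V * tent ((2 : ℝ) ^ n • x)

theorem continuous_mollifier (n : ℕ) : Continuous (mollifier n : V → ℝ) := by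
  unfold mollifier
  exact continuous_const.mul (continuous_tent.comp (by fun_prop))

theorem mollifier_nonneg (n : ℕ) (x : V) : 0 ≤ mollifier n x :=
  mul_nonneg (mul_nonneg tentFactor_pos.le (by positivity)) (tent_nonneg _)

theorem mollifier_le (n : ℕ) (x : V) :
    mollifier n x ≤ tentFactor V * ((2 : ℝ) ^ n) ^ finrank ℝ V :=
  mul_le_of_le_one_right (mul_nonneg tentFactor_pos.le (by positivity)) (tent_le_one _)

theorem mollifier_eq_zero {n : ℕ} {x : V} (h : ((2 : ℝ) ^ n)⁻¹ ≤ ‖x‖) : mollifier n x = 0 := by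
  unfold mollifier
  rw [tent_eq_zero, mul_zero]
  rw [norm_smul, Real.norm_of_nonneg (by positivity)]
  rwa [inv_le_iff_one_le_mul₀' (by positivity)] at h

theorem abs_mollifier_sub_le (n : ℕ) (x y : V) : |mollifier n x - mollifier n y| ≤
    tentFactor V * ((2 : ℝ) ^ n) ^ (finrank ℝ V + 1) * ‖x - y‖ := by
  unfold mollifier
  have h0 : 0 ≤ tentFactor V * ((2 : ℝ) ^ n) ^ finrank ℝ V :=
    mul_nonneg tentFactor_pos.le (by positivity)
  rw [← mul_sub, abs_mul, abs_of_nonneg h0, pow_succ, ← mul_assoc, mul_assoc _ _ ‖x - y‖]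
  gcongr
  refine (abs_tent_sub_le _ _).trans ?_
  rw [← smul_sub, norm_smul, Real.norm_of_nonneg (by positivity)]

theorem hasCompactSupport_mollifier (n : ℕ) : HasCompactSupport (mollifier n : V → ℝ) :=
  hasCompactSupport_of_eq_zero (R := ((2 : ℝ) ^ n)⁻¹) fun _ hx => mollifier_eq_zero hx.le

theorem integrable_mollifier (n : ℕ) : Integrable (mollifier n : V → ℝ) :=
  (continuous_mollifier n).integrable_of_hasCompactSupport (hasCompactSupport_mollifier n)

theorem integral_mollifier (n : ℕ) : ∫ x : V, mollifier n x = 1 := by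
  unfold mollifier
  rw [integral_const_mul, Measure.integral_comp_smul, abs_of_nonneg (by positivity), smul_eq_mul,
    tentFactor]
  have := (integral_tent_pos (V := V)).ne'
  field_simp

theorem norm_fourier_mollifier_sub_one_le (n : ℕ) (ξ : V) :
    ‖𝓕 (fun x : V => (mollifier n x : ℂ)) ξ - 1‖ ≤ 2 * Real.pi * (((2 : ℝ) ^ n)⁻¹ * ‖ξ‖) := by
  have h1 : (1 : ℂ) = ∫ x : V, (mollifier n x : ℂ) := by
    rw [integral_complex_ofReal, integral_mollifier, Complex.ofReal_one]
  have hi : Integrable (fun x : V => (mollifier n x : ℂ)) := (integrable_mollifier n).ofReal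
  rw [fourier_eq_integral_mul]
  nth_rw 1 [h1]
  rw [← integral_sub (integrable_fourierKernel_mul hi ξ) hi]
  calc ‖∫ x : V, (fourierKernel x ξ * (mollifier n x : ℂ) - (mollifier n x : ℂ))‖
      ≤ ∫ x : V, 2 * Real.pi * (((2 : ℝ) ^ n)⁻¹ * ‖ξ‖) * mollifier n x := by
        refine norm_integral_le_of_norm_le ((integrable_mollifier n).const_mul _)
          (Eventually.of_forall fun x => ?_)
        rw [← sub_one_mul, norm_mul, Complex.norm_real, Real.norm_of_nonneg (mollifier_nonneg n x)]
        rcases le_total ((2 : ℝ) ^ n)⁻¹ ‖x‖ with hx | hx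
        · simp [mollifier_eq_zero hx]
        gcongr
        · exact mollifier_nonneg n x
        have := Real.norm_exp_I_mul_ofReal_sub_one_le (x := -2 * Real.pi * ⟪x, ξ⟫)
        rw [mul_comm Complex.I] at this
        refine this.trans ?_
        rw [norm_mul, norm_mul, norm_neg, Real.norm_two, Real.norm_of_nonneg Real.pi_pos.le]
        gcongr
        exact (norm_inner_le_norm _ _).trans (by gcongr)
    _ = _ := by rw [integral_const_mul, integral_mollifier, mul_one]

theorem norm_fourier_mollifier_le_one (n : ℕ) (ξ : V) :
    ‖𝓕 (fun x : V => (mollifier n x : ℂ)) ξ‖ ≤ 1 := by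
  refine (VectorFourier.norm_fourierIntegral_le_integral_norm _ _ _ _ _).trans ?_
  simp only [Complex.norm_real, Real.norm_of_nonneg (mollifier_nonneg n _)]
  rw [integral_mollifier]

/-- The mollification `ν * ψ_n` of a measure. -/
def smoothed (ν : Measure V) (n : ℕ) (y : V) : ℝ := ∫ v, mollifier n (y - v) ∂ν

/-- The part of `ν` at frequencies about `2ʲ`. -/
def piece (ν : Measure V) (j : ℕ) (y : V) : ℝ := smoothed ν (j + 1) y - smoothed ν j y

variable (ν : Measure V) [IsFiniteMeasure ν]

theorem integrable_mollifier_translate (n : ℕ) (y : V) :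
    Integrable (fun v => mollifier n (y - v)) ν :=
  Integrable.of_bound ((continuous_mollifier n).comp (by fun_prop)).aestronglyMeasurable
    (tentFactor V * ((2 : ℝ) ^ n) ^ finrank ℝ V) (Eventually.of_forall fun v => by
      rw [Real.norm_of_nonneg (mollifier_nonneg _ _)]; exact mollifier_le _ _)

theorem continuous_smoothed (n : ℕ) : Continuous (smoothed ν n) := by
  refine continuous_of_dominated (bound := fun _ => tentFactor V * ((2 : ℝ) ^ n) ^ finrank ℝ V)
    (fun y => (integrable_mollifier_translate ν n y).1) (fun y => Eventually.of_forall fun v => ?_)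
    (integrable_const _) (Eventually.of_forall fun v => (continuous_mollifier n).comp (by fun_prop))
  rw [Real.norm_of_nonneg (mollifier_nonneg _ _)]
  exact mollifier_le _ _

theorem smoothed_nonneg (n : ℕ) (y : V) : 0 ≤ smoothed ν n y :=
  integral_nonneg fun _ => mollifier_nonneg _ _

theorem smoothed_le (n : ℕ) (y : V) :
    smoothed ν n y ≤ tentFactor V * ((2 : ℝ) ^ n) ^ finrank ℝ V * ν.real univ := by
  refine (integral_mono (integrable_mollifier_translate ν n y) (integrable_const _)
    fun v => mollifier_le n _).trans ?_
  simp [mul_comm]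

variable {ν}

theorem smoothed_eq_zero {R : ℝ} (hR : ν (closedBall 0 R)ᶜ = 0) {n : ℕ} {y : V}
    (hy : R + 1 < ‖y‖) : smoothed ν n y = 0 := by
  refine integral_eq_zero_of_ae ?_
  have : ∀ᵐ v ∂ν, v ∈ closedBall (0 : V) R := by
    rw [ae_iff]; exact hR
  filter_upwards [this] with v hv
  refine mollifier_eq_zero ?_
  have h1 : ‖v‖ ≤ R := by simpa using hv
  have h2 : ((2 : ℝ) ^ n)⁻¹ ≤ 1 := inv_le_one_of_one_le₀ (one_le_pow₀ one_le_two)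
  have h3 := norm_sub_norm_le y v
  linarith

variable (ν)

theorem continuous_piece (j : ℕ) : Continuous (piece ν j) :=
  (continuous_smoothed ν _).sub (continuous_smoothed ν _)

variable {ν}

theorem piece_eq_zero {R : ℝ} (hR : ν (closedBall 0 R)ᶜ = 0) {j : ℕ} {y : V}
    (hy : R + 1 < ‖y‖) : piece ν j y = 0 := by
  simp [piece, smoothed_eq_zero hR hy]

theorem integrable_smoothed {R : ℝ} (hR : ν (closedBall 0 R)ᶜ = 0) (n : ℕ) :
    Integrable (smoothed ν n) :=
  (continuous_smoothed ν n).integrable_of_hasCompactSupport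
    (hasCompactSupport_of_eq_zero fun _ => smoothed_eq_zero hR)

theorem integrable_piece {R : ℝ} (hR : ν (closedBall 0 R)ᶜ = 0) (n : ℕ) :
    Integrable (piece ν n) := (integrable_smoothed hR _).sub (integrable_smoothed hR _)

variable (ν)

theorem fourier_smoothed (n : ℕ) (ξ : V) : 𝓕 (fun y => (smoothed ν n y : ℂ)) ξ =
    𝓕 (fun x : V => (mollifier n x : ℂ)) ξ * fourierMeasure ν ξ := by
  have h := fourier_integral_translates (σ := ν) (F := fun x : V => (mollifier n x : ℂ))
    (Complex.measurable_ofReal.comp (continuous_mollifier n).measurable)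
    (integrable_mollifier n).ofReal (φ := fun _ => 1) (integrable_const _) 1 ξ
  simp only [one_smul, mul_one] at h
  rw [fourierMeasure, ← h]
  refine congrArg (fun f : V → ℂ => (𝓕 f : V → ℂ) ξ) (funext fun y => ?_)
  rw [smoothed, integral_complex_ofReal]

variable {ν}

/-- The difference of two mollifier multipliers is at most `2` everywhere and `O(2^(-j)|ξ|)` near
the origin, hence `O((2^(-j)|ξ|)^s)` for each `0 ≤ s ≤ 1`. The exponent trades decay in `ξ` for
decay in `j`; the `L²` norm of a piece and its square function use different values of `s`. -/
theorem norm_fourier_piece_le {R : ℝ} (hR : ν (closedBall 0 R)ᶜ = 0) (j : ℕ) (ξ : V) {s : ℝ}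
    (hs : 0 ≤ s) (hs1 : s ≤ 1) :
    ‖𝓕 (fun y => (piece ν j y : ℂ)) ξ‖ ≤
      4 * Real.pi * (((2 : ℝ) ^ j)⁻¹ * ‖ξ‖) ^ s * ‖fourierMeasure ν ξ‖ := by
  have h1 : 𝓕 (fun y => (piece ν j y : ℂ)) ξ =
      (𝓕 (fun x : V => (mollifier (j + 1) x : ℂ)) ξ - 𝓕 (fun x : V => (mollifier j x : ℂ)) ξ) *
        fourierMeasure ν ξ := by
    rw [sub_mul, ← fourier_smoothed, ← fourier_smoothed]
    have hi1 : Integrable (fun x => (smoothed ν (j + 1) x : ℂ)) :=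
      (integrable_smoothed hR (j + 1)).ofReal
    have hi2 : Integrable (fun x => (smoothed ν j x : ℂ)) := (integrable_smoothed hR j).ofReal
    simp only [fourier_eq_integral_mul]
    rw [← integral_sub (integrable_fourierKernel_mul hi1 ξ) (integrable_fourierKernel_mul hi2 ξ)]
    congr 1 with v
    simp [piece, mul_sub]
  rw [h1, norm_mul]
  gcongr
  set u := ((2 : ℝ) ^ j)⁻¹ * ‖ξ‖ with hu
  have hu0 : 0 ≤ u := by positivity
  have hpi := Real.pi_gt_three
  rcases le_total 1 u with h | h
  · calc _ ≤ (1 : ℝ) + 1 := (norm_sub_le _ _).trans (add_le_add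
        (norm_fourier_mollifier_le_one _ _) (norm_fourier_mollifier_le_one _ _))
      _ ≤ 4 * Real.pi * 1 := by linarith
      _ ≤ 4 * Real.pi * u ^ s := by
        gcongr
        exact Real.one_le_rpow h hs
  · have h2 := norm_fourier_mollifier_sub_one_le (j + 1) ξ
    have h3 := norm_fourier_mollifier_sub_one_le j ξ
    have h4 : ((2 : ℝ) ^ (j + 1))⁻¹ * ‖ξ‖ ≤ u := by
      rw [hu]
      gcongr
      · norm_num
      · omega
    calc _ = ‖(𝓕 (fun x : V => (mollifier (j + 1) x : ℂ)) ξ - 1) -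
          (𝓕 (fun x : V => (mollifier j x : ℂ)) ξ - 1)‖ := by congr 1; ring
      _ ≤ 2 * Real.pi * u + 2 * Real.pi * u := by
          refine (norm_sub_le _ _).trans (add_le_add (h2.trans ?_) h3)
          gcongr
      _ = 4 * Real.pi * u := by ring
      _ ≤ 4 * Real.pi * u ^ s := by
          gcongr
          exact Real.self_le_rpow_of_le_one hu0 h hs1

end Mollify

end

/-! ### Decay of the pieces, square functions and the `L²` bound over nets. -/

noncomputable section

section SquareFunction

open Module Metric
open scoped FourierTransform RealInnerProductSpace

/-- A dyadic sum of a bump in the logarithmic scale is bounded. -/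
theorem exists_tsum_int_rpow_le {α β : ℝ} (hα : 0 < α) (hβ : 0 < β) :
    ∃ K : ℝ≥0, ∀ u : ℝ, 0 ≤ u →
      ∑' l : ℤ, ENNReal.ofReal (((2 : ℝ) ^ l * u) ^ α * (1 + (2 : ℝ) ^ l * u) ^ (-(α + β))) ≤ K := by
  set c := min α β with hc
  have hc0 : 0 < c := lt_min hα hβ
  set r : ℝ := (2 : ℝ) ^ (-c) with hr
  have hr0 : 0 < r := by positivity
  have hr1 : r < 1 := Real.rpow_lt_one_of_one_lt_of_neg one_lt_two (by linarith)
  have hs : Summable fun l : ℤ => (2 : ℝ) ^ α * r ^ l.natAbs := by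
    refine Summable.mul_left _ (Summable.of_nat_of_neg ?_ ?_)
    · simpa using summable_geometric_of_lt_one hr0.le hr1
    · simpa using summable_geometric_of_lt_one hr0.le hr1
  have hnat : ∀ k : ℕ, r ^ k = (2 : ℝ) ^ (-(c * k)) := by
    intro k
    rw [hr, ← Real.rpow_natCast, ← Real.rpow_mul (by norm_num), neg_mul]
  -- For `u` in `[1, 2)` the terms are geometric on both sides, like `2^(-βl)` for `l ≥ 0` and
  -- `2^(-α|l|)` for `l ≤ 0`. A general `u > 0` is brought here by translating the summation index.
  have key : ∀ u : ℝ, 1 ≤ u → u < 2 → ∀ l : ℤ,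
      ((2 : ℝ) ^ l * u) ^ α * (1 + (2 : ℝ) ^ l * u) ^ (-(α + β)) ≤ (2 : ℝ) ^ α * r ^ l.natAbs := by
    intro u hu1 hu2 l
    have hu0 : 0 < u := by linarith
    set w := (2 : ℝ) ^ l * u with hw
    have hw0 : 0 < w := by positivity
    rw [hnat]
    rcases le_total 0 l with hl | hl
    · have h1 : (1 + w) ^ (-(α + β)) ≤ w ^ (-(α + β)) :=
        Real.rpow_le_rpow_of_nonpos hw0 (by linarith) (by linarith)
      have h2 : (2 : ℝ) ^ (l.natAbs : ℝ) ≤ w := by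
        rw [Real.rpow_natCast, ← zpow_natCast, Int.natCast_natAbs, abs_of_nonneg hl, hw]
        exact le_mul_of_one_le_right (by positivity) hu1
      calc w ^ α * (1 + w) ^ (-(α + β)) ≤ w ^ α * w ^ (-(α + β)) := by gcongr
        _ = w ^ (-β) := by rw [← Real.rpow_add hw0]; congr 1; ring
        _ ≤ ((2 : ℝ) ^ (l.natAbs : ℝ)) ^ (-β) :=
          Real.rpow_le_rpow_of_nonpos (by positivity) h2 (by linarith)
        _ = (2 : ℝ) ^ (-(β * l.natAbs)) := by
          rw [← Real.rpow_mul (by norm_num)]; congr 1; ring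
        _ ≤ (2 : ℝ) ^ (-(c * l.natAbs)) := by
          gcongr
          · norm_num
          · exact min_le_right _ _
        _ ≤ (2 : ℝ) ^ α * (2 : ℝ) ^ (-(c * l.natAbs)) :=
          le_mul_of_one_le_left (by positivity) (Real.one_le_rpow one_le_two hα.le)
    · have h1 : (1 + w) ^ (-(α + β)) ≤ 1 :=
        Real.rpow_le_one_of_one_le_of_nonpos (by linarith) (by linarith)
      have h2 : (2 : ℝ) ^ l = (2 : ℝ) ^ (-(l.natAbs : ℝ)) := by
        rw [← Real.rpow_intCast]
        congr 1
        have : (l : ℝ) = -((-l : ℤ) : ℝ) := by simp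
        rw [this, ← abs_of_nonpos hl, ← Int.natCast_natAbs]
        simp
      calc w ^ α * (1 + w) ^ (-(α + β)) ≤ w ^ α * 1 := by gcongr
        _ = u ^ α * (2 : ℝ) ^ (-(α * l.natAbs)) := by
          rw [mul_one, hw, Real.mul_rpow (by positivity) hu0.le, h2,
            ← Real.rpow_mul (by norm_num), mul_comm]
          congr 2
          ring
        _ ≤ (2 : ℝ) ^ α * (2 : ℝ) ^ (-(c * l.natAbs)) := by
          gcongr
          · norm_num
          · exact min_le_left _ _
  refine ⟨(∑' l : ℤ, (2 : ℝ) ^ α * r ^ l.natAbs).toNNReal, fun u hu => ?_⟩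
  change _ ≤ ENNReal.ofReal _
  rcases hu.eq_or_lt with rfl | hu
  · simp [Real.zero_rpow hα.ne']
  obtain ⟨n, hn1, hn2⟩ := exists_mem_Ico_zpow hu (one_lt_two (α := ℝ))
  have h2n : (0 : ℝ) < 2 ^ n := by positivity
  rw [ENNReal.ofReal_tsum_of_nonneg (fun l => by positivity) hs,
    ← (Equiv.subRight n).tsum_eq (fun l : ℤ =>
      ENNReal.ofReal (((2 : ℝ) ^ l * u) ^ α * (1 + (2 : ℝ) ^ l * u) ^ (-(α + β))))]
  refine ENNReal.tsum_le_tsum fun l => ENNReal.ofReal_le_ofReal ?_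
  have := key (u / 2 ^ n) (by rwa [le_div_iff₀ h2n, one_mul])
    (by rwa [div_lt_iff₀ h2n, ← zpow_one_add₀ two_ne_zero, add_comm]) l
  have e : (2 : ℝ) ^ l * (u / 2 ^ n) = (2 : ℝ) ^ (Equiv.subRight n l) * u := by
    simp only [Equiv.subRight_apply]
    rw [zpow_sub₀ two_ne_zero]
    ring
  rwa [e] at this

variable {V : Type*} [NormedAddCommGroup V] [InnerProductSpace ℝ V] [FiniteDimensional ℝ V]
  [MeasurableSpace V] [BorelSpace V]

theorem Continuous.memLp_of_eq_zero {f : V → ℝ} (hf : Continuous f) {R : ℝ}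
    (h : ∀ x, R < ‖x‖ → f x = 0) (p : ℝ≥0∞) : MemLp (fun x => (f x : ℂ)) p :=
  (Complex.continuous_ofReal.comp hf).memLp_of_hasCompactSupport
    (hasCompactSupport_of_eq_zero (R := R) fun x hx => by simp [h x hx])

section Decay

variable {ν : Measure V} [IsFiniteMeasure ν] {R C a : ℝ}

theorem norm_fourier_piece_le_rpow (hR : ν (closedBall 0 R)ᶜ = 0)
    (hν : ∀ ξ, ‖fourierMeasure ν ξ‖ ≤ C * (1 + ‖ξ‖) ^ (-a)) {s : ℝ} (hs : 0 ≤ s) (hs1 : s ≤ 1)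
    (j : ℕ) (ξ : V) :
    ‖𝓕 (fun y => (piece ν j y : ℂ)) ξ‖ ≤
      4 * Real.pi * C * (2 : ℝ) ^ (-s * j) * (‖ξ‖ ^ s * (1 + ‖ξ‖) ^ (-a)) := by
  refine (norm_fourier_piece_le hR j ξ hs hs1).trans ?_
  calc _ ≤ 4 * Real.pi * (((2 : ℝ) ^ j)⁻¹ * ‖ξ‖) ^ s * (C * (1 + ‖ξ‖) ^ (-a)) := by
        gcongr
        exact hν ξ
    _ = _ := by
        rw [Real.mul_rpow (by positivity) (norm_nonneg _), ← Real.rpow_natCast,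
          ← Real.rpow_neg (by norm_num), ← Real.rpow_mul (by norm_num)]
        rw [show -(j : ℝ) * s = -s * j by ring]
        ring

/-- By Plancherel, after the factor `2^(-sj)` is extracted there remains `(1 + |ξ|)^(-(2a-2s))`,
integrable as long as `2a - 2s > d`. Thus the squared norm decays at nearly the rate `2^(-(2a-d)j)`.
-/
theorem exists_lintegral_fourier_piece_sq_le (hR : ν (closedBall 0 R)ᶜ = 0)
    (hν : ∀ ξ, ‖fourierMeasure ν ξ‖ ≤ C * (1 + ‖ξ‖) ^ (-a)) {s : ℝ} (hs : 0 ≤ s) (hs1 : s ≤ 1)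
    (hsa : finrank ℝ V + 2 * s < 2 * a) :
    ∃ K : ℝ≥0, ∀ j : ℕ, ∫⁻ y, ‖piece ν j y‖ₑ ^ (2 : ℝ) ≤
      K * ENNReal.ofReal ((2 : ℝ) ^ (-(2 * s) * j)) := by
  have hint : Integrable (fun ξ : V => (1 + ‖ξ‖) ^ (-(2 * a - 2 * s))) :=
    integrable_one_add_norm (by linarith)
  set I : ℝ≥0∞ := ∫⁻ ξ : V, ENNReal.ofReal ((1 + ‖ξ‖) ^ (-(2 * a - 2 * s))) with hI
  have hIt : I ≠ ∞ := hint.lintegral_lt_top.ne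
  refine ⟨(ENNReal.ofReal ((4 * Real.pi * C) ^ 2) * I).toNNReal, fun j => ?_⟩
  rw [ENNReal.coe_toNNReal (ENNReal.mul_ne_top (by simp) hIt)]
  have h1 := lintegral_enorm_sq_fourier
    (f := fun y => (piece ν j y : ℂ)) (integrable_piece hR j).ofReal
    ((continuous_piece ν j).memLp_of_eq_zero (fun x hx => piece_eq_zero hR hx) 2)
  have h2 : ∀ y, ‖(piece ν j y : ℂ)‖ₑ = ‖piece ν j y‖ₑ := fun y => by
    rw [← ofReal_norm, ← ofReal_norm, Complex.norm_real]
  simp only [h2] at h1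
  rw [← h1, mul_assoc, mul_comm I, ← mul_assoc, ← ENNReal.ofReal_mul (by positivity), hI,
    ← lintegral_const_mul' _ _ (by simp)]
  refine lintegral_mono fun ξ => ?_
  rw [← ENNReal.ofReal_mul (by positivity), ← ofReal_norm,
    ENNReal.ofReal_rpow_of_nonneg (norm_nonneg _) (by norm_num)]
  refine ENNReal.ofReal_le_ofReal ?_
  have h4 := norm_fourier_piece_le_rpow hR hν hs hs1 j ξ
  rw [Real.rpow_two]
  have h5 : (0 : ℝ) < 1 + ‖ξ‖ := by positivity
  have h6 : ‖ξ‖ ^ s ≤ (1 + ‖ξ‖) ^ s := by gcongr; linarith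
  have hpow : ∀ b : ℝ, ((1 + ‖ξ‖) ^ b) ^ 2 = (1 + ‖ξ‖) ^ (2 * b) := fun b => by
    rw [← Real.rpow_two, ← Real.rpow_mul h5.le, mul_comm]
  have hpow2 : ((2 : ℝ) ^ (-s * j)) ^ 2 = (2 : ℝ) ^ (-(2 * s) * j) := by
    rw [← Real.rpow_two, ← Real.rpow_mul (by norm_num)]; congr 1; ring
  calc ‖𝓕 (fun y => (piece ν j y : ℂ)) ξ‖ ^ 2
      ≤ (4 * Real.pi * C * (2 : ℝ) ^ (-s * j) * (‖ξ‖ ^ s * (1 + ‖ξ‖) ^ (-a))) ^ 2 := by gcongr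
    _ = (4 * Real.pi * C) ^ 2 * ((2 : ℝ) ^ (-s * j)) ^ 2 *
        ((‖ξ‖ ^ s) ^ 2 * ((1 + ‖ξ‖) ^ (-a)) ^ 2) := by ring
    _ ≤ (4 * Real.pi * C) ^ 2 * ((2 : ℝ) ^ (-s * j)) ^ 2 *
        (((1 + ‖ξ‖) ^ s) ^ 2 * ((1 + ‖ξ‖) ^ (-a)) ^ 2) := by gcongr
    _ = _ := by
        rw [hpow, hpow, hpow2, ← Real.rpow_add h5]
        congr 2
        ring

/-- The dilates of the Fourier transform of a piece are uniformly square-summable. -/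
theorem exists_tsum_fourier_piece_sq_le (hR : ν (closedBall 0 R)ᶜ = 0)
    (hν : ∀ ξ, ‖fourierMeasure ν ξ‖ ≤ C * (1 + ‖ξ‖) ^ (-a)) {s : ℝ} (hs : 0 < s) (hs1 : s ≤ 1)
    (hsa : s < a) :
    ∃ K : ℝ≥0, ∀ (j : ℕ) (ξ : V),
      ∑' l : ℤ, ‖𝓕 (fun y => (piece ν j y : ℂ)) ((2 : ℝ) ^ l • ξ)‖ₑ ^ (2 : ℝ) ≤
        K * ENNReal.ofReal ((2 : ℝ) ^ (-(2 * s) * j)) := by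
  -- With `α + β = 2a` the sum over dyadic scales converges for any `0 < s < a`. In contrast to the
  -- `L²` norm of the piece, no dimensional term is lost.
  obtain ⟨K, hK⟩ := exists_tsum_int_rpow_le (α := 2 * s) (β := 2 * (a - s)) (by linarith)
    (by linarith)
  refine ⟨((4 * Real.pi * C) ^ 2).toNNReal * K, fun j ξ => ?_⟩
  rw [ENNReal.coe_mul]
  change _ ≤ ENNReal.ofReal _ * _ * _
  calc _ ≤ ∑' l : ℤ, (ENNReal.ofReal ((4 * Real.pi * C) ^ 2) *
        ENNReal.ofReal ((2 : ℝ) ^ (-(2 * s) * j))) *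
        ENNReal.ofReal (((2 : ℝ) ^ l * ‖ξ‖) ^ (2 * s) *
          (1 + (2 : ℝ) ^ l * ‖ξ‖) ^ (-(2 * s + 2 * (a - s)))) := by
        refine ENNReal.tsum_le_tsum fun l => ?_
        rw [← ENNReal.ofReal_mul (by positivity), ← ENNReal.ofReal_mul (by positivity),
          ← ofReal_norm, ENNReal.ofReal_rpow_of_nonneg (norm_nonneg _) (by norm_num), Real.rpow_two]
        refine ENNReal.ofReal_le_ofReal ?_
        have h4 := norm_fourier_piece_le_rpow hR hν hs.le hs1 j ((2 : ℝ) ^ l • ξ)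
        rw [norm_smul, Real.norm_of_nonneg (by positivity)] at h4
        set w := (2 : ℝ) ^ l * ‖ξ‖
        have hw : 0 ≤ w := by positivity
        refine (pow_le_pow_left₀ (norm_nonneg _) h4 2).trans (le_of_eq ?_)
        rw [mul_pow, mul_pow, mul_pow (w ^ s)]
        simp only [← Real.rpow_two]
        rw [← Real.rpow_mul (by norm_num), ← Real.rpow_mul hw, ← Real.rpow_mul (by positivity)]
        congr 2
        · congr 1; ring
        · congr 1; ring
        · congr 1; ring
    _ ≤ _ := by
        rw [ENNReal.tsum_mul_left, mul_right_comm]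
        gcongr
        exact hK _ (norm_nonneg _)

end Decay

/-- The maximal function of the averages with kernel `φ` over the dilations `2ˡt`, `t ∈ D`. -/
def netMax (φ : V → ℝ) (D : Finset ℝ) (F : V → ℝ) (x : V) : ℝ≥0∞ :=
  ⨆ l : ℤ, ⨆ t ∈ D, ‖∫ v, F (x - ((2 : ℝ) ^ l * t) • v) * φ v‖ₑ

theorem measurable_integral_translates {F φ : V → ℝ} (hF : Measurable F) (hφ : Measurable φ)
    (s : ℝ) : Measurable fun x => ∫ v, F (x - s • v) * φ v := by
  have : Measurable fun q : V × V => F (q.1 - s • q.2) * φ q.2 :=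
    (hF.comp (by fun_prop)).mul (hφ.comp measurable_snd)
  exact this.stronglyMeasurable.integral_prod_right.measurable

theorem measurable_netMax {F φ : V → ℝ} (hF : Measurable F) (hφ : Measurable φ) (D : Finset ℝ) :
    Measurable (netMax φ D F) :=
  Measurable.iSup fun _ => Measurable.biSup (D : Set ℝ) D.countable_toSet fun _ _ =>
    (measurable_integral_translates hF hφ _).enorm

/-- The average is a convolution, whose transform is the product of those of `F` and the dilated
kernel. Boundedness and bounded support of `F` put it, and the average, in `L¹ ∩ L²`. -/
theorem integral_translates_sq {F φ : V → ℝ} (hF : Measurable F) {M RF : ℝ}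
    (hFM : ∀ x, |F x| ≤ M) (hF0 : ∀ x, RF < ‖x‖ → F x = 0) (hφ : Continuous φ) {R : ℝ}
    (hφ0 : ∀ x, R < ‖x‖ → φ x = 0) (s : ℝ) :
    ∫⁻ x, ‖∫ v, F (x - s • v) * φ v‖ₑ ^ (2 : ℝ) =
      ∫⁻ ξ, ‖𝓕 (fun x => (F x : ℂ)) ξ‖ₑ ^ (2 : ℝ) * ‖𝓕 (fun x => (φ x : ℂ)) (s • ξ)‖ₑ ^ (2 : ℝ) := by
  have hFc : Measurable fun x => (F x : ℂ) := Complex.measurable_ofReal.comp hF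
  have hφi : Integrable φ :=
    hφ.integrable_of_hasCompactSupport (hasCompactSupport_of_eq_zero hφ0)
  have hFi : Integrable F := by
    have : IntegrableOn F (closedBall 0 RF) := by
      refine Measure.integrableOn_of_bounded (M := M) measure_closedBall_lt_top.ne
        hF.aestronglyMeasurable (Eventually.of_forall hFM)
    refine (integrableOn_iff_integrable_of_support_subset ?_).1 this
    intro x hx
    by_contra hcon
    exact hx (hF0 x (by simpa using hcon))
  set A : V → ℂ := fun x => ∫ v, (F (x - s • v) : ℂ) * (φ v : ℂ) with hA
  have hAF : ∀ x, A x = ((∫ v, F (x - s • v) * φ v : ℝ) : ℂ) := by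
    intro x
    rw [hA, ← integral_complex_ofReal]
    simp
  have hint : Integrable (fun q : V × V => F (q.1 - s • q.2) * φ q.2) (volume.prod volume) := by
    rw [integrable_prod_iff']
    · refine ⟨Eventually.of_forall fun v =>
        ((hFi.comp_sub_right (s • v)).mul_const (φ v) :
          Integrable (fun x => F (x - s • v) * φ v)), ?_⟩
      have : ∀ v, ∫ x, ‖F (x - s • v) * φ v‖ = (∫ x, ‖F x‖) * ‖φ v‖ := by
        intro v
        simp_rw [norm_mul]
        rw [integral_mul_const, integral_sub_right_eq_self (fun x => ‖F x‖) (s • v)]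
      simp only [this]
      exact hφi.norm.const_mul _
    · exact ((hF.comp (by fun_prop)).mul (hφ.measurable.comp measurable_snd)).aestronglyMeasurable
  have hAi' : Integrable fun x => ∫ v, F (x - s • v) * φ v := hint.integral_prod_left
  have hAb : ∀ x, ‖∫ v, F (x - s • v) * φ v‖ ≤ M * ∫ v, ‖φ v‖ := by
    intro x
    rw [← integral_const_mul]
    refine norm_integral_le_of_norm_le (hφi.norm.const_mul _) (Eventually.of_forall fun v => ?_)
    rw [norm_mul]
    gcongr
    exact hFM _
  have hAi : Integrable A := by
    simp only [funext hAF]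
    exact hAi'.ofReal
  have hA2 : MemLp A 2 := by
    rw [memLp_two_iff_integrable_sq_norm hAi.1]
    simp only [sq]
    refine hAi.norm.bdd_mul (c := M * ∫ v, ‖φ v‖) hAi.1.norm (Eventually.of_forall fun x => ?_)
    rw [norm_norm, hAF, Complex.norm_real]
    exact hAb x
  have h1 := lintegral_enorm_sq_fourier hAi hA2
  have h2 : ∀ x, ‖A x‖ₑ = ‖∫ v, F (x - s • v) * φ v‖ₑ := fun x => by
    rw [hAF, ← ofReal_norm, ← ofReal_norm, Complex.norm_real]
  simp only [h2] at h1
  rw [← h1]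
  refine lintegral_congr fun ξ => ?_
  rw [← ENNReal.mul_rpow_of_nonneg _ _ (by norm_num), ← enorm_mul]
  have h3 : 𝓕 A ξ = _ := fourier_integral_translates (σ := volume) hFc hFi.ofReal
    (φ := fun v => (φ v : ℂ)) hφi.ofReal s ξ
  rw [h3, ← fourier_eq_integral_mul]

/-- The `L²` bound of the maximal function over a net, from the square function. -/
theorem lintegral_netMax_sq_le {F φ : V → ℝ} (hF : Measurable F) {M RF : ℝ}
    (hFM : ∀ x, |F x| ≤ M) (hF0 : ∀ x, RF < ‖x‖ → F x = 0) (hφ : Continuous φ) {R : ℝ}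
    (hφ0 : ∀ x, R < ‖x‖ → φ x = 0) {B : ℝ≥0∞}
    (hB : ∀ ξ, ∑' l : ℤ, ‖𝓕 (fun x => (φ x : ℂ)) ((2 : ℝ) ^ l • ξ)‖ₑ ^ (2 : ℝ) ≤ B)
    (D : Finset ℝ) :
    ∫⁻ x, netMax φ D F x ^ (2 : ℝ) ≤ D.card * B * ∫⁻ x, ‖F x‖ₑ ^ (2 : ℝ) := by
  have hφc : Continuous (𝓕 (fun x => (φ x : ℂ))) := by
    have hφi : Integrable (fun x => (φ x : ℂ)) :=
      (hφ.integrable_of_hasCompactSupport (hasCompactSupport_of_eq_zero hφ0)).ofReal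
    exact VectorFourier.fourierIntegral_continuous Real.continuous_fourierChar
      (by exact continuous_inner) hφi
  have hFi : Integrable F := by
    have : IntegrableOn F (closedBall 0 RF) := by
      refine Measure.integrableOn_of_bounded (M := M) measure_closedBall_lt_top.ne
        hF.aestronglyMeasurable (Eventually.of_forall hFM)
    refine (integrableOn_iff_integrable_of_support_subset ?_).1 this
    intro x hx
    by_contra hcon
    exact hx (hF0 x (by simpa using hcon))
  have hFi' : Integrable (fun x => (F x : ℂ)) := hFi.ofReal
  have hF2 : MemLp (fun x => (F x : ℂ)) 2 := by
    rw [memLp_two_iff_integrable_sq_norm hFi'.1]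
    simp only [sq]
    refine hFi'.norm.bdd_mul (c := M) hFi'.1.norm (Eventually.of_forall fun x => ?_)
    rw [norm_norm, Complex.norm_real]
    exact hFM x
  have hFc : Continuous (𝓕 (fun x => (F x : ℂ))) :=
    VectorFourier.fourierIntegral_continuous Real.continuous_fourierChar
      (by exact continuous_inner) hFi'
  have hplanch : ∫⁻ ξ, ‖𝓕 (fun x => (F x : ℂ)) ξ‖ₑ ^ (2 : ℝ) = ∫⁻ x, ‖F x‖ₑ ^ (2 : ℝ) := by
    rw [lintegral_enorm_sq_fourier hFi' hF2]
    refine lintegral_congr fun x => ?_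
    rw [← ofReal_norm, ← ofReal_norm, Complex.norm_real]
  have hmeas : ∀ s : ℝ, Measurable fun x => ‖∫ v, F (x - s • v) * φ v‖ₑ ^ (2 : ℝ) := fun s =>
    (measurable_integral_translates hF hφ.measurable s).enorm.pow_const _
  have hmeas2 : ∀ s : ℝ, Measurable fun ξ => ‖𝓕 (fun x => (φ x : ℂ)) (s • ξ)‖ₑ ^ (2 : ℝ) := fun s =>
    ((hφc.comp (continuous_const_smul s)).measurable.enorm).pow_const _
  -- The supremum over scales and net points is replaced by the `ℓ²` sum. The sum over `l` is
  -- controlled by `B`, and the sum over `t` costs the cardinality.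
  have hpt : ∀ x, netMax φ D F x ^ (2 : ℝ) ≤
      ∑ t ∈ D, ∑' l : ℤ, ‖∫ v, F (x - ((2 : ℝ) ^ l * t) • v) * φ v‖ₑ ^ (2 : ℝ) := by
    intro x
    rw [← ENNReal.le_rpow_inv_iff (by norm_num)]
    refine iSup_le fun l => iSup₂_le fun t ht => ?_
    rw [ENNReal.le_rpow_inv_iff (by norm_num)]
    exact (ENNReal.le_tsum l).trans (Finset.single_le_sum (f := fun t =>
      ∑' l : ℤ, ‖∫ v, F (x - ((2 : ℝ) ^ l * t) • v) * φ v‖ₑ ^ (2 : ℝ)) (fun _ _ => zero_le) ht)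
  calc ∫⁻ x, netMax φ D F x ^ (2 : ℝ)
      ≤ ∫⁻ x, ∑ t ∈ D, ∑' l : ℤ, ‖∫ v, F (x - ((2 : ℝ) ^ l * t) • v) * φ v‖ₑ ^ (2 : ℝ) :=
        lintegral_mono hpt
    _ = ∑ t ∈ D, ∑' l : ℤ, ∫⁻ ξ, ‖𝓕 (fun x => (F x : ℂ)) ξ‖ₑ ^ (2 : ℝ) *
          ‖𝓕 (fun x => (φ x : ℂ)) (((2 : ℝ) ^ l * t) • ξ)‖ₑ ^ (2 : ℝ) := by
        rw [lintegral_finsetSum _ fun t _ => Measurable.tsum fun l => hmeas _]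
        refine Finset.sum_congr rfl fun t _ => ?_
        rw [lintegral_tsum fun l => (hmeas _).aemeasurable]
        refine tsum_congr fun l => ?_
        exact integral_translates_sq hF hFM hF0 hφ hφ0 _
    _ = ∑ t ∈ D, ∫⁻ ξ, ‖𝓕 (fun x => (F x : ℂ)) ξ‖ₑ ^ (2 : ℝ) *
          ∑' l : ℤ, ‖𝓕 (fun x => (φ x : ℂ)) ((2 : ℝ) ^ l • t • ξ)‖ₑ ^ (2 : ℝ) := by
        refine Finset.sum_congr rfl fun t _ => ?_
        have hm : ∀ l : ℤ, AEMeasurable (fun ξ => ‖𝓕 (fun x => (F x : ℂ)) ξ‖ₑ ^ (2 : ℝ) *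
            ‖𝓕 (fun x => (φ x : ℂ)) (((2 : ℝ) ^ l * t) • ξ)‖ₑ ^ (2 : ℝ)) volume := fun l =>
          ((hFc.measurable.enorm.pow_const _).mul (hmeas2 _)).aemeasurable
        rw [← lintegral_tsum hm]
        refine lintegral_congr fun ξ => ?_
        rw [ENNReal.tsum_mul_left]
        simp only [mul_smul]
    _ ≤ ∑ t ∈ D, ∫⁻ ξ, ‖𝓕 (fun x => (F x : ℂ)) ξ‖ₑ ^ (2 : ℝ) * B := by
        gcongr with t _ ξ
        exact hB _
    _ = _ := by
        rw [lintegral_mul_const _ (hFc.measurable.enorm.pow_const _), hplanch, Finset.sum_const,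
          nsmul_eq_mul]
        ring

end SquareFunction

end

/-! ### Bounds near `L¹` with logarithmic loss. -/

noncomputable section

section NearEndpoint

open Module Metric

variable {V : Type*} [NormedAddCommGroup V] [InnerProductSpace ℝ V] [FiniteDimensional ℝ V]
  [MeasurableSpace V] [BorelSpace V]

theorem lintegral_comp_smul_eq {s : ℝ} (hs : 0 < s) {f : V → ℝ≥0∞} (hf : Measurable f) :
    ∫⁻ v, f (s • v) = ENNReal.ofReal ((s ^ finrank ℝ V)⁻¹) * ∫⁻ v, f v := by
  have h := Measure.map_addHaar_smul (volume : Measure V) hs.ne'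
  rw [← lintegral_map (g := fun v => s • v) hf (measurable_const_smul s), h,
    lintegral_smul_measure, abs_of_nonneg (by positivity), smul_eq_mul]

theorem lintegral_comp_sub_smul_eq (x : V) {s : ℝ} (hs : 0 < s) {f : V → ℝ≥0∞}
    (hf : Measurable f) :
    ∫⁻ v, f (x - s • v) = ENNReal.ofReal ((s ^ finrank ℝ V)⁻¹) * ∫⁻ v, f v := by
  rw [lintegral_comp_smul_eq hs (f := fun v => f (x - v)) (hf.comp (by fun_prop)),
    lintegral_sub_left_eq_self f x]

/-- A positive average over the dilation `s` is dominated by the shifted maximal functions, if the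
kernel is controlled at scale `ρ`. -/
theorem lintegral_translates_mul_le {F Φ Ψ : V → ℝ≥0∞} (hF : Measurable F)
    (hΨ : Measurable Ψ) {ρ : ℝ} (hρ : 0 < ρ) (h : ∀ y z, ‖z - y‖ ≤ ρ → Φ y ≤ Ψ z) (l : ℤ) (x : V) :
    ∫⁻ y, F (x - (2 : ℝ) ^ l • y) * Φ y ≤
      (volume (closedBall (0 : V) 1))⁻¹ * ∫⁻ z, Ψ z * shiftedMax z ρ F x := by
  set v := volume (closedBall (0 : V) 1) with hv
  have hv0 : v ≠ 0 := (measure_closedBall_pos volume _ one_pos).ne'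
  have hvt : v ≠ ∞ := measure_closedBall_lt_top.ne
  set w := ENNReal.ofReal (ρ ^ finrank ℝ V) with hw
  have hw0 : w ≠ 0 := by simpa [hw] using by positivity
  have hwt : w ≠ ∞ := by simp [hw]
  have h2l : (0 : ℝ) < 2 ^ l := by positivity
  let S : Set (V × V) := {q | ‖q.2 - q.1‖ ≤ ρ}
  have hS : MeasurableSet S := measurableSet_le (by fun_prop) (by fun_prop)
  -- The value of `Φ` at `y` is dominated by the mean of `Ψ` over the ball of radius `ρ` about `y`.
  -- After exchanging integrals, `z` becomes the shift and `F` is averaged over a ball of relative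
  -- radius `ρ`.
  have h1 : ∀ y, Φ y ≤ (w * v)⁻¹ * ∫⁻ z, S.indicator (fun q => Ψ q.2) (y, z) := by
    intro y
    have hb : volume (closedBall y ρ) = w * v := volume_closedBall_eq_ofReal_pow y hρ.le
    have : w * v * Φ y ≤ ∫⁻ z, S.indicator (fun q => Ψ q.2) (y, z) := by
      rw [← hb, mul_comm, ← setLIntegral_const, ← lintegral_indicator measurableSet_closedBall]
      refine lintegral_mono fun z => ?_
      by_cases hz : z ∈ closedBall y ρ
      · have hz' : (y, z) ∈ S := by simpa [S, dist_eq_norm] using hz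
        rw [indicator_of_mem hz, indicator_of_mem hz']
        exact h y z hz'
      · rw [indicator_of_notMem hz]
        exact zero_le
    calc Φ y = (w * v)⁻¹ * (w * v * Φ y) := by
          rw [← mul_assoc, ENNReal.inv_mul_cancel (mul_ne_zero hw0 hv0)
            (ENNReal.mul_ne_top hwt hvt), one_mul]
      _ ≤ _ := by gcongr
  have hm : Measurable fun q : V × V => F (x - (2 : ℝ) ^ l • q.1) * S.indicator (fun q => Ψ q.2) q :=
    (hF.comp (by fun_prop)).mul ((hΨ.comp measurable_snd).indicator hS)
  have h2 : ∀ z, ∫⁻ y, F (x - (2 : ℝ) ^ l • y) * S.indicator (fun q => Ψ q.2) (y, z) ≤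
      w * (Ψ z * shiftedMax z ρ F x) := by
    intro z
    let G : V → ℝ≥0∞ := (closedBall (x - (2 : ℝ) ^ l • z) ((2 : ℝ) ^ l * ρ)).indicator F
    have hG : Measurable G := hF.indicator measurableSet_closedBall
    have e : ∀ y, F (x - (2 : ℝ) ^ l • y) * S.indicator (fun q => Ψ q.2) (y, z) =
        Ψ z * G (x - (2 : ℝ) ^ l • y) := by
      intro y
      have : (y, z) ∈ S ↔ x - (2 : ℝ) ^ l • y ∈
          closedBall (x - (2 : ℝ) ^ l • z) ((2 : ℝ) ^ l * ρ) := by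
        rw [mem_closedBall, dist_eq_norm, sub_sub_sub_cancel_left, ← smul_sub, norm_smul,
          Real.norm_of_nonneg h2l.le, mul_le_mul_iff_right₀ h2l]
        rfl
      by_cases hy : (y, z) ∈ S
      · simp only [G, indicator_of_mem hy, indicator_of_mem (this.1 hy)]
        rw [mul_comm]
      · simp only [G, indicator_of_notMem hy, indicator_of_notMem (fun h => hy (this.2 h)), mul_zero]
    simp_rw [e]
    have h3 : (ENNReal.ofReal (((2 : ℝ) ^ l * ρ) ^ finrank ℝ V))⁻¹ * ∫⁻ y, G y ≤
        shiftedMax z ρ F x := by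
      refine le_iSup_of_le l (le_of_eq ?_)
      rw [lintegral_indicator measurableSet_closedBall]
    have h4 : ENNReal.ofReal (((2 : ℝ) ^ l) ^ finrank ℝ V)⁻¹ =
        w * (ENNReal.ofReal (((2 : ℝ) ^ l * ρ) ^ finrank ℝ V))⁻¹ := by
      rw [hw, ← ENNReal.ofReal_inv_of_pos (by positivity), ← ENNReal.ofReal_mul (by positivity)]
      congr 1
      rw [mul_pow]
      field_simp
    have hGm : Measurable fun y => G (x - (2 : ℝ) ^ l • y) := hG.comp (by fun_prop)
    rw [lintegral_const_mul _ hGm, lintegral_comp_sub_smul_eq x h2l hG, h4, mul_assoc w,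
      mul_left_comm]
    gcongr
  calc ∫⁻ y, F (x - (2 : ℝ) ^ l • y) * Φ y
      ≤ ∫⁻ y, (w * v)⁻¹ * ∫⁻ z, F (x - (2 : ℝ) ^ l • y) * S.indicator (fun q => Ψ q.2) (y, z) := by
        refine lintegral_mono fun y => ?_
        have hmy : Measurable fun z => S.indicator (fun q : V × V => Ψ q.2) (y, z) :=
          ((hΨ.comp measurable_snd).indicator hS).comp measurable_prodMk_left
        rw [lintegral_const_mul _ hmy, mul_left_comm]
        gcongr
        exact h1 y
    _ = (w * v)⁻¹ * ∫⁻ z, ∫⁻ y, F (x - (2 : ℝ) ^ l • y) * S.indicator (fun q => Ψ q.2) (y, z) := by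
        rw [lintegral_const_mul _ hm.lintegral_prod_right',
          lintegral_lintegral_swap (f := fun y z =>
            F (x - (2 : ℝ) ^ l • y) * S.indicator (fun q => Ψ q.2) (y, z)) hm.aemeasurable]
    _ ≤ (w * v)⁻¹ * ∫⁻ z, w * (Ψ z * shiftedMax z ρ F x) := by
        gcongr with z
        exact h2 z
    _ = _ := by
        rw [lintegral_const_mul' _ _ hwt, ← mul_assoc, ENNReal.mul_inv (Or.inl hw0) (Or.inl hwt),
          mul_right_comm _ _ w, ENNReal.inv_mul_cancel hw0 hwt, one_mul]

/-- The largest dilate of a kernel over a net. -/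
def kernelSup (φ : V → ℝ) (D : Finset ℝ) (y : V) : ℝ≥0∞ := ⨆ t ∈ D, ‖φ (t⁻¹ • y)‖ₑ

theorem measurable_kernelSup {φ : V → ℝ} (hφ : Measurable φ) (D : Finset ℝ) :
    Measurable (kernelSup φ D) :=
  Measurable.biSup (D : Set ℝ) D.countable_toSet fun t _ =>
    (hφ.comp (measurable_const_smul t⁻¹)).enorm

/-- The substitution `y = t v`, with Jacobian at most `1` because `t ≥ 1`, moves the dilation by `t`
onto the kernel. The bound then depends on `t` only through membership in the net. -/
theorem enorm_integral_translates_le {F φ : V → ℝ} (hF : Measurable F) (hφ : Measurable φ)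
    {D : Finset ℝ} {t : ℝ} (htD : t ∈ D) (ht : 1 ≤ t) (s : ℝ) (x : V) :
    ‖∫ v, F (x - (s * t) • v) * φ v‖ₑ ≤ ∫⁻ y, ‖F (x - s • y)‖ₑ * kernelSup φ D y := by
  have ht0 : 0 < t := by linarith
  refine (enorm_integral_le_lintegral_enorm _).trans ?_
  have hm : Measurable fun y => ‖F (x - s • y)‖ₑ * ‖φ (t⁻¹ • y)‖ₑ :=
    (hF.comp (by fun_prop)).enorm.mul (hφ.comp (measurable_const_smul t⁻¹)).enorm
  calc ∫⁻ v, ‖F (x - (s * t) • v) * φ v‖ₑ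
      = ∫⁻ v, (fun y => ‖F (x - s • y)‖ₑ * ‖φ (t⁻¹ • y)‖ₑ) (t • v) := by
        refine lintegral_congr fun v => ?_
        simp only [enorm_mul, smul_smul, inv_mul_cancel₀ ht0.ne', one_smul]
    _ ≤ 1 * ∫⁻ y, ‖F (x - s • y)‖ₑ * ‖φ (t⁻¹ • y)‖ₑ := by
        rw [lintegral_comp_smul_eq ht0 hm]
        gcongr
        exact ENNReal.ofReal_le_one.2 (inv_le_one_of_one_le₀ (one_le_pow₀ ht))
    _ ≤ _ := by
        rw [one_mul]
        gcongr
        exact le_iSup₂_of_le t htD le_rfl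

/-- The maximal operator over the net is dominated by an average of shifted maximal functions
against the largest dilate of the kernel, and the mass of that dilate is estimated by Cauchy–Schwarz
and an `ℓ²` sum over the net. The Lipschitz constant `L` enters only through the scale `ρ`, hence
only through the factor `m + 3`. -/
theorem exists_lintegral_netMax_rpow_le [Nontrivial V] {p : ℝ} (hp : 1 < p) (hp2 : p < 2)
    (R : ℝ) :
    ∃ C : ℝ≥0, ∀ (φ : V → ℝ) (D : Finset ℝ) (L ρ : ℝ) (m : ℕ) (F : V → ℝ),
      Measurable φ → (∀ x, R < ‖x‖ → φ x = 0) → (∀ x y, |φ x - φ y| ≤ L * ‖x - y‖) → 0 ≤ L →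
      (∀ t ∈ D, t ∈ Icc (1 : ℝ) 2) → 0 < ρ → ρ ≤ 1 → L * ρ ≤ 1 → 2 * R + 1 ≤ 2 ^ m * ρ →
      Measurable F →
      ∫⁻ x, netMax φ D F x ^ p ≤
        C * (m + 3 : ℕ) * (1 + D.card * ∫⁻ x, ‖φ x‖ₑ ^ (2 : ℝ)) * ∫⁻ x, ‖F x‖ₑ ^ p := by
  obtain ⟨C, hC⟩ := exists_lintegral_shiftedMax_rpow_le (V := V) hp hp2
  have hp0 : 0 < p := by linarith
  set v := volume (closedBall (0 : V) 1) with hv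
  have hv0 : v ≠ 0 := (measure_closedBall_pos volume _ one_pos).ne'
  have hvt : v ≠ ∞ := measure_closedBall_lt_top.ne
  let U : Set V := closedBall 0 (2 * R + 1)
  have hU : MeasurableSet U := measurableSet_closedBall
  have hUt : volume U ≠ ∞ := measure_closedBall_lt_top.ne
  set κ : ℝ≥0∞ := 1 + volume U * 2 * (ENNReal.ofReal (2 ^ finrank ℝ V) + volume U) with hκ
  have hκt : κ ≠ ∞ := by
    refine ENNReal.add_ne_top.2 ⟨by simp, ENNReal.mul_ne_top (ENNReal.mul_ne_top hUt (by simp))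
      (ENNReal.add_ne_top.2 ⟨by simp, hUt⟩)⟩
  have hvp : (v⁻¹) ^ p ≠ ∞ := ENNReal.rpow_ne_top_of_nonneg hp0.le (by simpa using hv0)
  refine ⟨((v⁻¹) ^ p * κ * C).toNNReal, fun φ D L ρ m F hφ hφ0 hφL hL hD hρ hρ1 hLρ hm hF => ?_⟩
  rw [ENNReal.coe_toNNReal (ENNReal.mul_ne_top (ENNReal.mul_ne_top hvp hκt) (by simp))]
  set Φ := kernelSup φ D with hΦ
  have hΦm : Measurable Φ := measurable_kernelSup hφ D
  -- The `1` absorbs the oscillation of `φ` at scale `ρ`, since `L ρ ≤ 1`. The ball `U` contains the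
  -- `ρ`-neighbourhood of the supports of all dilates by `t ≤ 2`.
  set Ψ : V → ℝ≥0∞ := U.indicator fun z => Φ z + 1 with hΨ
  have hΨm : Measurable Ψ := (hΦm.add measurable_const).indicator hU
  have hΦΨ : ∀ y z, ‖z - y‖ ≤ ρ → Φ y ≤ Ψ z := by
    intro y z hyz
    refine iSup₂_le fun t ht => ?_
    obtain ⟨ht1, ht2⟩ := hD t ht
    have ht0 : 0 < t := by linarith
    by_cases hy : R < ‖t⁻¹ • y‖
    · simp [hφ0 _ hy]
    have hy2 : ‖y‖ ≤ 2 * R := by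
      rw [not_lt, norm_smul, Real.norm_of_nonneg (by positivity), inv_mul_le_iff₀ ht0] at hy
      have : 0 ≤ R := by
        by_contra hR
        have : t * R < 0 := mul_neg_of_pos_of_neg ht0 (not_le.1 hR)
        linarith [norm_nonneg y]
      nlinarith
    have hz : z ∈ U := by
      simp only [U, mem_closedBall, dist_zero_right]
      calc ‖z‖ = ‖(z - y) + y‖ := by simp
        _ ≤ 2 * R + 1 := (norm_add_le _ _).trans (by linarith)
    rw [hΨ, indicator_of_mem hz]
    have h1 : ‖φ (t⁻¹ • y)‖ₑ ≤ ‖φ (t⁻¹ • z)‖ₑ + 1 := by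
      have h2 : |φ (t⁻¹ • y) - φ (t⁻¹ • z)| ≤ 1 := by
        refine (hφL _ _).trans (le_trans ?_ hLρ)
        gcongr
        rw [← smul_sub, norm_smul, Real.norm_of_nonneg (by positivity), norm_sub_rev]
        exact (mul_le_of_le_one_left (norm_nonneg _) (inv_le_one_of_one_le₀ ht1)).trans hyz
      rw [← ofReal_norm, ← ofReal_norm, ← ENNReal.ofReal_one,
        ← ENNReal.ofReal_add (norm_nonneg _) zero_le_one]
      refine ENNReal.ofReal_le_ofReal ?_
      rw [Real.norm_eq_abs, Real.norm_eq_abs]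
      linarith [abs_sub_abs_le_abs_sub (φ (t⁻¹ • y)) (φ (t⁻¹ • z))]
    refine h1.trans ?_
    gcongr
    exact le_iSup₂_of_le t ht le_rfl
  have hpt : ∀ x, netMax φ D F x ≤ v⁻¹ * ∫⁻ z, Ψ z * shiftedMax z ρ (fun y => ‖F y‖ₑ) x := by
    intro x
    refine iSup_le fun l => iSup₂_le fun t ht => ?_
    exact (enorm_integral_translates_le hF hφ ht (hD t ht).1 _ x).trans
      (lintegral_translates_mul_le hF.enorm hΨm hρ hΦΨ l x)
  have hΦ2 : ∫⁻ z, Φ z ^ (2 : ℝ) ≤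
      ENNReal.ofReal (2 ^ finrank ℝ V) * (D.card * ∫⁻ x, ‖φ x‖ₑ ^ (2 : ℝ)) := by
    have hmm : ∀ t : ℝ, Measurable fun y => ‖φ (t⁻¹ • y)‖ₑ ^ (2 : ℝ) := fun t =>
      (hφ.comp (measurable_const_smul t⁻¹)).enorm.pow_const _
    calc ∫⁻ z, Φ z ^ (2 : ℝ) ≤ ∫⁻ z, ∑ t ∈ D, ‖φ (t⁻¹ • z)‖ₑ ^ (2 : ℝ) := by
          refine lintegral_mono fun z => ?_
          rw [← ENNReal.le_rpow_inv_iff (by norm_num)]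
          refine iSup₂_le fun t ht => ?_
          rw [ENNReal.le_rpow_inv_iff (by norm_num)]
          exact Finset.single_le_sum (f := fun t => ‖φ (t⁻¹ • z)‖ₑ ^ (2 : ℝ))
            (fun _ _ => zero_le) ht
      _ = ∑ t ∈ D, ENNReal.ofReal (((t⁻¹) ^ finrank ℝ V)⁻¹) * ∫⁻ x, ‖φ x‖ₑ ^ (2 : ℝ) := by
          rw [lintegral_finsetSum _ fun t _ => hmm t]
          refine Finset.sum_congr rfl fun t ht => ?_
          exact lintegral_comp_smul_eq (inv_pos.2 (by linarith [(hD t ht).1]))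
            (hφ.enorm.pow_const _)
      _ ≤ ∑ t ∈ D, ENNReal.ofReal (2 ^ finrank ℝ V) * ∫⁻ x, ‖φ x‖ₑ ^ (2 : ℝ) := by
          gcongr with t ht
          rw [inv_pow, inv_inv]
          have := hD t ht
          exact pow_le_pow_left₀ (by linarith [this.1]) this.2 _
      _ = _ := by rw [Finset.sum_const, nsmul_eq_mul]; ring
  set X := (D.card : ℝ≥0∞) * ∫⁻ x, ‖φ x‖ₑ ^ (2 : ℝ) with hX
  have hΨ1 : (∫⁻ z, Ψ z) ^ (2 : ℝ) ≤ κ * (1 + X) := by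
    rw [hΨ, lintegral_indicator hU]
    refine (lintegral_rpow_le_measure_univ_rpow_mul one_le_two
      (hΦm.add measurable_const).aemeasurable).trans ?_
    rw [Measure.restrict_apply_univ, show (2 : ℝ) - 1 = 1 by norm_num, ENNReal.rpow_one]
    calc volume U * ∫⁻ z in U, (Φ z + 1) ^ (2 : ℝ)
        ≤ volume U * ∫⁻ z in U, 2 * (Φ z ^ (2 : ℝ) + 1) := by
          gcongr with z
          have := ENNReal.rpow_add_le_mul_rpow_add_rpow (Φ z) 1 (one_le_two (α := ℝ))
          simpa [show (2 : ℝ) - 1 = 1 by norm_num] using this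
      _ = volume U * (2 * (∫⁻ z in U, Φ z ^ (2 : ℝ)) + 2 * volume U) := by
          rw [lintegral_const_mul' _ _ (by simp), lintegral_add_right _ measurable_const]
          simp [mul_add]
      _ ≤ volume U * (2 * (ENNReal.ofReal (2 ^ finrank ℝ V) * X) + 2 * volume U) := by
          gcongr
          exact (setLIntegral_le_lintegral _ _).trans hΦ2
      _ ≤ κ * (1 + X) := by
          rw [hκ]
          calc _ = volume U * 2 * (ENNReal.ofReal (2 ^ finrank ℝ V) * X + volume U * 1) := by ring
            _ ≤ volume U * 2 * (ENNReal.ofReal (2 ^ finrank ℝ V) * (1 + X) +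
                  volume U * (1 + X)) := by
                gcongr
                · exact le_add_self
                · exact le_self_add
            _ = volume U * 2 * (ENNReal.ofReal (2 ^ finrank ℝ V) + volume U) * (1 + X) := by ring
            _ ≤ _ := by gcongr; exact le_add_self
  -- The square of the mass is at most `κ (1 + X)`, which is at least `1`, so the power `p ≤ 2`
  -- obeys the same bound.
  have hΨp : (∫⁻ z, Ψ z) ^ p ≤ κ * (1 + X) := by
    have h1 : (1 : ℝ≥0∞) ≤ κ * (1 + X) := by
      calc (1 : ℝ≥0∞) = 1 * 1 := by simp
        _ ≤ _ := by gcongr <;> exact le_self_add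
    calc (∫⁻ z, Ψ z) ^ p = ((∫⁻ z, Ψ z) ^ (2 : ℝ)) ^ (p / 2) := by
          rw [← ENNReal.rpow_mul]; congr 1; ring
      _ ≤ (κ * (1 + X)) ^ (p / 2) := by gcongr
      _ ≤ (κ * (1 + X)) ^ (1 : ℝ) := ENNReal.rpow_le_rpow_of_exponent_le h1 (by linarith)
      _ = _ := ENNReal.rpow_one _
  have hsm := measurable_shiftedMax_prod ρ (F := fun y : V => ‖F y‖ₑ) hF.enorm
  -- Jensen for the measure `Ψ dz`; the bounds for the shifted maximal functions are uniform for `z`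
  -- in `U` and can then be averaged.
  have hjensen : ∀ x, (∫⁻ z, Ψ z * shiftedMax z ρ (fun y => ‖F y‖ₑ) x) ^ p ≤
      (∫⁻ z, Ψ z) ^ (p - 1) * ∫⁻ z, Ψ z * shiftedMax z ρ (fun y => ‖F y‖ₑ) x ^ p := by
    intro x
    have hmx : Measurable fun z => shiftedMax z ρ (fun y : V => ‖F y‖ₑ) x :=
      measurable_shiftedMax_left x ρ hF.enorm
    have := lintegral_rpow_le_measure_univ_rpow_mul (μ := volume.withDensity Ψ) hp.le
      hmx.aemeasurable
    rw [lintegral_withDensity_eq_lintegral_mul _ hΨm hmx,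
      lintegral_withDensity_eq_lintegral_mul _ hΨm (hmx.pow_const p),
      withDensity_apply _ MeasurableSet.univ, setLIntegral_univ] at this
    exact this
  calc ∫⁻ x, netMax φ D F x ^ p
      ≤ ∫⁻ x, (v⁻¹) ^ p * ((∫⁻ z, Ψ z) ^ (p - 1) *
          ∫⁻ z, Ψ z * shiftedMax z ρ (fun y => ‖F y‖ₑ) x ^ p) := by
        refine lintegral_mono fun x => ?_
        refine (ENNReal.rpow_le_rpow (hpt x) hp0.le).trans ?_
        rw [ENNReal.mul_rpow_of_nonneg _ _ hp0.le]
        gcongr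
        exact hjensen x
    _ = (v⁻¹) ^ p * ((∫⁻ z, Ψ z) ^ (p - 1) *
          ∫⁻ z, Ψ z * ∫⁻ x, shiftedMax z ρ (fun y => ‖F y‖ₑ) x ^ p) := by
        have hmm : Measurable fun q : V × V =>
            Ψ q.1 * shiftedMax q.1 ρ (fun y => ‖F y‖ₑ) q.2 ^ p :=
          (hΨm.comp measurable_fst).mul (hsm.pow_const p)
        rw [lintegral_const_mul _ (hmm.lintegral_prod_left'.const_mul _),
          lintegral_const_mul _ hmm.lintegral_prod_left',
          ← lintegral_lintegral_swap (f := fun z x =>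
            Ψ z * shiftedMax z ρ (fun y => ‖F y‖ₑ) x ^ p) hmm.aemeasurable]
        congr 2
        refine lintegral_congr fun z => ?_
        exact lintegral_const_mul (Ψ z) ((measurable_shiftedMax z ρ hF.enorm).pow_const p)
    _ ≤ (v⁻¹) ^ p * ((∫⁻ z, Ψ z) ^ (p - 1) *
          ∫⁻ z, Ψ z * (C * (m + 3 : ℕ) * ∫⁻ x, ‖F x‖ₑ ^ p)) := by
        gcongr (v⁻¹) ^ p * (_ * ∫⁻ z, ?_)  with z
        by_cases hz : z ∈ U
        · gcongr
          refine hC z ρ m _ hρ ?_ hF.enorm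
          have : ‖z‖ ≤ 2 * R + 1 := by simpa [U] using hz
          exact this.trans hm
        · simp [hΨ, indicator_of_notMem hz]
    _ = (v⁻¹) ^ p * ((∫⁻ z, Ψ z) ^ (p - 1) * (∫⁻ z, Ψ z) ^ (1 : ℝ)) *
          (C * (m + 3 : ℕ) * ∫⁻ x, ‖F x‖ₑ ^ p) := by
        rw [lintegral_mul_const _ hΨm, ENNReal.rpow_one]
        ring
    _ = (v⁻¹) ^ p * (∫⁻ z, Ψ z) ^ p * (C * (m + 3 : ℕ) * ∫⁻ x, ‖F x‖ₑ ^ p) := by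
        rw [← ENNReal.rpow_add_of_nonneg _ _ (by linarith) zero_le_one, sub_add_cancel]
    _ ≤ (v⁻¹) ^ p * (κ * (1 + X)) * (C * (m + 3 : ℕ) * ∫⁻ x, ‖F x‖ₑ ^ p) := by gcongr
    _ = _ := by ring

end NearEndpoint

end

/-! ### Oscillation of the pieces, change of dilation, and absolute continuity. -/

noncomputable section

section KernelEstimates

open Module Metric
open scoped FourierTransform RealInnerProductSpace

variable {V : Type*} [NormedAddCommGroup V] [InnerProductSpace ℝ V] [FiniteDimensional ℝ V]
  [MeasurableSpace V] [BorelSpace V]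

variable (ν : Measure V) [IsFiniteMeasure ν]

/-- The Lipschitz constant of the mollifiers at scale `2⁻ʲ`. -/
def pieceLip (V : Type*) [NormedAddCommGroup V] [InnerProductSpace ℝ V] [FiniteDimensional ℝ V]
    [MeasurableSpace V] [BorelSpace V] (j : ℕ) : ℝ :=
  2 * tentFactor V * ((2 : ℝ) ^ (j + 1)) ^ (finrank ℝ V + 1)

theorem pieceLip_nonneg (j : ℕ) : 0 ≤ pieceLip V j := by
  have := tentFactor_pos (V := V)
  unfold pieceLip
  positivity

theorem abs_mollifier_diff_le (j : ℕ) (x y : V) :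
    |(mollifier (j + 1) x - mollifier j x) - (mollifier (j + 1) y - mollifier j y)| ≤
      pieceLip V j * ‖x - y‖ := by
  have h1 := abs_mollifier_sub_le (j + 1) x y
  have h2 := abs_mollifier_sub_le j x y
  have h3 : tentFactor V * ((2 : ℝ) ^ j) ^ (finrank ℝ V + 1) * ‖x - y‖ ≤
      tentFactor V * ((2 : ℝ) ^ (j + 1)) ^ (finrank ℝ V + 1) * ‖x - y‖ := by
    have := tentFactor_pos (V := V)
    gcongr
    · norm_num
    · omega
  calc _ = |(mollifier (j + 1) x - mollifier (j + 1) y) - (mollifier j x - mollifier j y)| := by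
        congr 1; ring
    _ ≤ _ := (abs_sub _ _).trans (by unfold pieceLip; linarith)

theorem piece_eq_integral (j : ℕ) (y : V) :
    piece ν j y = ∫ v, (mollifier (j + 1) (y - v) - mollifier j (y - v)) ∂ν := by
  rw [piece, smoothed, smoothed, integral_sub (integrable_mollifier_translate ν _ _)
    (integrable_mollifier_translate ν _ _)]

/-- The oscillation of a piece is controlled by the `ν`-mass of a ball. -/
theorem abs_piece_sub_le (j : ℕ) {x y : V} {r : ℝ} (h : ‖x - y‖ + ((2 : ℝ) ^ j)⁻¹ ≤ r) :
    |piece ν j x - piece ν j y| ≤ pieceLip V j * ‖x - y‖ * ν.real (closedBall x r) := by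
  have hi : ∀ y, Integrable (fun v => mollifier (j + 1) (y - v) - mollifier j (y - v)) ν :=
    fun y => (integrable_mollifier_translate ν _ _).sub (integrable_mollifier_translate ν _ _)
  rw [piece_eq_integral, piece_eq_integral, ← integral_sub (hi x) (hi y), ← Real.norm_eq_abs]
  calc _ ≤ ∫ v, (closedBall x r).indicator (fun _ => pieceLip V j * ‖x - y‖) v ∂ν := by
        refine norm_integral_le_of_norm_le
          ((integrable_const _).indicator measurableSet_closedBall)
          (Eventually.of_forall fun v => ?_)
        by_cases hv : v ∈ closedBall x r
        · rw [indicator_of_mem hv, Real.norm_eq_abs]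
          refine (abs_mollifier_diff_le j _ _).trans ?_
          rw [sub_sub_sub_cancel_right]
        -- Off the ball both `x - v` and `y - v` have length at least `2^(-j)`, where the two
        -- mollifiers vanish.
        · rw [indicator_of_notMem hv]
          rw [mem_closedBall, dist_eq_norm, not_le, norm_sub_rev] at hv
          have hx : ((2 : ℝ) ^ j)⁻¹ ≤ ‖x - v‖ := by linarith [norm_nonneg (x - y)]
          have hy : ((2 : ℝ) ^ j)⁻¹ ≤ ‖y - v‖ := by
            have : ‖x - v‖ ≤ ‖x - y‖ + ‖y - v‖ := by
              simpa using norm_add_le (x - y) (y - v)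
            linarith
          have h2 : ((2 : ℝ) ^ (j + 1))⁻¹ ≤ ((2 : ℝ) ^ j)⁻¹ := by
            gcongr
            · norm_num
            · omega
          simp [mollifier_eq_zero hx, mollifier_eq_zero hy, mollifier_eq_zero (h2.trans hx),
            mollifier_eq_zero (h2.trans hy)]
    _ = _ := by
        rw [integral_indicator_const _ measurableSet_closedBall, smul_eq_mul, mul_comm]

/-- This crude global Lipschitz bound, exponential in `j`, suffices where it enters only through a
logarithm. -/
theorem abs_piece_sub_le_univ (j : ℕ) (x y : V) :
    |piece ν j x - piece ν j y| ≤ pieceLip V j * ν.real univ * ‖x - y‖ := by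
  refine (abs_piece_sub_le ν j le_rfl).trans ?_
  rw [mul_right_comm]
  have := pieceLip_nonneg (V := V) j
  gcongr
  · exact measure_ne_top ν univ
  · exact subset_univ _

/-- By Tonelli the mass `ν(B(v, r))` is spread over `y`; for each `y` the points `x - s v` fill a
ball of radius `s r` about `x - s y`, and the powers of `s` cancel. The gain `rᵈ` will compensate
the size of the mollifiers. -/
theorem lintegral_translates_mul_measure_closedBall_le {G : V → ℝ≥0∞} (hG : Measurable G) {s r : ℝ}
    (hs : 0 < s) (hr : 0 < r) (x : V) :
    ∫⁻ v, G (x - s • v) * ν (closedBall v r) ≤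
      ENNReal.ofReal ((4 * r) ^ finrank ℝ V) * ∫⁻ y, hlMax G (x - s • y) ∂ν := by
  let S : Set (V × V) := {q | ‖q.1 - q.2‖ ≤ r}
  have hS : MeasurableSet S := measurableSet_le (by fun_prop) (by fun_prop)
  have hm : Measurable fun q : V × V => S.indicator (fun q => G (x - s • q.1)) q :=
    (hG.comp (by fun_prop)).indicator hS
  have h1 : ∀ v, G (x - s • v) * ν (closedBall v r) =
      ∫⁻ y, S.indicator (fun q => G (x - s • q.1)) (v, y) ∂ν := by
    intro v
    rw [← setLIntegral_const, ← lintegral_indicator measurableSet_closedBall]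
    refine lintegral_congr fun y => ?_
    have : (v, y) ∈ S ↔ y ∈ closedBall v r := by
      rw [mem_closedBall, dist_eq_norm, norm_sub_rev]; rfl
    by_cases hy : (v, y) ∈ S
    · rw [indicator_of_mem hy, indicator_of_mem (this.1 hy)]
    · rw [indicator_of_notMem hy, indicator_of_notMem (fun h => hy (this.2 h))]
  have h2 : ∀ y, ∫⁻ v, S.indicator (fun q => G (x - s • q.1)) (v, y) ≤
      ENNReal.ofReal ((4 * r) ^ finrank ℝ V) * hlMax G (x - s • y) := by
    intro y
    let G' : V → ℝ≥0∞ := (closedBall (x - s • y) (s * r)).indicator G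
    have hG' : Measurable G' := hG.indicator measurableSet_closedBall
    have e : ∀ v, S.indicator (fun q => G (x - s • q.1)) (v, y) = G' (x - s • v) := by
      intro v
      have : (v, y) ∈ S ↔ x - s • v ∈ closedBall (x - s • y) (s * r) := by
        rw [mem_closedBall, dist_eq_norm, sub_sub_sub_cancel_left, ← smul_sub, norm_smul,
          Real.norm_of_nonneg hs.le, mul_le_mul_iff_right₀ hs, norm_sub_rev]
        rfl
      by_cases hy : (v, y) ∈ S
      · simp only [G', indicator_of_mem hy, indicator_of_mem (this.1 hy)]
      · simp only [G', indicator_of_notMem hy, indicator_of_notMem (fun h => hy (this.2 h))]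
    simp_rw [e]
    rw [lintegral_comp_sub_smul_eq x hs hG', lintegral_indicator measurableSet_closedBall]
    calc _ ≤ ENNReal.ofReal ((s ^ finrank ℝ V)⁻¹) *
          (ENNReal.ofReal ((4 * (s * r)) ^ finrank ℝ V) * hlMax G (x - s • y)) := by
          gcongr
          exact lintegral_closedBall_le_hlMax G (by positivity) (by simp; positivity)
      _ = _ := by
          rw [← mul_assoc, ← ENNReal.ofReal_mul (by positivity)]
          congr 2
          rw [show 4 * (s * r) = s * (4 * r) by ring, mul_pow]
          field_simp
  simp_rw [h1]
  rw [lintegral_lintegral_swap (f := fun v y => S.indicator (fun q => G (x - s • q.1)) (v, y))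
    hm.aemeasurable, ← lintegral_const_mul' _ _ (by simp)]
  exact lintegral_mono h2

variable {ν}

theorem integrable_translates_mul {F φ : V → ℝ} (hF : Measurable F) {M : ℝ}
    (hFM : ∀ x, |F x| ≤ M) (hφ : Integrable φ) (s : ℝ) (x : V) :
    Integrable fun v => F (x - s • v) * φ v :=
  hφ.bdd_mul (c := M) (hF.comp (by fun_prop)).aestronglyMeasurable
    (Eventually.of_forall fun v => hFM _)

/-- Changing the dilation parameter in an average of a piece of `ν`. -/
theorem enorm_integral_piece_dilation_le {R : ℝ} (hR0 : 0 ≤ R) (hR : ν (closedBall 0 R)ᶜ = 0)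
    {F : V → ℝ} (hF : Measurable F) {M : ℝ} (hFM : ∀ x, |F x| ≤ M) {s t t' h : ℝ} (hs : 0 < s)
    (ht : t ∈ Icc (1 : ℝ) 2) (ht' : t' ∈ Icc (1 : ℝ) 2) (j : ℕ) (hh : |t - t'| ≤ h)
    (hhj : h ≤ ((2 : ℝ) ^ j)⁻¹) (x : V) :
    ‖∫ v, F (x - (s * t) • v) * piece ν j v‖ₑ ≤
      ENNReal.ofReal (2 ^ finrank ℝ V) * ‖∫ v, F (x - (s * t') • v) * piece ν j v‖ₑ +
      ENNReal.ofReal (pieceLip V j * (2 * (R + 1) * h) *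
        (4 * ((2 * R + 3) * ((2 : ℝ) ^ j)⁻¹)) ^ finrank ℝ V) *
        ∫⁻ y, hlMax (fun u => ‖F u‖ₑ) (x - (s * t) • y) ∂ν := by
  obtain ⟨ht1, ht2⟩ := ht
  obtain ⟨ht1', ht2'⟩ := ht'
  have ht0 : 0 < t := by linarith
  have ht0' : 0 < t' := by linarith
  have hpi := integrable_piece hR j
  have hh0 : 0 ≤ h := (abs_nonneg _).trans hh
  -- Composing the kernel with `v ↦ τ v` turns dilation by `t` into dilation by `t'`. The mesh error
  -- is then the difference between the piece and this composition.
  set τ := t / t' with hτ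
  have hτ0 : 0 < τ := by positivity
  have hτ1 : |1 - τ| ≤ h := by
    have : 1 - τ = -(t - t') / t' := by rw [hτ]; field_simp; ring
    rw [this, abs_div, abs_neg, abs_of_pos ht0', div_le_iff₀ ht0']
    nlinarith
  have hτ2 : 1 / 2 ≤ τ := by rw [hτ, div_le_div_iff₀ two_pos ht0']; linarith
  have hpτ : Integrable fun v => piece ν j (τ • v) := hpi.comp_smul hτ0.ne'
  set r := (2 * R + 3) * ((2 : ℝ) ^ j)⁻¹ with hr
  have hr0 : 0 < r := by positivity
  have hL := pieceLip_nonneg (V := V) j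
  have hsplit : ∫ v, F (x - (s * t) • v) * piece ν j v =
      (∫ v, F (x - (s * t) • v) * piece ν j (τ • v)) +
        ∫ v, F (x - (s * t) • v) * (piece ν j v - piece ν j (τ • v)) := by
    have h1 : Integrable fun v => F (x - (s * t) • v) * piece ν j (τ • v) :=
      integrable_translates_mul hF hFM hpτ _ _
    have h2 : Integrable fun v => F (x - (s * t) • v) * (piece ν j v - piece ν j (τ • v)) :=
      integrable_translates_mul hF hFM (hpi.sub hpτ) _ _
    rw [← integral_add h1 h2]
    congr 1 with v
    ring
  have hfirst : ∫ v, F (x - (s * t) • v) * piece ν j (τ • v) =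
      (τ ^ finrank ℝ V)⁻¹ * ∫ v, F (x - (s * t') • v) * piece ν j v := by
    have := Measure.integral_comp_smul (volume : Measure V)
      (fun v => F (x - (s * t') • v) * piece ν j v) τ
    rw [abs_of_pos (by positivity), smul_eq_mul] at this
    rw [← this]
    refine integral_congr_ae (Eventually.of_forall fun v => ?_)
    simp only [smul_smul]
    congr 4
    rw [hτ]
    field_simp
  have hdiff : ∀ v, ‖piece ν j v - piece ν j (τ • v)‖ₑ ≤
      ENNReal.ofReal (pieceLip V j * (2 * (R + 1) * h)) * ν (closedBall v r) := by
    intro v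
    by_cases hv : 2 * (R + 1) < ‖v‖
    · have h1 : R + 1 < ‖v‖ := by linarith
      have h2 : R + 1 < ‖τ • v‖ := by
        rw [norm_smul, Real.norm_of_nonneg hτ0.le]
        nlinarith
      simp [piece_eq_zero hR h1, piece_eq_zero hR h2]
    rw [not_lt] at hv
    have hd : ‖v - τ • v‖ ≤ 2 * (R + 1) * h := by
      rw [show v - τ • v = (1 - τ) • v by rw [sub_smul, one_smul], norm_smul, mul_comm,
        Real.norm_eq_abs]
      gcongr
    have hd2 : ‖v - τ • v‖ + ((2 : ℝ) ^ j)⁻¹ ≤ r := by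
      have : 2 * (R + 1) * h ≤ 2 * (R + 1) * ((2 : ℝ) ^ j)⁻¹ := by gcongr
      rw [hr]
      nlinarith
    rw [← ofReal_norm, Real.norm_eq_abs, ← ofReal_measureReal,
      ← ENNReal.ofReal_mul (by positivity)]
    refine ENNReal.ofReal_le_ofReal ((abs_piece_sub_le ν j hd2).trans ?_)
    gcongr
  rw [hsplit]
  refine (enorm_add_le _ _).trans (add_le_add ?_ ?_)
  · rw [hfirst, enorm_mul]
    gcongr
    rw [Real.enorm_of_nonneg (by positivity)]
    refine ENNReal.ofReal_le_ofReal ?_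
    rw [← inv_pow]
    refine pow_le_pow_left₀ (by positivity) ?_ _
    rw [inv_le_comm₀ hτ0 two_pos]
    linarith
  · refine (enorm_integral_le_lintegral_enorm _).trans ?_
    calc ∫⁻ v, ‖F (x - (s * t) • v) * (piece ν j v - piece ν j (τ • v))‖ₑ
        ≤ ∫⁻ v, ENNReal.ofReal (pieceLip V j * (2 * (R + 1) * h)) *
            (‖F (x - (s * t) • v)‖ₑ * ν (closedBall v r)) := by
          refine lintegral_mono fun v => ?_
          rw [enorm_mul, mul_left_comm]
          gcongr
          exact hdiff v
      _ ≤ ENNReal.ofReal (pieceLip V j * (2 * (R + 1) * h)) *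
          (ENNReal.ofReal ((4 * r) ^ finrank ℝ V) *
            ∫⁻ y, hlMax (fun u => ‖F u‖ₑ) (x - (s * t) • y) ∂ν) := by
          rw [lintegral_const_mul' _ _ (by simp)]
          gcongr
          exact lintegral_translates_mul_measure_closedBall_le ν hF.enorm (by positivity) hr0 x
      _ = _ := by
          rw [← mul_assoc, ← ENNReal.ofReal_mul (by positivity)]

/-- Averages with respect to a fixed mollification are dominated by the Hardy–Littlewood maximal
function. -/
theorem enorm_integral_smoothed_le {R : ℝ} (hR0 : 0 ≤ R) (hR : ν (closedBall 0 R)ᶜ = 0)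
    {F : V → ℝ} (hF : Measurable F) {s : ℝ} (hs : 0 < s) (n : ℕ) (x : V) :
    ‖∫ v, F (x - s • v) * smoothed ν n v‖ₑ ≤
      ENNReal.ofReal (tentFactor V * ((2 : ℝ) ^ n) ^ finrank ℝ V * ν.real univ *
        (4 * (R + 1)) ^ finrank ℝ V) * hlMax (fun u => ‖F u‖ₑ) x := by
  set B := tentFactor V * ((2 : ℝ) ^ n) ^ finrank ℝ V * ν.real univ with hB
  have hB0 : 0 ≤ B := by have := tentFactor_pos (V := V); positivity
  let G : V → ℝ≥0∞ := (closedBall x (s * (R + 1))).indicator fun u => ‖F u‖ₑ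
  have hG : Measurable G := hF.enorm.indicator measurableSet_closedBall
  have hGm : Measurable fun v => G (x - s • v) := hG.comp (by fun_prop)
  refine (enorm_integral_le_lintegral_enorm _).trans ?_
  calc ∫⁻ v, ‖F (x - s • v) * smoothed ν n v‖ₑ ≤ ∫⁻ v, ENNReal.ofReal B * G (x - s • v) := by
        refine lintegral_mono fun v => ?_
        by_cases hv : R + 1 < ‖v‖
        · simp [smoothed_eq_zero hR hv]
        · have hmem : x - s • v ∈ closedBall x (s * (R + 1)) := by
            rw [mem_closedBall, dist_eq_norm, sub_sub_cancel_left, norm_neg, norm_smul,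
              Real.norm_of_nonneg hs.le]
            gcongr
            exact not_lt.1 hv
          simp only [G, indicator_of_mem hmem]
          rw [enorm_mul, mul_comm]
          gcongr
          rw [Real.enorm_of_nonneg (smoothed_nonneg ν n v)]
          exact ENNReal.ofReal_le_ofReal (smoothed_le ν n v)
    _ ≤ ENNReal.ofReal B * (ENNReal.ofReal ((s ^ finrank ℝ V)⁻¹) *
          (ENNReal.ofReal ((4 * (s * (R + 1))) ^ finrank ℝ V) * hlMax (fun u => ‖F u‖ₑ) x)) := by
        rw [lintegral_const_mul _ hGm, lintegral_comp_sub_smul_eq x hs hG,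
          lintegral_indicator measurableSet_closedBall]
        gcongr
        exact lintegral_closedBall_le_hlMax _ (by positivity) (by simp; positivity)
    _ = _ := by
        rw [← mul_assoc, ← mul_assoc, ← ENNReal.ofReal_mul hB0, ← ENNReal.ofReal_mul (by positivity)]
        congr 2
        rw [show 4 * (s * (R + 1)) = s * (4 * (R + 1)) by ring, mul_pow]
        field_simp

/-- The mollifications of `ν` converge weakly to `ν`. -/
theorem tendsto_integral_mul_smoothed {g : V → ℝ} (hg : Continuous g) (hgc : HasCompactSupport g) :
    Tendsto (fun n => ∫ v, g v * smoothed ν n v) atTop (𝓝 (∫ v, g v ∂ν)) := by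
  obtain ⟨M, hM⟩ := hg.bounded_above_of_compact_support hgc
  have hM0 : 0 ≤ M := (norm_nonneg _).trans (hM 0)
  have hgi : Integrable g := hg.integrable_of_hasCompactSupport hgc
  have hgν : Integrable g ν :=
    Integrable.of_bound hg.aestronglyMeasurable M (Eventually.of_forall hM)
  have hprod : ∀ n, Integrable (fun q : V × V => g q.1 * mollifier n (q.1 - q.2))
      (volume.prod ν) := by
    intro n
    refine (hgi.comp_fst ν).mul_bdd (c := tentFactor V * ((2 : ℝ) ^ n) ^ finrank ℝ V) ?_
      (Eventually.of_forall fun q => ?_)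
    · exact ((continuous_mollifier n).comp (by fun_prop)).aestronglyMeasurable
    · rw [Real.norm_of_nonneg (mollifier_nonneg _ _)]
      exact mollifier_le _ _
  have hmi : ∀ n y, Integrable fun u => g (u + y) * mollifier n u := fun n y =>
    (integrable_mollifier n).bdd_mul (c := M) (hg.comp (by fun_prop)).aestronglyMeasurable
      (Eventually.of_forall fun u => hM _)
  have hfub : ∀ n, ∫ v, g v * smoothed ν n v = ∫ y, (∫ u, g (u + y) * mollifier n u) ∂ν := by
    intro n
    simp only [smoothed, ← integral_const_mul]
    rw [integral_integral_swap (f := fun v y => g v * mollifier n (v - y)) (hprod n)]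
    refine integral_congr_ae (Eventually.of_forall fun y => ?_)
    have := integral_add_right_eq_self (μ := volume) (fun v => g v * mollifier n (v - y)) y
    simpa using this.symm
  have hint : ∀ n, Integrable (fun y => ∫ u, g (u + y) * mollifier n u) ν := by
    intro n
    refine (hprod n).integral_prod_right.congr (Eventually.of_forall fun y => ?_)
    have := integral_add_right_eq_self (μ := volume) (fun v => g v * mollifier n (v - y)) y
    simpa using this.symm
  rw [Metric.tendsto_atTop]
  intro ε hε
  set ε' := ε / (ν.real univ + 1) with hε'
  have hε0 : 0 < ε' := by positivity
  obtain ⟨δ, hδ, hδg⟩ := Metric.uniformContinuous_iff.1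
    (hgc.uniformContinuous_of_continuous hg) ε' hε0
  obtain ⟨N, hN⟩ := exists_pow_lt_of_lt_one hδ (show (2 : ℝ)⁻¹ < 1 by norm_num)
  refine ⟨N, fun n hn => ?_⟩
  have hsmall : ((2 : ℝ) ^ n)⁻¹ < δ := by
    rw [← inv_pow]
    exact (pow_le_pow_of_le_one (by norm_num) (by norm_num) hn).trans_lt hN
  have hpt : ∀ y, ‖(∫ u, g (u + y) * mollifier n u) - g y‖ ≤ ε' := by
    intro y
    have e : (∫ u, g (u + y) * mollifier n u) - g y =
        ∫ u, (g (u + y) - g y) * mollifier n u := by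
      simp_rw [sub_mul]
      rw [integral_sub (hmi n y) ((integrable_mollifier n).const_mul _), integral_const_mul,
        integral_mollifier, mul_one]
    rw [e]
    calc _ ≤ ∫ u : V, ε' * mollifier n u := by
          refine norm_integral_le_of_norm_le ((integrable_mollifier n).const_mul _)
            (Eventually.of_forall fun u => ?_)
          rw [norm_mul, Real.norm_of_nonneg (mollifier_nonneg n u)]
          by_cases hu : ((2 : ℝ) ^ n)⁻¹ ≤ ‖u‖
          · rw [mollifier_eq_zero hu]; simp
          · refine mul_le_mul_of_nonneg_right ?_ (mollifier_nonneg n u)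
            rw [← dist_eq_norm]
            refine (hδg ?_).le
            rw [dist_eq_norm, add_sub_cancel_right]
            exact (not_le.1 hu).trans hsmall
      _ = ε' := by rw [integral_const_mul, integral_mollifier, mul_one]
  rw [hfub, dist_eq_norm, ← integral_sub (hint n) hgν]
  calc _ ≤ ε' * ν.real univ := norm_integral_le_of_norm_le_const (Eventually.of_forall hpt)
    _ < ε' * (ν.real univ + 1) := by gcongr; linarith
    _ = ε := by rw [hε']; field_simp

/-- The mollifier multipliers are bounded by `1`, so Plancherel compares all mollifications with the
square integrable `ν̂`. Uniformity in `n` is what survives in the weak limit. -/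
theorem exists_lintegral_smoothed_sq_le {R C a : ℝ} (hR : ν (closedBall 0 R)ᶜ = 0)
    (hν : ∀ ξ, ‖fourierMeasure ν ξ‖ ≤ C * (1 + ‖ξ‖) ^ (-a)) (hda : finrank ℝ V < 2 * a) :
    ∃ K : ℝ≥0, ∀ n : ℕ, ∫⁻ y, ‖smoothed ν n y‖ₑ ^ (2 : ℝ) ≤ K := by
  have hint : Integrable (fun ξ : V => C ^ 2 * (1 + ‖ξ‖) ^ (-(2 * a))) :=
    (integrable_one_add_norm (by linarith)).const_mul _
  refine ⟨(∫⁻ ξ : V, ENNReal.ofReal (C ^ 2 * (1 + ‖ξ‖) ^ (-(2 * a)))).toNNReal, fun n => ?_⟩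
  rw [ENNReal.coe_toNNReal hint.lintegral_lt_top.ne]
  have h1 := lintegral_enorm_sq_fourier
    (f := fun y => (smoothed ν n y : ℂ)) (integrable_smoothed hR n).ofReal
    ((continuous_smoothed ν n).memLp_of_eq_zero (fun x hx => smoothed_eq_zero hR hx) 2)
  have h2 : ∀ y, ‖(smoothed ν n y : ℂ)‖ₑ = ‖smoothed ν n y‖ₑ := fun y => by
    rw [← ofReal_norm, ← ofReal_norm, Complex.norm_real]
  simp only [h2] at h1
  rw [← h1]
  refine lintegral_mono fun ξ => ?_
  rw [← ofReal_norm, ENNReal.ofReal_rpow_of_nonneg (norm_nonneg _) (by norm_num)]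
  refine ENNReal.ofReal_le_ofReal ?_
  have h3 : ‖𝓕 (fun y => (smoothed ν n y : ℂ)) ξ‖ ≤ C * (1 + ‖ξ‖) ^ (-a) := by
    rw [fourier_smoothed, norm_mul]
    exact (mul_le_of_le_one_left (norm_nonneg _) (norm_fourier_mollifier_le_one n ξ)).trans (hν ξ)
  calc _ ≤ (C * (1 + ‖ξ‖) ^ (-a)) ^ (2 : ℝ) := by gcongr
    _ = C ^ 2 * (1 + ‖ξ‖) ^ (-(2 * a)) := by
      rw [Real.rpow_ofNat, mul_pow, ← Real.rpow_mul_natCast (by positivity)]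
      congr 2
      push_cast
      ring

/-- A measure with square integrable Fourier transform is absolutely continuous. -/
theorem absolutelyContinuous_of_fourierMeasure_le {R C a : ℝ} (hR : ν (closedBall 0 R)ᶜ = 0)
    (hν : ∀ ξ, ‖fourierMeasure ν ξ‖ ≤ C * (1 + ‖ξ‖) ^ (-a)) (hda : finrank ℝ V < 2 * a) :
    ν ≪ volume := by
  obtain ⟨K, hK⟩ := exists_lintegral_smoothed_sq_le hR hν hda
  -- Test `ν` with a Urysohn function between `Q` and `U`, pass to the limit in the mollifications,
  -- and apply Cauchy–Schwarz with the uniform `L²` bound. Shrinking `U` to a null set `Q` then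
  -- gives zero mass.
  have hopen : ∀ Q U : Set V, IsCompact Q → IsOpen U → Q ⊆ U →
      ν Q ≤ volume U ^ (1 / 2 : ℝ) * (K : ℝ≥0∞) ^ (1 / 2 : ℝ) := by
    intro Q U hQ hU hQU
    by_cases htop : volume U ^ (1 / 2 : ℝ) * (K : ℝ≥0∞) ^ (1 / 2 : ℝ) = ∞
    · rw [htop]; exact le_top
    obtain ⟨g, hg1, hgs, hgU, hg01⟩ := exists_continuousMap_one_of_isCompact_subset_isOpen hQ hU hQU
    have hgi : Integrable g ν := g.continuous.integrable_of_hasCompactSupport hgs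
    have h1 : ν Q ≤ ENNReal.ofReal (∫ v, g v ∂ν) := by
      rw [ofReal_integral_eq_lintegral_ofReal hgi (Eventually.of_forall fun x => (hg01 x).1),
        ← setLIntegral_one]
      refine (setLIntegral_mono' hQ.measurableSet fun x hx => ?_).trans (setLIntegral_le_lintegral Q _)
      simp [hg1 hx]
    refine h1.trans ?_
    rw [ENNReal.ofReal_le_iff_le_toReal htop]
    refine le_of_tendsto' (tendsto_integral_mul_smoothed (ν := ν) g.continuous hgs) fun n => ?_
    rw [← ENNReal.ofReal_le_iff_le_toReal htop]
    have hm1 : AEMeasurable (fun v => ‖g v‖ₑ) volume := g.continuous.measurable.enorm.aemeasurable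
    have hm2 : AEMeasurable (fun v => ‖smoothed ν n v‖ₑ) volume :=
      (continuous_smoothed ν n).measurable.enorm.aemeasurable
    calc ENNReal.ofReal (∫ v, g v * smoothed ν n v) ≤ ‖∫ v, g v * smoothed ν n v‖ₑ :=
          Real.ofReal_le_enorm _
      _ ≤ ∫⁻ v, ‖g v * smoothed ν n v‖ₑ := enorm_integral_le_lintegral_enorm _
      _ = ∫⁻ v, ‖g v‖ₑ * ‖smoothed ν n v‖ₑ := by simp_rw [enorm_mul]
      _ ≤ (∫⁻ v, ‖g v‖ₑ ^ (2 : ℝ)) ^ (1 / 2 : ℝ) *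
            (∫⁻ v, ‖smoothed ν n v‖ₑ ^ (2 : ℝ)) ^ (1 / 2 : ℝ) :=
          ENNReal.lintegral_mul_le_Lp_mul_Lq _ Real.HolderConjugate.two_two hm1 hm2
      _ ≤ _ := by
          gcongr
          · rw [← lintegral_indicator_one hU.measurableSet]
            refine lintegral_mono fun v => ?_
            by_cases hv : v ∈ U
            · rw [indicator_of_mem hv, Pi.one_apply]
              refine ENNReal.rpow_le_one ?_ (by norm_num)
              rw [Real.enorm_of_nonneg (hg01 v).1]
              simpa using (hg01 v).2
            · rw [image_eq_zero_of_notMem_tsupport fun h => hv (hgU h)]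
              simp
          · exact hK n
  refine Measure.AbsolutelyContinuous.mk fun A hA hA0 => ?_
  rw [hA.measure_eq_iSup_isCompact ν]
  simp only [ENNReal.iSup_eq_zero]
  intro Q hQA hQ
  have hQ0 : volume Q = 0 := measure_mono_null hQA hA0
  have hle : ∀ ε : ℝ≥0∞, ε ≠ 0 → ν Q ≤ ε ^ (1 / 2 : ℝ) * (K : ℝ≥0∞) ^ (1 / 2 : ℝ) := by
    intro ε hε
    obtain ⟨U, hQU, hU, hUε⟩ := hQ.exists_isOpen_lt_add (μ := volume) hε
    rw [hQ0, zero_add] at hUε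
    exact (hopen Q U hQ hU hQU).trans (by gcongr)
  have ht : Tendsto (fun ε : ℝ≥0∞ => ε ^ (1 / 2 : ℝ) * (K : ℝ≥0∞) ^ (1 / 2 : ℝ)) (𝓝[>] 0) (𝓝 0) := by
    have h1 : Tendsto (fun ε : ℝ≥0∞ => ε ^ (1 / 2 : ℝ)) (𝓝[>] 0) (𝓝 0) := by
      have := (ENNReal.continuous_rpow_const (y := (1 / 2 : ℝ))).tendsto 0
      rw [ENNReal.zero_rpow_of_pos (by norm_num)] at this
      exact this.mono_left nhdsWithin_le_nhds
    simpa using ENNReal.Tendsto.mul_const h1 (b := (K : ℝ≥0∞) ^ (1 / 2 : ℝ))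
      (Or.inr (ENNReal.rpow_ne_top_of_nonneg (by norm_num) ENNReal.coe_ne_top))
  exact le_antisymm (ge_of_tendsto ht (eventually_nhdsWithin_of_forall fun ε hε => hle ε hε.ne'))
    zero_le

end KernelEstimates

end

/-! ### Interpolation over nets and summability in the frequency. -/

noncomputable section

section Interpolation

open Module Metric
open scoped FourierTransform RealInnerProductSpace

variable {V : Type*} [NormedAddCommGroup V] [InnerProductSpace ℝ V] [FiniteDimensional ℝ V]
  [MeasurableSpace V] [BorelSpace V]

theorem meas_ofReal_lt_le_lintegral_rpow {α : Type*} {m : MeasurableSpace α} {μ : Measure α}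
    {H : α → ℝ≥0∞} (hH : Measurable H) {q t : ℝ} (hq : 0 < q) (ht : 0 < t) :
    μ {x | ENNReal.ofReal t < H x} ≤ ENNReal.ofReal (t ^ (-q)) * ∫⁻ x, H x ^ q ∂μ := by
  have h := mul_meas_ge_le_lintegral (μ := μ) (hH.pow_const q) (ENNReal.ofReal (t ^ q))
  have hsub : {x | ENNReal.ofReal t < H x} ⊆ {x | ENNReal.ofReal (t ^ q) ≤ H x ^ q} := by
    intro x hx
    change ENNReal.ofReal (t ^ q) ≤ H x ^ q
    rw [← ENNReal.ofReal_rpow_of_pos ht]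
    exact ENNReal.rpow_le_rpow (le_of_lt hx) hq.le
  have e : ENNReal.ofReal (t ^ (-q)) * ENNReal.ofReal (t ^ q) = 1 := by
    rw [← ENNReal.ofReal_mul (by positivity), ← Real.rpow_add ht, neg_add_cancel, Real.rpow_zero,
      ENNReal.ofReal_one]
  calc _ ≤ μ {x | ENNReal.ofReal (t ^ q) ≤ H x ^ q} := measure_mono hsub
    _ = ENNReal.ofReal (t ^ (-q)) *
        (ENNReal.ofReal (t ^ q) * μ {x | ENNReal.ofReal (t ^ q) ≤ H x ^ q}) := by
        rw [← mul_assoc, e, one_mul]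
    _ ≤ _ := by gcongr

theorem netMax_add_le {φ F G : V → ℝ} (hφ : Integrable φ) (hF : Measurable F) (hG : Measurable G)
    {M : ℝ} (hFM : ∀ x, |F x| ≤ M) (hGM : ∀ x, |G x| ≤ M) (D : Finset ℝ) (x : V) :
    netMax φ D (fun x => F x + G x) x ≤ netMax φ D F x + netMax φ D G x := by
  refine iSup_le fun l => iSup₂_le fun t ht => ?_
  simp_rw [add_mul]
  rw [integral_add (integrable_translates_mul hF hFM hφ _ _)
    (integrable_translates_mul hG hGM hφ _ _)]
  refine (enorm_add_le _ _).trans (add_le_add ?_ ?_)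
  · exact le_iSup_of_le l (le_iSup₂_of_le t ht le_rfl)
  · exact le_iSup_of_le l (le_iSup₂_of_le t ht le_rfl)

/-- Interpolation between an `L²` bound and an `L^q` bound for the maximal operator over a net. -/
theorem lintegral_netMax_rpow_le_of_bounds {φ : V → ℝ} (hφm : Measurable φ) (hφ : Integrable φ)
    (D : Finset ℝ) {p q K : ℝ} (hq : 0 < q) (hqp : q < p) (hp2 : p < 2) (hK : 0 < K) {M RF : ℝ}
    {B₁ B₂ : ℝ≥0∞}
    (h2 : ∀ F : V → ℝ, Measurable F → (∀ x, |F x| ≤ M) → (∀ x, RF < ‖x‖ → F x = 0) →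
      ∫⁻ x, netMax φ D F x ^ (2 : ℝ) ≤ B₂ * ∫⁻ x, ‖F x‖ₑ ^ (2 : ℝ))
    (h1 : ∀ F : V → ℝ, Measurable F → ∫⁻ x, netMax φ D F x ^ q ≤ B₁ * ∫⁻ x, ‖F x‖ₑ ^ q)
    {F : V → ℝ} (hF : Measurable F) (hFM : ∀ x, |F x| ≤ M) (hF0 : ∀ x, RF < ‖x‖ → F x = 0) :
    ∫⁻ x, netMax φ D F x ^ p ≤ ENNReal.ofReal p *
      (4 * B₂ * ENNReal.ofReal (K ^ (2 - p) / (2 - p)) +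
        ENNReal.ofReal (2 ^ q) * B₁ * ENNReal.ofReal (K ^ (q - p) / (p - q))) *
        ∫⁻ x, ‖F x‖ₑ ^ p := by
  refine lintegral_rpow_le_of_meas_lt_le hq hqp hp2 hK hF.enorm (measurable_netMax hF hφm D) _ _ ?_
  intro t ht
  have hM0 : 0 ≤ M := (abs_nonneg _).trans (hFM 0)
  -- The part of `F` below height `K t` goes to the `L²` bound and the rest to the `L^q` bound.
  -- Truncation preserves the bound `M` and the vanishing outside radius `RF` demanded by `h2`.
  let S : Set V := {x | ‖F x‖ₑ ≤ ENNReal.ofReal (K * t)}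
  let T : Set V := {x | ENNReal.ofReal (K * t) < ‖F x‖ₑ}
  have hS : MeasurableSet S := measurableSet_le hF.enorm measurable_const
  have hT : MeasurableSet T := measurableSet_lt measurable_const hF.enorm
  have hST : T = Sᶜ := by ext x; simp [S, T]
  have hFS : Measurable (S.indicator F) := hF.indicator hS
  have hFT : Measurable (T.indicator F) := hF.indicator hT
  have hbd : ∀ (A : Set V) x, |A.indicator F x| ≤ M := by
    intro A x
    by_cases hx : x ∈ A
    · rw [indicator_of_mem hx]; exact hFM x
    · rw [indicator_of_notMem hx]; simpa
  have hz : ∀ x, RF < ‖x‖ → S.indicator F x = 0 := by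
    intro x hx
    by_cases hxS : x ∈ S
    · rw [indicator_of_mem hxS]; exact hF0 x hx
    · rw [indicator_of_notMem hxS]
  have hpow : ∀ (A : Set V) (_ : MeasurableSet A) {r : ℝ} (_ : 0 < r),
      ∫⁻ x, ‖A.indicator F x‖ₑ ^ r = ∫⁻ x in A, ‖F x‖ₑ ^ r := by
    intro A hA r hr
    rw [← lintegral_indicator hA]
    refine lintegral_congr fun x => ?_
    by_cases hx : x ∈ A
    · simp [hx]
    · simp [hx, hr]
  have hsum : ∀ x, netMax φ D F x ≤ netMax φ D (S.indicator F) x + netMax φ D (T.indicator F) x := by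
    intro x
    have := netMax_add_le hφ hFS hFT (hbd S) (hbd T) D x
    have e : (fun x => S.indicator F x + T.indicator F x) = F := by
      rw [hST]; exact indicator_self_add_compl S F
    rwa [e] at this
  have hsub : {x | ENNReal.ofReal t < netMax φ D F x} ⊆
      {x | ENNReal.ofReal (t / 2) < netMax φ D (S.indicator F) x} ∪
        {x | ENNReal.ofReal (t / 2) < netMax φ D (T.indicator F) x} := by
    intro x hx
    by_contra hcon
    simp only [mem_union, mem_ofPred_eq, not_or, not_lt] at hcon
    have : netMax φ D F x ≤ ENNReal.ofReal t := by
      refine (hsum x).trans ((add_le_add hcon.1 hcon.2).trans ?_)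
      rw [← ENNReal.ofReal_add (by positivity) (by positivity), add_halves]
    exact absurd hx (not_lt.2 this)
  have hhalf : ∀ r : ℝ, (t / 2) ^ (-r) = 2 ^ r * t ^ (-r) := by
    intro r
    rw [Real.div_rpow ht.le (by norm_num), Real.rpow_neg (by norm_num : (0 : ℝ) ≤ 2), div_inv_eq_mul,
      mul_comm]
  refine (measure_mono hsub).trans ((measure_union_le _ _).trans (add_le_add ?_ ?_))
  · refine (meas_ofReal_lt_le_lintegral_rpow (measurable_netMax hFS hφm D) two_pos
      (half_pos ht)).trans ?_
    rw [hhalf, ENNReal.ofReal_mul (by positivity)]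
    calc _ ≤ ENNReal.ofReal (2 ^ (2 : ℝ)) * ENNReal.ofReal (t ^ (-2 : ℝ)) *
          (B₂ * ∫⁻ x, ‖S.indicator F x‖ₑ ^ (2 : ℝ)) := by
          gcongr
          exact h2 _ hFS (hbd S) hz
      _ = _ := by
          rw [hpow S hS two_pos]
          have : ENNReal.ofReal ((2 : ℝ) ^ (2 : ℝ)) = 4 := by norm_num
          rw [this]
          ring
  · refine (meas_ofReal_lt_le_lintegral_rpow (measurable_netMax hFT hφm D) hq
      (half_pos ht)).trans ?_
    rw [hhalf, ENNReal.ofReal_mul (by positivity)]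
    calc _ ≤ ENNReal.ofReal (2 ^ q) * ENNReal.ofReal (t ^ (-q)) *
          (B₁ * ∫⁻ x, ‖T.indicator F x‖ₑ ^ q) := by
          gcongr
          exact h1 _ hFT
      _ = _ := by
          rw [hpow T hT hq]
          ring

/-- `E` has nets of the cardinality expected of a set of upper Minkowski dimension `b`. -/
def HasNets (E : Set ℝ) (b : ℝ) : Prop :=
  ∀ ε : ℝ, 0 < ε → ∃ K : ℝ, ∀ δ : ℝ, 0 < δ → δ ≤ 1 → ∃ D : Finset ℝ, ↑D ⊆ E ∧
    (∀ t ∈ E, ∃ t' ∈ D, |t - t'| ≤ δ) ∧ (D.card : ℝ) ≤ K * δ ^ (-(b + ε))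

/-- The logarithmic losses are linear in `j` and are absorbed here into an arbitrarily small
exponential. -/
theorem natCast_le_mul_two_rpow {κ : ℝ} (hκ : 0 < κ) (j : ℕ) :
    (j : ℝ) ≤ (κ * Real.log 2)⁻¹ * 2 ^ (κ * j) := by
  have hl : 0 < Real.log 2 := Real.log_pos one_lt_two
  have h := Real.add_one_le_exp (Real.log 2 * (κ * j))
  rw [Real.rpow_def_of_pos two_pos]
  rw [inv_mul_eq_div, le_div_iff₀ (by positivity)]
  nlinarith

/-- The maximal operators over suitable nets of the pieces of `ν` have summable `Lᵖ` norms. -/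
theorem exists_lintegral_netMax_piece_le [Nontrivial V] {ν : Measure V} [IsFiniteMeasure ν]
    {R C b : ℝ} (hR : ν (closedBall 0 R)ᶜ = 0) (hb0 : 0 < b) (hb1 : b ≤ 1)
    (hν : ∀ ξ, ‖fourierMeasure ν ξ‖ ≤ C * (1 + ‖ξ‖) ^ (-((finrank ℝ V + b) / 2)))
    {E : Set ℝ} (hE : E ⊆ Icc 1 2) (hEb : HasNets E b) {p : ℝ} (hp : 1 < p) (hp2 : p < 2) :
    ∃ (κ : ℝ) (K : ℝ≥0) (D : ℕ → Finset ℝ), 0 < κ ∧ (∀ j, ↑(D j) ⊆ E) ∧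
      (∀ j, ∀ t ∈ E, ∃ t' ∈ D j, |t - t'| ≤ 2 ^ (-(1 + κ) * j)) ∧
      ∀ (j : ℕ) (F : V → ℝ) (M RF : ℝ), Measurable F → (∀ x, |F x| ≤ M) →
        (∀ x, RF < ‖x‖ → F x = 0) → ∫⁻ x, netMax (piece ν j) (D j) F x ^ p ≤
          K * ENNReal.ofReal (2 ^ (-(3 * κ) * j)) * ∫⁻ x, ‖F x‖ₑ ^ p := by
  -- The losses near `L¹` add up to `5κ`, while interpolation with threshold `2^(j/4)` gains `(p -
  -- 1)/8 = 8κ` there, leaving `-3κ`.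
  obtain ⟨κ, hκ⟩ : ∃ κ : ℝ, κ = (p - 1) / 64 := ⟨_, rfl⟩
  have hκ0 : 0 < κ := by rw [hκ]; linarith
  have hκ1 : κ < 1 / 64 := by rw [hκ]; linarith
  have hd : (1 : ℝ) ≤ finrank ℝ V := by exact_mod_cast (finrank_pos : 0 < finrank ℝ V)
  obtain ⟨KN, hKN⟩ := hEb κ hκ0
  have hδ : ∀ j : ℕ, (0 : ℝ) < 2 ^ (-(1 + κ) * j) ∧ (2 : ℝ) ^ (-(1 + κ) * j) ≤ 1 := fun j =>
    ⟨by positivity, Real.rpow_le_one_of_one_le_of_nonpos one_le_two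
      (mul_nonpos_of_nonpos_of_nonneg (by linarith) (by positivity))⟩
  choose D hDE hDnet hDcard using fun j : ℕ => hKN _ (hδ j).1 (hδ j).2
  -- For the `L²` norm the condition is `2s < b`, so `s` is just below `b/2`, cut off at `0` when `b
  -- < κ`.
  obtain ⟨K₁, hK₁⟩ := exists_lintegral_fourier_piece_sq_le hR hν (s := max 0 ((b - κ) / 2))
    (le_max_left _ _) (max_le zero_le_one (by linarith)) (by
      rcases max_choice 0 ((b - κ) / 2) with h | h <;> rw [h] <;> linarith)
  -- For the square function only `s < (d + b)/2` and `s ≤ 1` are needed. As `d ≥ 1` and `b ≤ 1`,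
  -- the value `b/2 + 1/4` is admissible and beats the cardinality `2^(bj)` by `2^(-j/2)`.
  obtain ⟨K₂, hK₂⟩ := exists_tsum_fourier_piece_sq_le hR hν (s := (b + 1 / 2) / 2) (by linarith)
    (by linarith) (by linarith)
  obtain ⟨C₀, hC₀⟩ := exists_lintegral_netMax_rpow_le (V := V) (p := (1 + p) / 2) (by linarith)
    (by linarith) (R + 1)
  -- The exponent is `(1 + κ)(b + κ) ≤ b + 3κ`, using `b ≤ 1` and `κ ≤ 1`.
  have hcard : ∀ j : ℕ, ((D j).card : ℝ) ≤ |KN| * 2 ^ ((b + 3 * κ) * j) := by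
    intro j
    refine (hDcard j).trans ?_
    rw [← Real.rpow_mul (by norm_num)]
    refine mul_le_mul (le_abs_self _) (Real.rpow_le_rpow_of_exponent_le one_le_two ?_)
      (by positivity) (abs_nonneg _)
    have hj : (0 : ℝ) ≤ j * κ := by positivity
    nlinarith [mul_nonneg hj (sub_nonneg.2 hκ1.le), mul_nonneg hj (sub_nonneg.2 hb1)]
  -- The scale `ρ = 2^(-(N₀ + (d+1)(j+1)))` lies below the inverse Lipschitz constant of the piece,
  -- and `N₁` accounts for its support. The resulting `m` is linear in `j`.
  obtain ⟨N₀, hN₀⟩ := pow_unbounded_of_one_lt (2 * tentFactor V * ν.real univ) (one_lt_two (α := ℝ))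
  obtain ⟨N₁, hN₁⟩ := pow_unbounded_of_one_lt (2 * (R + 1) + 1) (one_lt_two (α := ℝ))
  have hone : ∀ (c : ℝ) (j : ℕ), 0 ≤ c → (1 : ℝ) ≤ 2 ^ (c * j) := fun c j hc =>
    Real.one_le_rpow one_le_two (by positivity)
  obtain ⟨A, hA⟩ : ∃ A : ℝ, A = N₀ + N₁ + finrank ℝ V + 4 + (finrank ℝ V + 1) *
    (κ * Real.log 2)⁻¹ := ⟨_, rfl⟩
  have hl : 0 < Real.log 2 := Real.log_pos one_lt_two
  have hA0 : 0 ≤ A := by rw [hA]; positivity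
  have hm : ∀ j : ℕ, ((N₀ + (finrank ℝ V + 1) * (j + 1) + N₁ + 3 : ℕ) : ℝ) ≤ A * 2 ^ (κ * j) := by
    intro j
    have h1 := natCast_le_mul_two_rpow hκ0 j
    have h2 := hone κ j hκ0.le
    have h3 : (0 : ℝ) ≤ N₀ + N₁ + finrank ℝ V + 4 := by positivity
    push_cast
    rw [hA, add_mul]
    have h4 : (finrank ℝ V + 1 : ℝ) * j ≤ (finrank ℝ V + 1) * ((κ * Real.log 2)⁻¹ * 2 ^ (κ * j)) := by
      gcongr
    nlinarith
  have hB₁ : ∀ (j : ℕ) (F : V → ℝ), Measurable F →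
      ∫⁻ x, netMax (piece ν j) (D j) F x ^ ((1 + p) / 2) ≤
        C₀ * ENNReal.ofReal (A * (1 + |KN| * K₁) * 2 ^ (5 * κ * j)) *
          ∫⁻ x, ‖F x‖ₑ ^ ((1 + p) / 2) := by
    intro j F hF
    have h := hC₀ (piece ν j) (D j) (pieceLip V j * ν.real univ)
      (((2 : ℝ) ^ (N₀ + (finrank ℝ V + 1) * (j + 1)))⁻¹) (N₀ + (finrank ℝ V + 1) * (j + 1) + N₁) F
      (continuous_piece ν j).measurable (fun x hx => piece_eq_zero hR hx)
      (fun x y => abs_piece_sub_le_univ ν j x y)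
      (mul_nonneg (pieceLip_nonneg j) measureReal_nonneg) (fun t ht => hE (hDE j ht)) (by positivity)
      (inv_le_one_of_one_le₀ (one_le_pow₀ one_le_two)) (by
        rw [← div_eq_mul_inv, div_le_one (by positivity), pow_add, pow_mul', pieceLip,
          mul_right_comm]
        gcongr) (by
        rw [pow_add, mul_right_comm, mul_inv_cancel₀ (by positivity), one_mul]
        exact hN₁.le) hF
    refine h.trans ?_
    rw [mul_assoc (C₀ : ℝ≥0∞)]
    gcongr
    have h1 : (D j).card * ∫⁻ x, ‖piece ν j x‖ₑ ^ (2 : ℝ) ≤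
        ENNReal.ofReal (|KN| * K₁ * 2 ^ (4 * κ * j)) := by
      calc _ ≤ ENNReal.ofReal (|KN| * 2 ^ ((b + 3 * κ) * j)) *
            (K₁ * ENNReal.ofReal (2 ^ (-(b - κ) * j))) := by
            gcongr
            · rw [← ENNReal.ofReal_natCast]
              exact ENNReal.ofReal_le_ofReal (hcard j)
            · refine (hK₁ j).trans ?_
              gcongr
              · norm_num
              · linarith [le_max_right 0 ((b - κ) / 2)]
        _ = _ := by
            rw [← ENNReal.ofReal_coe_nnreal, ← ENNReal.ofReal_mul (by positivity),
              ← ENNReal.ofReal_mul (by positivity)]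
            congr 1
            rw [show 4 * κ * j = (b + 3 * κ) * j + -(b - κ) * j by ring, Real.rpow_add two_pos]
            ring
    calc _ ≤ ENNReal.ofReal (A * 2 ^ (κ * j)) *
          (ENNReal.ofReal (2 ^ (4 * κ * j)) + ENNReal.ofReal (|KN| * K₁ * 2 ^ (4 * κ * j))) := by
          gcongr
          · rw [← ENNReal.ofReal_natCast]
            exact ENNReal.ofReal_le_ofReal (hm j)
          · rw [ENNReal.one_le_ofReal]
            exact hone _ _ (by positivity)
      _ = _ := by
          rw [← ENNReal.ofReal_add (by positivity) (by positivity),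
            ← ENNReal.ofReal_mul (by positivity)]
          congr 1
          rw [show 5 * κ * j = κ * j + 4 * κ * j by ring, Real.rpow_add two_pos]
          ring
  have hB₂ : ∀ (j : ℕ) (M RF : ℝ) (F : V → ℝ), Measurable F → (∀ x, |F x| ≤ M) →
      (∀ x, RF < ‖x‖ → F x = 0) → ∫⁻ x, netMax (piece ν j) (D j) F x ^ (2 : ℝ) ≤
        ENNReal.ofReal (|KN| * K₂ * 2 ^ ((3 * κ - 1 / 2) * j)) * ∫⁻ x, ‖F x‖ₑ ^ (2 : ℝ) := by
    intro j M RF F hF hFM hF0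
    refine (lintegral_netMax_sq_le hF hFM hF0 (continuous_piece ν j)
      (fun x hx => piece_eq_zero hR hx) (hK₂ j) (D j)).trans ?_
    gcongr
    calc _ ≤ ENNReal.ofReal (|KN| * 2 ^ ((b + 3 * κ) * j)) *
          (K₂ * ENNReal.ofReal (2 ^ (-(2 * ((b + 1 / 2) / 2)) * j))) := by
          gcongr
          rw [← ENNReal.ofReal_natCast]
          exact ENNReal.ofReal_le_ofReal (hcard j)
      _ = _ := by
          rw [← ENNReal.ofReal_coe_nnreal, ← ENNReal.ofReal_mul (by positivity),
            ← ENNReal.ofReal_mul (by positivity)]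
          congr 1
          rw [show (3 * κ - 1 / 2) * j = (b + 3 * κ) * j + -(2 * ((b + 1 / 2) / 2)) * j by ring,
            Real.rpow_add two_pos]
          ring
  refine ⟨κ, (p * (4 * (|KN| * K₂) / (2 - p) + 2 ^ ((1 + p) / 2) * C₀ * (A * (1 + |KN| * K₁)) /
    (p - (1 + p) / 2))).toNNReal, D, hκ0, hDE, hDnet, fun j F M RF hF hFM hF0 => ?_⟩
  -- The threshold `2^(j/4)` is small enough to keep the `L²` gain `2^(-j/2)`, since it costs at
  -- most `2^((2-p)j/4)`, and large enough to overcome the loss near `L¹`.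
  have h := lintegral_netMax_rpow_le_of_bounds (continuous_piece ν j).measurable
    (integrable_piece hR j) (D j) (q := (1 + p) / 2) (p := p) (K := 2 ^ ((1 / 4 : ℝ) * j))
    (by linarith) (by linarith) hp2 (by positivity) (hB₂ j M RF) (hB₁ j) hF hFM hF0
  refine h.trans (mul_le_mul_left ?_ _)
  have hp2' : 0 < 2 - p := by linarith
  have hpq : 0 < p - (1 + p) / 2 := by linarith
  have e4 : (4 : ℝ≥0∞) = ENNReal.ofReal 4 := by norm_num
  rw [e4, ← ENNReal.ofReal_coe_nnreal (p := C₀), ← ENNReal.ofReal_coe_nnreal,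
    ← ENNReal.ofReal_mul (by positivity), ← ENNReal.ofReal_mul (by positivity),
    ← ENNReal.ofReal_mul (by positivity), ← ENNReal.ofReal_mul (by positivity),
    ← ENNReal.ofReal_mul (by positivity), ← ENNReal.ofReal_add (by positivity) (by positivity),
    ← ENNReal.ofReal_mul (by positivity), ← ENNReal.ofReal_mul (by positivity),
    Real.coe_toNNReal _ (by positivity)]
  refine ENNReal.ofReal_le_ofReal ?_
  have hj : (0 : ℝ) ≤ j := by positivity
  have hr1 : (2 : ℝ) ^ ((3 * κ - 1 / 2) * j) * ((2 : ℝ) ^ ((1 / 4 : ℝ) * j)) ^ (2 - p) ≤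
      2 ^ (-(3 * κ) * j) := by
    rw [← Real.rpow_mul (by norm_num), ← Real.rpow_add two_pos]
    refine Real.rpow_le_rpow_of_exponent_le one_le_two ?_
    nlinarith
  have hr2 : (2 : ℝ) ^ (5 * κ * j) * ((2 : ℝ) ^ ((1 / 4 : ℝ) * j)) ^ ((1 + p) / 2 - p) =
      2 ^ (-(3 * κ) * j) := by
    rw [← Real.rpow_mul (by norm_num), ← Real.rpow_add two_pos]
    congr 1
    rw [hκ]
    ring
  rw [mul_assoc p]
  refine mul_le_mul_of_nonneg_left ?_ (by linarith)
  rw [add_mul]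
  refine add_le_add ?_ (le_of_eq ?_)
  · calc _ = 4 * (|KN| * K₂) / (2 - p) * ((2 : ℝ) ^ ((3 * κ - 1 / 2) * j) *
          ((2 : ℝ) ^ ((1 / 4 : ℝ) * j)) ^ (2 - p)) := by ring
      _ ≤ _ := by gcongr
  · rw [← hr2]; ring

end Interpolation

end

/-! ### Domination by continuous functions and extension of a priori bounds. -/

noncomputable section

section Density

open Module Metric

variable {V : Type*} [NormedAddCommGroup V] [InnerProductSpace ℝ V] [FiniteDimensional ℝ V]
  [MeasurableSpace V] [BorelSpace V]

/-- The `Lᵖ` norm of a function with values in `[0, ∞]`. -/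
def powNorm (p : ℝ) (G : V → ℝ≥0∞) : ℝ≥0∞ := (∫⁻ x, G x ^ p) ^ (1 / p)

theorem powNorm_rpow {p : ℝ} (hp : 0 < p) (G : V → ℝ≥0∞) : powNorm p G ^ p = ∫⁻ x, G x ^ p := by
  rw [powNorm, ← ENNReal.rpow_mul, one_div_mul_cancel hp.ne', ENNReal.rpow_one]

theorem powNorm_mono {p : ℝ} (hp : 0 < p) {G H : V → ℝ≥0∞} (h : ∀ x, G x ≤ H x) :
    powNorm p G ≤ powNorm p H := by
  unfold powNorm
  gcongr
  exact h _

theorem powNorm_add_le {p : ℝ} (hp : 1 ≤ p) {G H : V → ℝ≥0∞} (hG : AEMeasurable G)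
    (hH : AEMeasurable H) : powNorm p (fun x => G x + H x) ≤ powNorm p G + powNorm p H :=
  ENNReal.lintegral_Lp_add_le hG hH hp

theorem powNorm_const_mul {p : ℝ} (hp : 0 < p) {c : ℝ≥0∞} (hc : c ≠ ∞) (G : V → ℝ≥0∞) :
    powNorm p (fun x => c * G x) = c * powNorm p G := by
  unfold powNorm
  simp_rw [ENNReal.mul_rpow_of_nonneg _ _ hp.le]
  rw [lintegral_const_mul' _ _ (ENNReal.rpow_ne_top_of_nonneg hp.le hc),
    ENNReal.mul_rpow_of_nonneg _ _ (by positivity), ← ENNReal.rpow_mul,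
    mul_one_div_cancel hp.ne', ENNReal.rpow_one]

theorem powNorm_le_of_lintegral_le {p : ℝ} (hp : 0 < p) {c : ℝ≥0∞} {G H : V → ℝ≥0∞}
    (h : ∫⁻ x, G x ^ p ≤ c * ∫⁻ x, H x ^ p) : powNorm p G ≤ c ^ (1 / p) * powNorm p H := by
  unfold powNorm
  rw [← ENNReal.mul_rpow_of_nonneg _ _ (by positivity)]
  gcongr

theorem eLpNorm_eq_powNorm {E : Type*} [ENorm E] {p : ℝ} (hp : 0 < p) (f : V → E) :
    eLpNorm f (ENNReal.ofReal p) volume = powNorm p (fun x => ‖f x‖ₑ) := by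
  rw [eLpNorm_eq_lintegral_rpow_enorm_toReal (by simpa using hp) (by simp),
    ENNReal.toReal_ofReal hp.le]
  rfl

/-- Null sets pulled back by `v ↦ x - s v` are Lebesgue null for every single `x`, hence `ν`-null.
Averages of almost everywhere defined functions thus make sense for all dilations at once, with no
exceptional set of `x`. -/
theorem ae_comp_sub_smul {ν : Measure V} (hν : ν ≪ volume) {s : ℝ} (hs : 0 < s) {P : V → Prop}
    (h : ∀ᵐ y, P y) (x : V) : ∀ᵐ v ∂ν, P (x - s • v) := by
  refine hν.ae_le ?_
  set N := toMeasurable volume {y | ¬ P y} with hN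
  have hN0 : volume N = 0 := by rw [hN, measure_toMeasurable]; exact h
  have h1 := lintegral_comp_sub_smul_eq x hs (f := N.indicator 1)
    (measurable_one.indicator (measurableSet_toMeasurable _ _))
  rw [lintegral_indicator_one (measurableSet_toMeasurable _ _), hN0, mul_zero,
    lintegral_eq_zero_iff] at h1
  · filter_upwards [h1] with v hv
    by_contra hcon
    have : x - s • v ∈ N := subset_toMeasurable _ _ hcon
    simp [this] at hv
  · exact (measurable_one.indicator (measurableSet_toMeasurable _ _)).comp
      (show Measurable fun v : V => x - s • v by fun_prop)

/-- A function in `Lᵖ` is dominated by a series of continuous functions with compact support. -/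
theorem exists_tsum_continuous_ge {p : ℝ} (hp : 1 ≤ p) {G : V → ℝ≥0∞} (hG : AEMeasurable G)
    (hfin : powNorm p G ≠ ∞) :
    ∃ h : ℕ → V → ℝ, (∀ n, Continuous (h n)) ∧ (∀ n, HasCompactSupport (h n)) ∧
      (∀ n x, 0 ≤ h n x) ∧ (∀ᵐ x, G x ≤ ∑' n, ‖h n x‖ₑ) ∧
      ∑' n, powNorm p (fun x => ‖h n x‖ₑ) ≤ 2 * powNorm p G := by
  have hp0 : 0 < p := by linarith
  have hint : ∫⁻ x, G x ^ p ≠ ∞ := by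
    rw [← powNorm_rpow hp0]
    exact ENNReal.rpow_ne_top_of_nonneg hp0.le hfin
  rcases eq_or_ne (powNorm p G) 0 with h0 | h0
  · refine ⟨fun _ _ => 0, fun _ => continuous_const, fun _ => HasCompactSupport.zero,
      fun _ _ => le_rfl, ?_, by simp [powNorm, hp0]⟩
    have h1 : ∫⁻ x, G x ^ p = 0 := by
      rw [← powNorm_rpow hp0, h0, ENNReal.zero_rpow_of_pos hp0]
    rw [lintegral_eq_zero_iff' (hG.pow_const p)] at h1
    filter_upwards [h1] with x hx
    rw [Pi.zero_apply, ENNReal.rpow_eq_zero_iff_of_pos hp0] at hx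
    simp [hx]
  set f : V → ℝ := fun x => (G x).toReal with hf
  have hfm : AEMeasurable f := hG.ennreal_toReal
  have hGf : ∀ᵐ x, G x = ‖f x‖ₑ := by
    filter_upwards [ae_lt_top' (hG.pow_const p) hint] with x hx
    have : G x ≠ ∞ := by
      rintro h
      rw [h, ENNReal.top_rpow_of_pos hp0] at hx
      exact hx.ne rfl
    rw [hf, Real.enorm_of_nonneg ENNReal.toReal_nonneg, ENNReal.ofReal_toReal this]
  have hNf : powNorm p (fun x => ‖f x‖ₑ) = powNorm p G := by
    unfold powNorm
    congr 1
    exact lintegral_congr_ae (hGf.mono fun x hx => by simp only [hx])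
  have hfL : MemLp f (ENNReal.ofReal p) := by
    refine ⟨hfm.aestronglyMeasurable, ?_⟩
    rw [eLpNorm_eq_powNorm hp0, hNf]
    exact hfin.lt_top
  -- The first term costs `‖G‖ + ε` and the telescoping differences `4ε`, in total less than `2‖G‖`.
  set ε : ℝ≥0∞ := powNorm p G / 8 with hε
  have hε0 : ∀ n : ℕ, ε * (2 : ℝ≥0∞)⁻¹ ^ n ≠ 0 := fun n =>
    mul_ne_zero (ENNReal.div_ne_zero.2 ⟨h0, by simp⟩) (pow_ne_zero _ (by simp))
  choose g hgc hgε hgcont hgL using fun n : ℕ =>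
    hfL.exists_hasCompactSupport_eLpNorm_sub_le (by simp) (hε0 n)
  have hgε' : ∀ n, powNorm p (fun x => ‖f x - g n x‖ₑ) ≤ ε * (2 : ℝ≥0∞)⁻¹ ^ n := by
    intro n
    have := hgε n
    rwa [eLpNorm_eq_powNorm hp0] at this
  have hgm : ∀ n, Measurable (g n) := fun n => (hgcont n).measurable
  -- Absolute values of telescoping differences: their sum dominates every approximant, hence the
  -- limit `f` almost everywhere.
  let h : ℕ → V → ℝ := fun n x => match n with
    | 0 => |g 0 x|
    | n + 1 => |g (n + 1) x - g n x|
  have hsum : ∀ n x, ‖g n x‖ₑ ≤ ∑ k ∈ Finset.range (n + 1), ‖h k x‖ₑ := by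
    intro n x
    induction n with
    | zero => simp [h]
    | succ n ih =>
      rw [Finset.sum_range_succ]
      calc ‖g (n + 1) x‖ₑ = ‖g n x + (g (n + 1) x - g n x)‖ₑ := by congr 1; ring
        _ ≤ ‖g n x‖ₑ + ‖g (n + 1) x - g n x‖ₑ := enorm_add_le _ _
        _ ≤ _ := by
          gcongr
          simp [h]
  have hhc : ∀ n, Continuous (h n) := by
    rintro (_ | n)
    · exact (hgcont 0).abs
    · exact ((hgcont (n + 1)).sub (hgcont n)).abs
  refine ⟨h, hhc, ?_, ?_, ?_, ?_⟩
  · rintro (_ | n)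
    · exact (hgc 0).comp_left (g := abs) (by simp)
    · exact ((hgc (n + 1)).sub (hgc n)).comp_left (g := abs) (by simp)
  · rintro (_ | n) x <;> exact abs_nonneg _
  · have hHm : Measurable fun x => ∑' n, ‖h n x‖ₑ :=
      Measurable.tsum fun n => (hhc n).measurable.enorm
    have hle : ∀ n, powNorm p (fun x => ‖f x‖ₑ - ∑' n, ‖h n x‖ₑ) ≤ ε * (2 : ℝ≥0∞)⁻¹ ^ n := by
      intro n
      refine (powNorm_mono hp0 fun x => ?_).trans (hgε' n)
      rw [tsub_le_iff_right]
      calc ‖f x‖ₑ = ‖(f x - g n x) + g n x‖ₑ := by congr 1; ring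
        _ ≤ ‖f x - g n x‖ₑ + ‖g n x‖ₑ := enorm_add_le _ _
        _ ≤ _ := by
          gcongr
          exact (hsum n x).trans (ENNReal.sum_le_tsum _)
    have hεt : ε ≠ ∞ := ENNReal.div_ne_top hfin (by simp)
    have hlim : Tendsto (fun n : ℕ => ε * (2 : ℝ≥0∞)⁻¹ ^ n) atTop (𝓝 0) := by
      have := ENNReal.Tendsto.const_mul (a := ε)
        (ENNReal.tendsto_pow_atTop_nhds_zero_of_lt_one (r := (2 : ℝ≥0∞)⁻¹) (by simp))
        (Or.inr hεt)
      simpa using this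
    have hz : powNorm p (fun x => ‖f x‖ₑ - ∑' n, ‖h n x‖ₑ) = 0 :=
      le_antisymm (ge_of_tendsto' hlim hle) zero_le
    have hz' : ∫⁻ x, (‖f x‖ₑ - ∑' n, ‖h n x‖ₑ) ^ p = 0 := by
      rw [← powNorm_rpow hp0 (fun x => ‖f x‖ₑ - ∑' n, ‖h n x‖ₑ), hz, ENNReal.zero_rpow_of_pos hp0]
    have hm : AEMeasurable fun x => (‖f x‖ₑ - ∑' n, ‖h n x‖ₑ) ^ p :=
      (hfm.enorm.sub hHm.aemeasurable).pow_const p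
    rw [lintegral_eq_zero_iff' hm] at hz'
    filter_upwards [hz', hGf] with x hx hx2
    rw [Pi.zero_apply, ENNReal.rpow_eq_zero_iff_of_pos hp0, tsub_eq_zero_iff_le] at hx
    rwa [hx2]
  · have hfe : AEMeasurable (fun x => ‖f x‖ₑ) := hfm.enorm
    have hdiff : ∀ n, AEMeasurable (fun x => ‖f x - g n x‖ₑ) :=
      fun n => (hfm.sub (hgm n).aemeasurable).enorm
    have e0 : powNorm p (fun x => ‖h 0 x‖ₑ) ≤ powNorm p G + ε := by
      rw [← hNf]
      refine le_trans ?_ ((powNorm_add_le hp hfe (hdiff 0)).trans (add_le_add_right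
        ((hgε' 0).trans_eq (by simp)) _))
      refine powNorm_mono hp0 fun x => ?_
      simp only [h]
      calc ‖|g 0 x|‖ₑ = ‖f x - (f x - g 0 x)‖ₑ := by simp
        _ ≤ _ := enorm_sub_le
    have e1 : ∀ n, powNorm p (fun x => ‖h (n + 1) x‖ₑ) ≤ (2 * ε) * (2 : ℝ≥0∞)⁻¹ ^ n := by
      intro n
      have : (2 * ε) * (2 : ℝ≥0∞)⁻¹ ^ n = ε * (2 : ℝ≥0∞)⁻¹ ^ n + ε * (2 : ℝ≥0∞)⁻¹ ^ n := by ring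
      rw [this]
      refine le_trans ?_ ((powNorm_add_le hp (hdiff n) (hdiff (n + 1))).trans
        (add_le_add (hgε' n) ((hgε' (n + 1)).trans ?_)))
      · refine powNorm_mono hp0 fun x => ?_
        simp only [h]
        calc ‖|g (n + 1) x - g n x|‖ₑ = ‖(f x - g n x) - (f x - g (n + 1) x)‖ₑ := by
              simp
          _ ≤ _ := enorm_sub_le
      · gcongr ε * ?_
        exact pow_le_pow_of_le_one zero_le (by simp) (Nat.le_succ n)
    rw [tsum_eq_zero_add' ENNReal.summable]
    calc _ ≤ (powNorm p G + ε) + ∑' n : ℕ, (2 * ε) * (2 : ℝ≥0∞)⁻¹ ^ n :=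
          add_le_add e0 (ENNReal.tsum_le_tsum e1)
      _ = powNorm p G + 5 * ε := by
          rw [ENNReal.tsum_mul_left, ENNReal.tsum_geometric, ENNReal.one_sub_inv_two, inv_inv]
          ring
      _ ≤ powNorm p G + 8 * ε := by gcongr; norm_num
      _ = 2 * powNorm p G := by
          rw [hε, ENNReal.mul_div_cancel (by simp) (by simp), two_mul]

variable (ν : Measure V)

/-- The maximal function `sup_{s ∈ S} ∫ G(x - s v) dν(v)`. -/
def dilMax (S : Set ℝ) (G : V → ℝ≥0∞) (x : V) : ℝ≥0∞ := ⨆ s ∈ S, ∫⁻ v, G (x - s • v) ∂ν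

variable {ν}

theorem continuous_lintegral_translates [IsFiniteMeasure ν] {h : V → ℝ} (hc : Continuous h)
    (hs : HasCompactSupport h) : Continuous fun q : ℝ × V => ∫⁻ v, ‖h (q.2 - q.1 • v)‖ₑ ∂ν := by
  obtain ⟨M, hM⟩ := hc.bounded_above_of_compact_support hs
  have e : ∀ q : ℝ × V, ∫⁻ v, ‖h (q.2 - q.1 • v)‖ₑ ∂ν =
      ENNReal.ofReal (∫ v, ‖h (q.2 - q.1 • v)‖ ∂ν) := by
    intro q
    rw [ofReal_integral_norm_eq_lintegral_enorm]
    exact Integrable.of_bound (hc.comp (by fun_prop)).aestronglyMeasurable M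
      (Eventually.of_forall fun v => hM _)
  simp_rw [e]
  refine ENNReal.continuous_ofReal.comp (continuous_of_dominated (bound := fun _ => M)
    (fun q => ?_) (fun q => Eventually.of_forall fun v => ?_) (integrable_const _)
    (Eventually.of_forall fun v => ?_))
  · exact (hc.comp (by fun_prop)).norm.aestronglyMeasurable
  · simpa using hM _
  · exact (hc.comp (by fun_prop)).norm

/-- Each average is continuous in `x`, so the supremum is lower semicontinuous whatever the
cardinality of `S`. -/
theorem measurable_dilMax [IsFiniteMeasure ν] (S : Set ℝ) {h : V → ℝ} (hc : Continuous h)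
    (hs : HasCompactSupport h) : Measurable (dilMax ν S fun x => ‖h x‖ₑ) :=
  (lowerSemicontinuous_biSup fun s _ => ((continuous_lintegral_translates hc hs).comp
    (Continuous.prodMk_right s)).lowerSemicontinuous).measurable

/-- An `Lᵖ` bound for the maximal function on continuous functions with compact support. -/
def DilBound (ν : Measure V) (S : Set ℝ) (p : ℝ) (c : ℝ≥0∞) : Prop :=
  ∀ h : V → ℝ, Continuous h → HasCompactSupport h → (∀ x, 0 ≤ h x) →
    powNorm p (dilMax ν S fun x => ‖h x‖ₑ) ≤ c * powNorm p fun x => ‖h x‖ₑ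

/-- An a priori bound extends to all of `Lᵖ`, with a measurable majorant. -/
theorem DilBound.exists_majorant [IsFiniteMeasure ν] (hν : ν ≪ volume) {S : Set ℝ}
    (hS : ∀ s ∈ S, 0 < s) {p : ℝ} (hp : 1 ≤ p) {c : ℝ≥0∞} (hb : DilBound ν S p c)
    {G : V → ℝ≥0∞} (hG : AEMeasurable G) (hfin : powNorm p G ≠ ∞) :
    ∃ H : V → ℝ≥0∞, Measurable H ∧ (∀ x, dilMax ν S G x ≤ H x) ∧
      powNorm p H ≤ c * (2 * powNorm p G) := by
  obtain ⟨h, hc, hcs, h0, hle, hsum⟩ := exists_tsum_continuous_ge hp hG hfin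
  have hm : ∀ n, Measurable (dilMax ν S fun x => ‖h n x‖ₑ) := fun n =>
    measurable_dilMax S (hc n) (hcs n)
  refine ⟨fun x => ∑' n, dilMax ν S (fun x => ‖h n x‖ₑ) x, Measurable.tsum hm, ?_, ?_⟩
  · intro x
    refine iSup₂_le fun s hs => ?_
    calc _ ≤ ∫⁻ v, ∑' n, ‖h n (x - s • v)‖ₑ ∂ν :=
          -- Domination almost everywhere suffices at every `x` by absolute continuity.
          lintegral_mono_ae (ae_comp_sub_smul hν (hS s hs) hle x)
      _ = ∑' n, ∫⁻ v, ‖h n (x - s • v)‖ₑ ∂ν :=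
          lintegral_tsum fun n => ((hc n).comp (by fun_prop)).measurable.enorm.aemeasurable
      _ ≤ _ := ENNReal.tsum_le_tsum fun n => le_iSup₂_of_le s hs le_rfl
  · calc _ ≤ ∑' n, powNorm p (dilMax ν S fun x => ‖h n x‖ₑ) :=
          lintegral_rpow_tsum_le hp fun n => (hm n).aemeasurable
      _ ≤ ∑' n, c * powNorm p fun x => ‖h n x‖ₑ :=
          ENNReal.tsum_le_tsum fun n => hb (h n) (hc n) (hcs n) (h0 n)
      _ ≤ _ := by
          rw [ENNReal.tsum_mul_left]
          gcongr

end Density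

end

/-! ### The bootstrap for the linear maximal operator. -/

noncomputable section

section Bootstrapping

open Module Metric

variable {V : Type*} [NormedAddCommGroup V] [InnerProductSpace ℝ V] [FiniteDimensional ℝ V]
  [MeasurableSpace V] [BorelSpace V] {ν : Measure V} [IsFiniteMeasure ν]

theorem lintegral_rpow_lintegral_translates_le {p : ℝ} (hp : 1 ≤ p) {G : V → ℝ≥0∞}
    (hG : Measurable G) (s : ℝ) :
    ∫⁻ x, (∫⁻ v, G (x - s • v) ∂ν) ^ p ≤ ν univ ^ p * ∫⁻ x, G x ^ p := by
  have hm : Measurable fun q : V × V => G (q.1 - s • q.2) ^ p :=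
    (hG.comp (by fun_prop)).pow_const p
  calc _ ≤ ∫⁻ x, ν univ ^ (p - 1) * ∫⁻ v, G (x - s • v) ^ p ∂ν :=
        lintegral_mono fun x => lintegral_rpow_le_measure_univ_rpow_mul hp
          (hG.comp (show Measurable fun v : V => x - s • v by fun_prop)).aemeasurable
    _ = ν univ ^ (p - 1) * ∫⁻ v, (∫⁻ x, G (x - s • v) ^ p) ∂ν := by
        rw [lintegral_const_mul' _ _ (ENNReal.rpow_ne_top_of_nonneg (by linarith)
          (measure_ne_top ν univ)), lintegral_lintegral_swap
          (f := fun x v => G (x - s • v) ^ p) hm.aemeasurable]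
    _ = ν univ ^ (p - 1) * (ν univ ^ (1 : ℝ) * ∫⁻ x, G x ^ p) := by
        simp_rw [lintegral_sub_right_eq_self (fun x => G x ^ p)]
        rw [lintegral_const, mul_comm (∫⁻ x, G x ^ p), ENNReal.rpow_one]
    _ = _ := by
        rw [← mul_assoc, ← ENNReal.rpow_add_of_nonneg _ _ (by linarith) zero_le_one, sub_add_cancel]

/-- The finite starting constant of the bootstrap. Its dependence on the number of dilations
disappears under iteration. -/
theorem exists_dilBound_finset (S : Finset ℝ) {p : ℝ} (hp : 1 ≤ p) :
    ∃ c : ℝ≥0∞, c ≠ ∞ ∧ DilBound ν S p c := by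
  have hp0 : 0 < p := by linarith
  refine ⟨(S.card * ν univ ^ p) ^ (1 / p), ENNReal.rpow_ne_top_of_nonneg (by positivity)
    (ENNReal.mul_ne_top (by simp) (ENNReal.rpow_ne_top_of_nonneg hp0.le (measure_ne_top ν univ))),
    fun h hc hcs h0 => powNorm_le_of_lintegral_le hp0 ?_⟩
  have hm : Measurable fun x => ‖h x‖ₑ := hc.measurable.enorm
  have hms : ∀ s : ℝ, Measurable fun x => (∫⁻ v, ‖h (x - s • v)‖ₑ ∂ν) ^ p := fun s =>
    ((continuous_lintegral_translates hc hcs).comp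
      (Continuous.prodMk_right s)).measurable.pow_const p
  have hpt : ∀ x, dilMax ν S (fun x => ‖h x‖ₑ) x ^ p ≤
      ∑ s ∈ S, (∫⁻ v, ‖h (x - s • v)‖ₑ ∂ν) ^ p := by
    intro x
    rw [← ENNReal.le_rpow_inv_iff hp0]
    refine iSup₂_le fun s hs => ?_
    rw [ENNReal.le_rpow_inv_iff hp0]
    exact Finset.single_le_sum (f := fun s => (∫⁻ v, ‖h (x - s • v)‖ₑ ∂ν) ^ p)
      (fun _ _ => zero_le) hs
  calc _ ≤ ∫⁻ x, ∑ s ∈ S, (∫⁻ v, ‖h (x - s • v)‖ₑ ∂ν) ^ p := lintegral_mono hpt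
    _ = ∑ s ∈ S, ∫⁻ x, (∫⁻ v, ‖h (x - s • v)‖ₑ ∂ν) ^ p :=
        lintegral_finsetSum _ fun s _ => hms s
    _ ≤ ∑ s ∈ S, ν univ ^ p * ∫⁻ x, ‖h x‖ₑ ^ p :=
        Finset.sum_le_sum fun s _ => lintegral_rpow_lintegral_translates_le hp hm s
    _ = _ := by rw [Finset.sum_const, nsmul_eq_mul, mul_assoc]

/-- The dilations `2ˡ t`, `l ∈ ℤ`, `t ∈ E`. -/
def dyadicDilates (E : Set ℝ) : Set ℝ := {s | ∃ l : ℤ, ∃ t ∈ E, s = (2 : ℝ) ^ l * t}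

theorem dyadicDilates_pos {E : Set ℝ} (hE : E ⊆ Icc 1 2) {s : ℝ} (hs : s ∈ dyadicDilates E) :
    0 < s := by
  obtain ⟨l, t, ht, rfl⟩ := hs
  have := (hE ht).1
  positivity

theorem smoothed_add_eq_sum (J n : ℕ) (v : V) :
    smoothed ν (J + n) v = smoothed ν J v + ∑ i ∈ Finset.range n, piece ν (J + i) v := by
  induction n with
  | zero => simp
  | succ n ih =>
    rw [Finset.sum_range_succ, ← add_assoc (smoothed ν J v), ← ih, piece]
    ring_nf

/-- The mollification at level `J` is a Hardy–Littlewood average, and each later piece is compared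
with its net. The mesh error is an average of `hlMax` at the original dilation, so its supremum runs
over the same set `S`; this makes the estimate self-referential even for finite `S`. -/
theorem lintegral_translates_le_tsum {R : ℝ} (hR0 : 0 ≤ R) (hR : ν (closedBall 0 R)ᶜ = 0)
    {E : Set ℝ} (hE : E ⊆ Icc 1 2) {κ : ℝ} (hκ : 0 < κ) {D : ℕ → Finset ℝ} (hDE : ∀ j, ↑(D j) ⊆ E)
    (hD : ∀ j, ∀ t ∈ E, ∃ t' ∈ D j, |t - t'| ≤ 2 ^ (-(1 + κ) * j)) (J : ℕ) {S : Set ℝ}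
    (hS : S ⊆ dyadicDilates E) {h : V → ℝ} (hc : Continuous h) (hcs : HasCompactSupport h)
    (h0 : ∀ x, 0 ≤ h x) (x : V) :
    dilMax ν S (fun x => ‖h x‖ₑ) x ≤
      ENNReal.ofReal (tentFactor V * ((2 : ℝ) ^ J) ^ finrank ℝ V * ν.real univ *
        (4 * (R + 1)) ^ finrank ℝ V) * hlMax (fun u => ‖h u‖ₑ) x +
      ∑' i : ℕ, (ENNReal.ofReal (2 ^ finrank ℝ V) * netMax (piece ν (J + i)) (D (J + i)) h x +
        ENNReal.ofReal (tentFactor V * 2 ^ (finrank ℝ V + 2) * (2 * (R + 1)) *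
          (4 * (2 * R + 3)) ^ finrank ℝ V) * ENNReal.ofReal (2 ^ (-κ)) ^ (J + i) *
          dilMax ν S (hlMax fun u => ‖h u‖ₑ) x) := by
  refine iSup₂_le fun s hs => ?_
  obtain ⟨l, t, ht, hst⟩ := hS hs
  have hs0 : 0 < s := dyadicDilates_pos hE (hS hs)
  obtain ⟨M, hM⟩ := hc.bounded_above_of_compact_support hcs
  have hM' : ∀ x, |h x| ≤ M := hM
  have hgc : Continuous fun v => h (x - s • v) := hc.comp (by fun_prop)
  have hgcs : HasCompactSupport fun v => h (x - s • v) := by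
    have hcl : IsClosedEmbedding fun v : V => x - s • v :=
      ((Homeomorph.subLeft x).isClosedEmbedding).comp
        (Homeomorph.smulOfNeZero s hs0.ne').isClosedEmbedding
    exact hcs.comp_isClosedEmbedding hcl
  have hlim := (tendsto_integral_mul_smoothed (ν := ν) hgc hgcs).comp
    (tendsto_add_atTop_nat J)
  -- Nonnegativity of `h` turns the integral of the norm into the norm of the integral, to which
  -- weak convergence applies.
  have hlim' : Tendsto (fun n => ‖∫ v, h (x - s • v) * smoothed ν (J + n) v‖ₑ) atTop
      (𝓝 (∫⁻ v, ‖h (x - s • v)‖ₑ ∂ν)) := by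
    have e : ∫⁻ v, ‖h (x - s • v)‖ₑ ∂ν = ‖∫ v, h (x - s • v) ∂ν‖ₑ := by
      rw [Real.enorm_of_nonneg (integral_nonneg fun v => h0 _),
        ofReal_integral_eq_lintegral_ofReal (Integrable.of_bound hgc.aestronglyMeasurable M
          (Eventually.of_forall fun v => hM _)) (Eventually.of_forall fun v => h0 _)]
      exact lintegral_congr fun v => Real.enorm_of_nonneg (h0 _)
    rw [e]
    refine (hlim.enorm).congr fun n => ?_
    simp [add_comm]
  refine le_of_tendsto' hlim' fun n => ?_
  have hsi : Integrable fun v => h (x - s • v) * smoothed ν J v :=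
    integrable_translates_mul hc.measurable hM' (integrable_smoothed hR J) s x
  have hpi : ∀ i, Integrable fun v => h (x - s • v) * piece ν (J + i) v := fun i =>
    integrable_translates_mul hc.measurable hM' (integrable_piece hR (J + i)) s x
  have e : ∫ v, h (x - s • v) * smoothed ν (J + n) v = (∫ v, h (x - s • v) * smoothed ν J v) +
      ∑ i ∈ Finset.range n, ∫ v, h (x - s • v) * piece ν (J + i) v := by
    simp_rw [smoothed_add_eq_sum, mul_add, Finset.mul_sum]
    rw [integral_add hsi (integrable_finsetSum _ fun i _ => hpi i),
      integral_finsetSum _ fun i _ => hpi i]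
  rw [e]
  refine (enorm_add_le _ _).trans (add_le_add
    (enorm_integral_smoothed_le hR0 hR hc.measurable hs0 J x) ?_)
  refine (enorm_sum_le _ _).trans (le_trans (Finset.sum_le_sum fun i _ => ?_)
    (ENNReal.sum_le_tsum (Finset.range n)))
  obtain ⟨t', ht', htt'⟩ := hD (J + i) t ht
  have hpiece := enorm_integral_piece_dilation_le hR0 hR hc.measurable hM'
    (s := (2 : ℝ) ^ l) (by positivity) (hE ht) (hE (hDE _ ht')) (J + i) htt' (by
      rw [← Real.rpow_natCast, ← Real.rpow_neg (by norm_num)]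
      refine Real.rpow_le_rpow_of_exponent_le one_le_two ?_
      nlinarith [Nat.cast_nonneg (α := ℝ) (J + i)]) x
  rw [← hst] at hpiece
  refine hpiece.trans (add_le_add ?_ ?_)
  · gcongr
    exact le_iSup_of_le l (le_iSup₂_of_le t' ht' le_rfl)
  · refine mul_le_mul' (le_of_eq ?_) (le_iSup₂_of_le s hs le_rfl)
    have hA := (tentFactor_pos (V := V)).le
    rw [← ENNReal.ofReal_pow (by positivity), ← ENNReal.ofReal_mul (by positivity), pieceLip]
    congr 1
    -- The Lipschitz constant `2^((j+1)(d+1))`, the mesh `2^(-(1+κ)j)` and the ball volume `2^(-dj)`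
    -- multiply to a constant times `2^(-κj)`.
    have e2 : (2 : ℝ) ^ (-(1 + κ) * ((J + i : ℕ) : ℝ)) =
        ((2 : ℝ) ^ (J + i))⁻¹ * ((2 : ℝ) ^ (-κ)) ^ (J + i) := by
      rw [← Real.rpow_natCast, ← Real.rpow_natCast, ← Real.rpow_neg (by norm_num),
        ← Real.rpow_mul (by norm_num), ← Real.rpow_add two_pos]
      congr 1
      ring
    rw [e2, show 4 * ((2 * R + 3) * ((2 : ℝ) ^ (J + i))⁻¹) =
      4 * (2 * R + 3) * ((2 : ℝ) ^ (J + i))⁻¹ by ring, mul_pow (4 * (2 * R + 3)), pow_succ (2 : ℝ) (J + i),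
      mul_pow _ (2 : ℝ) (finrank ℝ V + 1), inv_pow, pow_succ ((2 : ℝ) ^ (J + i)), pow_succ (2 : ℝ) (finrank ℝ V + 1)]
    field_simp

/-- The net terms sum to a bound independent of `S` and `c`; the mesh errors contain the unknown
operator with geometric coefficients whose tail from `J` on is small. It matters that `A` depends on
neither `S` nor `c`. -/
theorem exists_dilBound_improve [Nontrivial V] {R C b : ℝ} (hR0 : 0 ≤ R)
    (hR : ν (closedBall 0 R)ᶜ = 0) (hb0 : 0 < b) (hb1 : b ≤ 1)
    (hν : ∀ ξ, ‖fourierMeasure ν ξ‖ ≤ C * (1 + ‖ξ‖) ^ (-((finrank ℝ V + b) / 2)))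
    {E : Set ℝ} (hE : E ⊆ Icc 1 2) (hEb : HasNets E b) {p : ℝ} (hp : 1 < p) (hp2 : p < 2) :
    ∃ A : ℝ≥0∞, A ≠ ∞ ∧ ∀ (S : Set ℝ) (c : ℝ≥0∞), S ⊆ dyadicDilates E → DilBound ν S p c →
      DilBound ν S p (A + c * 2⁻¹) := by
  have hp0 : 0 < p := by linarith
  have hac : ν ≪ volume := absolutelyContinuous_of_fourierMeasure_le hR hν (by linarith)
  obtain ⟨κ, K, D, hκ, hDE, hD, hnet⟩ :=
    exists_lintegral_netMax_piece_le hR hb0 hb1 hν hE hEb hp hp2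
  obtain ⟨C₁, hC₁⟩ := exists_lintegral_shiftedMax_rpow_le (V := V) hp hp2
  obtain ⟨A₁, hA₁⟩ : ∃ A₁ : ℝ≥0∞, A₁ = (C₁ * (0 + 3 : ℕ) : ℝ≥0∞) ^ (1 / p) := ⟨_, rfl⟩
  have hA₁t : A₁ ≠ ∞ := by
    rw [hA₁]
    exact ENNReal.rpow_ne_top_of_nonneg (by positivity) (ENNReal.mul_ne_top (by simp) (by simp))
  have hhl : ∀ G : V → ℝ≥0∞, Measurable G → powNorm p (hlMax G) ≤ A₁ * powNorm p G := fun G hG => by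
    rw [hA₁]
    exact powNorm_le_of_lintegral_le hp0 (hC₁ 0 1 0 G one_pos (by simp) hG)
  obtain ⟨A₂, hA₂⟩ : ∃ A₂ : ℝ≥0∞, A₂ = ENNReal.ofReal (tentFactor V * 2 ^ (finrank ℝ V + 2) *
    (2 * (R + 1)) * (4 * (2 * R + 3)) ^ finrank ℝ V) := ⟨_, rfl⟩
  have hA₂t : A₂ ≠ ∞ := by rw [hA₂]; simp
  obtain ⟨r, hr⟩ : ∃ r : ℝ≥0∞, r = ENNReal.ofReal (2 ^ (-κ)) := ⟨_, rfl⟩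
  have hr1 : r < 1 := by
    rw [hr, ENNReal.ofReal_lt_one]
    exact Real.rpow_lt_one_of_one_lt_of_neg one_lt_two (by linarith)
  obtain ⟨w, hw⟩ : ∃ w : ℝ≥0∞, w = ENNReal.ofReal (2 ^ (-(3 * κ))) ^ (1 / p) := ⟨_, rfl⟩
  have hw1 : w < 1 := by
    rw [hw]
    refine ENNReal.rpow_lt_one ?_ (by positivity)
    rw [ENNReal.ofReal_lt_one]
    exact Real.rpow_lt_one_of_one_lt_of_neg one_lt_two (by linarith)
  have hnet' : ∀ (j : ℕ) (h : V → ℝ), Continuous h → HasCompactSupport h →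
      powNorm p (netMax (piece ν j) (D j) h) ≤
        (K : ℝ≥0∞) ^ (1 / p) * w ^ j * powNorm p fun x => ‖h x‖ₑ := by
    intro j h hc hcs
    obtain ⟨M, hM⟩ := hc.bounded_above_of_compact_support hcs
    obtain ⟨RF, hRF⟩ := hcs.isCompact.isBounded.subset_closedBall (0 : V)
    have hh0 : ∀ x, RF < ‖x‖ → h x = 0 := fun x hx => by
      by_contra hcon
      have := hRF (subset_tsupport h hcon)
      rw [mem_closedBall, dist_zero_right] at this
      linarith
    refine (powNorm_le_of_lintegral_le hp0 (hnet j h M RF hc.measurable hM hh0)).trans_eq ?_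
    congr 1
    rw [ENNReal.mul_rpow_of_nonneg _ _ (by positivity), hw, ← ENNReal.rpow_natCast,
      ← ENNReal.rpow_mul, mul_comm (1 / p), ENNReal.rpow_mul, ENNReal.rpow_natCast,
      ← ENNReal.ofReal_pow (by positivity), ← Real.rpow_mul_natCast (by norm_num)]
  -- The tail of the mesh errors, including the Hardy–Littlewood norm `A₁` and the factor `2` from
  -- the extension to general functions, is at most `1/2`.
  obtain ⟨J, hJ⟩ : ∃ J : ℕ, A₂ * r ^ J * (1 - r)⁻¹ * (2 * A₁) ≤ 2⁻¹ := by
    have ht : Tendsto (fun J : ℕ => A₂ * r ^ J * (1 - r)⁻¹ * (2 * A₁)) atTop (𝓝 0) := by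
      have h1 := ENNReal.tendsto_pow_atTop_nhds_zero_of_lt_one hr1
      have hc1 : A₂ ≠ ∞ := hA₂t
      have hc2 : (1 - r)⁻¹ ≠ ∞ := ENNReal.inv_ne_top.2 (tsub_pos_of_lt hr1).ne'
      have hc3 : 2 * A₁ ≠ ∞ := ENNReal.mul_ne_top (by simp) hA₁t
      have := ENNReal.Tendsto.mul_const (ENNReal.Tendsto.mul_const
        (ENNReal.Tendsto.const_mul h1 (Or.inr hc1)) (Or.inr hc2)) (Or.inr hc3)
      simpa using this
    exact ((ht.eventually (ge_mem_nhds (show (0 : ℝ≥0∞) < 2⁻¹ by simp))).exists)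
  obtain ⟨A₃, hA₃⟩ : ∃ A₃ : ℝ≥0∞, A₃ = ENNReal.ofReal (tentFactor V * ((2 : ℝ) ^ J) ^ finrank ℝ V *
    ν.real univ * (4 * (R + 1)) ^ finrank ℝ V) := ⟨_, rfl⟩
  obtain ⟨T, hT⟩ : ∃ T : ℝ≥0∞, T = ENNReal.ofReal (2 ^ finrank ℝ V) := ⟨_, rfl⟩
  have hTt : T ≠ ∞ := by rw [hT]; simp
  refine ⟨A₃ * A₁ + T * (K : ℝ≥0∞) ^ (1 / p) * (1 - w)⁻¹, ?_, fun S c hS hb h hc hcs h0 => ?_⟩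
  · refine ENNReal.add_ne_top.2 ⟨ENNReal.mul_ne_top (by rw [hA₃]; simp) hA₁t,
      ENNReal.mul_ne_top (ENNReal.mul_ne_top hTt (ENNReal.rpow_ne_top_of_nonneg (by positivity)
        (by simp))) (ENNReal.inv_ne_top.2 (tsub_pos_of_lt hw1).ne')⟩
  set N := powNorm p fun x => ‖h x‖ₑ with hN
  have hNt : N ≠ ∞ := by
    have := (hc.memLp_of_hasCompactSupport hcs (p := ENNReal.ofReal p) (μ := volume)).2
    rw [eLpNorm_eq_powNorm hp0] at this
    exact this.ne
  have hhm : Measurable fun x => ‖h x‖ₑ := hc.measurable.enorm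
  have hhlm : Measurable (hlMax fun x => ‖h x‖ₑ) := measurable_shiftedMax _ _ hhm
  have hhlN := hhl _ hhm
  -- The a priori bound is assumed only for continuous compactly supported functions, and `hlMax`
  -- need not be one; the extension supplies a measurable majorant.
  obtain ⟨H, hHm, hH, hHN⟩ := hb.exists_majorant hac (fun s hs => dyadicDilates_pos hE (hS hs)) hp.le
    hhlm.aemeasurable (ne_top_of_le_ne_top (ENNReal.mul_ne_top hA₁t hNt) hhlN)
  have hnm : ∀ j, Measurable (netMax (piece ν j) (D j) h) := fun j =>
    measurable_netMax hc.measurable (continuous_piece ν j).measurable _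
  have hterm : ∀ i : ℕ, Measurable fun x => T * netMax (piece ν (J + i)) (D (J + i)) h x +
      A₂ * r ^ (J + i) * H x := fun i => ((hnm _).const_mul _).add (hHm.const_mul _)
  have hrt : ∀ i, A₂ * r ^ (J + i) ≠ ∞ := fun i =>
    ENNReal.mul_ne_top hA₂t (ENNReal.pow_ne_top hr1.ne_top)
  calc powNorm p (dilMax ν S fun x => ‖h x‖ₑ)
      ≤ powNorm p (fun x => A₃ * hlMax (fun u => ‖h u‖ₑ) x + ∑' i : ℕ,
          (T * netMax (piece ν (J + i)) (D (J + i)) h x + A₂ * r ^ (J + i) * H x)) := by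
        refine powNorm_mono hp0 fun x =>
          (lintegral_translates_le_tsum hR0 hR hE hκ hDE hD J hS hc hcs h0 x).trans ?_
        rw [hA₃, hT, hA₂, hr]
        gcongr with i
        exact hH x
    _ ≤ powNorm p (fun x => A₃ * hlMax (fun u => ‖h u‖ₑ) x) + ∑' i : ℕ, powNorm p (fun x =>
          T * netMax (piece ν (J + i)) (D (J + i)) h x + A₂ * r ^ (J + i) * H x) := by
        refine (powNorm_add_le hp.le (hhlm.const_mul _).aemeasurable
          (Measurable.tsum hterm).aemeasurable).trans ?_
        gcongr
        exact lintegral_rpow_tsum_le hp.le fun i => (hterm i).aemeasurable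
    _ ≤ A₃ * (A₁ * N) + ∑' i : ℕ, (T * ((K : ℝ≥0∞) ^ (1 / p) * w ^ i * N) +
          A₂ * r ^ (J + i) * (c * (2 * (A₁ * N)))) := by
        refine add_le_add ?_ (ENNReal.tsum_le_tsum fun i => ?_)
        · rw [powNorm_const_mul hp0 (by rw [hA₃]; simp)]
          gcongr
        · refine (powNorm_add_le hp.le ((hnm _).const_mul _).aemeasurable
            (hHm.const_mul _).aemeasurable).trans ?_
          rw [powNorm_const_mul hp0 hTt, powNorm_const_mul hp0 (hrt i)]
          gcongr
          · exact (hnet' _ h hc hcs).trans (mul_le_mul' (mul_le_mul' le_rfl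
              (pow_le_pow_of_le_one zero_le hw1.le (Nat.le_add_left i J))) le_rfl)
          · refine hHN.trans ?_
            gcongr
    _ = (A₃ * A₁ + T * (K : ℝ≥0∞) ^ (1 / p) * (1 - w)⁻¹) * N +
          c * N * (A₂ * r ^ J * (1 - r)⁻¹ * (2 * A₁)) := by
        have e : ∀ i : ℕ, T * ((K : ℝ≥0∞) ^ (1 / p) * w ^ i * N) +
            A₂ * r ^ (J + i) * (c * (2 * (A₁ * N))) =
            T * (K : ℝ≥0∞) ^ (1 / p) * N * w ^ i + A₂ * r ^ J * (c * (2 * (A₁ * N))) * r ^ i := by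
          intro i
          rw [pow_add]
          ring
        simp_rw [e]
        rw [ENNReal.tsum_add, ENNReal.tsum_mul_left, ENNReal.tsum_mul_left, ENNReal.tsum_geometric,
          ENNReal.tsum_geometric]
        ring
    _ ≤ _ := by
        rw [add_mul _ (c * 2⁻¹), mul_right_comm c]
        gcongr

/-- The map `c ↦ A + c/2` has fixed point `2A`, so iterating from a finite constant gives `2A` for
all finite sets. Continuity in the dilation and monotone convergence along a countable dense set do
the rest. -/
theorem exists_dilBound [Nontrivial V] {R C b : ℝ} (hR0 : 0 ≤ R)
    (hR : ν (closedBall 0 R)ᶜ = 0) (hb0 : 0 < b) (hb1 : b ≤ 1)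
    (hν : ∀ ξ, ‖fourierMeasure ν ξ‖ ≤ C * (1 + ‖ξ‖) ^ (-((finrank ℝ V + b) / 2)))
    {E : Set ℝ} (hE : E ⊆ Icc 1 2) (hEb : HasNets E b) {p : ℝ} (hp : 1 < p) (hp2 : p < 2) :
    ∃ A : ℝ≥0∞, A ≠ ∞ ∧ DilBound ν (dyadicDilates E) p A := by
  have hp0 : 0 < p := by linarith
  obtain ⟨A, hA, himp⟩ := exists_dilBound_improve hR0 hR hb0 hb1 hν hE hEb hp hp2
  have hfin : ∀ S : Finset ℝ, ↑S ⊆ dyadicDilates E → DilBound ν S p (2 * A) := by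
    intro S hS
    obtain ⟨c, hct, hc⟩ := exists_dilBound_finset (ν := ν) S hp.le
    -- The distance of the constant to `2A` halves at each step; this is where the a priori
    -- finiteness of `c` is essential.
    have hiter : ∀ n : ℕ, DilBound ν S p (2 * A + c * 2⁻¹ ^ n) := by
      intro n
      induction n with
      | zero => exact fun h h1 h2 h3 => (hc h h1 h2 h3).trans (by gcongr; simp)
      | succ n ih =>
        have := himp S _ hS ih
        have e : A + (2 * A + c * 2⁻¹ ^ n) * 2⁻¹ = 2 * A + c * 2⁻¹ ^ (n + 1) := by
          rw [add_mul, mul_comm (2 * A), ← mul_assoc, ENNReal.inv_mul_cancel (by simp) (by simp),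
            one_mul, ← add_assoc, two_mul, pow_succ, mul_assoc]
        rwa [e] at this
    intro h h1 h2 h3
    have hNt : (powNorm p fun x => ‖h x‖ₑ) ≠ ∞ := by
      have := (h1.memLp_of_hasCompactSupport h2 (p := ENNReal.ofReal p) (μ := volume)).2
      rw [eLpNorm_eq_powNorm hp0] at this
      exact this.ne
    have ht : Tendsto (fun n : ℕ => (2 * A + c * 2⁻¹ ^ n) * powNorm p fun x => ‖h x‖ₑ) atTop
        (𝓝 (2 * A * powNorm p fun x => ‖h x‖ₑ)) := by
      have := ENNReal.Tendsto.mul_const (((ENNReal.Tendsto.const_mul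
        (ENNReal.tendsto_pow_atTop_nhds_zero_of_lt_one (r := (2 : ℝ≥0∞)⁻¹) (by simp))
        (Or.inr hct))).const_add (2 * A)) (Or.inr hNt)
      simpa using this
    exact ge_of_tendsto' ht fun n => hiter n h h1 h2 h3
  refine ⟨2 * A, ENNReal.mul_ne_top (by simp) hA, fun h h1 h2 h3 => ?_⟩
  rcases E.eq_empty_or_nonempty with rfl | hne
  · have : dilMax ν (dyadicDilates ∅) (fun x => ‖h x‖ₑ) = 0 := by
      ext x
      simp [dilMax, dyadicDilates]
    rw [this]
    simp [powNorm, hp0]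
  have hne' : Nonempty (dyadicDilates E) := by
    obtain ⟨t, ht⟩ := hne
    exact ⟨⟨2 ^ (0 : ℤ) * t, 0, t, ht, rfl⟩⟩
  let u : ℕ → dyadicDilates E := TopologicalSpace.denseSeq _
  let S : ℕ → Finset ℝ := fun n => (Finset.range n).image fun k => (u k : ℝ)
  have hSmono : Monotone S := fun m n hmn =>
    Finset.image_subset_image (Finset.range_mono hmn)
  have hSE : ∀ n, ↑(S n) ⊆ dyadicDilates E := by
    intro n s hs
    obtain ⟨k, -, rfl⟩ := Finset.mem_image.1 (Finset.mem_coe.1 hs)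
    exact (u k).2
  have hle : ∀ x, dilMax ν (dyadicDilates E) (fun x => ‖h x‖ₑ) x ≤
      ⨆ n, dilMax ν (S n) (fun x => ‖h x‖ₑ) x := by
    intro x
    refine iSup₂_le fun s hs => ?_
    have hcont : Continuous fun s : dyadicDilates E => ∫⁻ v, ‖h (x - (s : ℝ) • v)‖ₑ ∂ν :=
      (continuous_lintegral_translates h1 h2).comp (by fun_prop : Continuous fun s : dyadicDilates E => ((s : ℝ), x))
    have hcl : IsClosed {s : dyadicDilates E | ∫⁻ v, ‖h (x - (s : ℝ) • v)‖ₑ ∂ν ≤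
        ⨆ n, dilMax ν (S n) (fun x => ‖h x‖ₑ) x} := isClosed_le hcont continuous_const
    refine (TopologicalSpace.denseRange_denseSeq (dyadicDilates E)).induction_on
      (p := fun s : dyadicDilates E => ∫⁻ v, ‖h (x - (s : ℝ) • v)‖ₑ ∂ν ≤
        ⨆ n, dilMax ν (S n) (fun x => ‖h x‖ₑ) x) ⟨s, hs⟩ hcl fun k => ?_
    refine le_iSup_of_le (k + 1) ?_
    exact le_iSup₂_of_le (f := fun s _ => ∫⁻ v, ‖h (x - s • v)‖ₑ ∂ν) (u k : ℝ)
      (Finset.mem_coe.2 (Finset.mem_image.2 ⟨k, by simp, rfl⟩)) le_rfl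
  have hm : ∀ n, Measurable fun x => dilMax ν (S n) (fun x => ‖h x‖ₑ) x ^ p := fun n =>
    (measurable_dilMax _ h1 h2).pow_const p
  have hmono : Monotone fun n x => dilMax ν (S n) (fun x => ‖h x‖ₑ) x ^ p := by
    intro m n hmn x
    exact ENNReal.rpow_le_rpow (biSup_mono fun s hs => hSmono hmn hs) hp0.le
  have hint : ∫⁻ x, dilMax ν (dyadicDilates E) (fun x => ‖h x‖ₑ) x ^ p ≤
      (2 * A * powNorm p fun x => ‖h x‖ₑ) ^ p := by
    calc _ ≤ ∫⁻ x, ⨆ n, dilMax ν (S n) (fun x => ‖h x‖ₑ) x ^ p := by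
          refine lintegral_mono fun x => ?_
          have := (ENNReal.orderIsoRpow p hp0).map_iSup fun n => dilMax ν (S n) (fun x => ‖h x‖ₑ) x
          simp only [ENNReal.orderIsoRpow_apply] at this
          rw [← this]
          exact ENNReal.rpow_le_rpow (hle x) hp0.le
      _ = ⨆ n, ∫⁻ x, dilMax ν (S n) (fun x => ‖h x‖ₑ) x ^ p := lintegral_iSup hm hmono
      _ ≤ _ := by
          refine iSup_le fun n => ?_
          rw [← powNorm_rpow hp0]
          exact ENNReal.rpow_le_rpow (hfin (S n) (hSE n) h h1 h2 h3) hp0.le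
  rw [powNorm, one_div, ENNReal.rpow_inv_le_iff hp0]
  exact hint

end Bootstrapping

end

/-! ### All exponents, and the bilinear majorant by Hölder's inequality. -/

noncomputable section

section Majorants

open Module Metric

variable {V : Type*} [NormedAddCommGroup V] [InnerProductSpace ℝ V] [FiniteDimensional ℝ V]
  [MeasurableSpace V] [BorelSpace V]

theorem aemeasurable_comp_sub_smul {β : Type*} [MeasurableSpace β] {ν : Measure V}
    (hν : ν ≪ volume) {s : ℝ} (hs : 0 < s) {G : V → β} (hG : AEMeasurable G) (x : V) :
    AEMeasurable (fun v => G (x - s • v)) ν :=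
  ⟨fun v => hG.mk G (x - s • v), hG.measurable_mk.comp (by fun_prop),
    ae_comp_sub_smul hν hs hG.ae_eq_mk x⟩

/-- The maximal function over the dilations `D` is bounded on `Lˢ`, `1 < s < ∞`, in the sense that
it has measurable majorants with the right norm. -/
def DilMaxBounded (ν : Measure V) (D : Set ℝ) : Prop :=
  ∀ s : ℝ, 1 < s → ∃ A : ℝ≥0∞, A ≠ ∞ ∧ ∀ G : V → ℝ≥0∞, AEMeasurable G → powNorm s G ≠ ∞ →
    ∃ H : V → ℝ≥0∞, Measurable H ∧ (∀ x, dilMax ν D G x ≤ H x) ∧ powNorm s H ≤ A * powNorm s G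

theorem powNorm_rpow_comp {p q : ℝ} (hp : 0 < p) (hq : 0 < q) (G : V → ℝ≥0∞) :
    powNorm p (fun x => G x ^ q) = powNorm (p * q) G ^ q := by
  unfold powNorm
  rw [← ENNReal.rpow_mul]
  congr 1
  · simp_rw [← ENNReal.rpow_mul, mul_comm q p]
  · field_simp

/-- Exponents below `2` come from the bootstrap. For `s ≥ 2`, Jensen gives `(∫ G dν)^q ≤ ν(V)^(q-1)
∫ G^q dν` with `q = s/(3/2)`, reducing to `L^(3/2)`. -/
theorem dilMaxBounded_dyadicDilates [Nontrivial V] {ν : Measure V} [IsFiniteMeasure ν] {R C b : ℝ}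
    (hR0 : 0 ≤ R) (hR : ν (closedBall 0 R)ᶜ = 0) (hb0 : 0 < b) (hb1 : b ≤ 1)
    (hν : ∀ ξ, ‖fourierMeasure ν ξ‖ ≤ C * (1 + ‖ξ‖) ^ (-((finrank ℝ V + b) / 2)))
    {E : Set ℝ} (hE : E ⊆ Icc 1 2) (hEb : HasNets E b) : DilMaxBounded ν (dyadicDilates E) := by
  have hac : ν ≪ volume := absolutelyContinuous_of_fourierMeasure_le hR hν (by linarith)
  have hlow : ∀ s : ℝ, 1 < s → s < 2 → ∃ A : ℝ≥0∞, A ≠ ∞ ∧ ∀ G : V → ℝ≥0∞, AEMeasurable G →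
      powNorm s G ≠ ∞ → ∃ H : V → ℝ≥0∞, Measurable H ∧
        (∀ x, dilMax ν (dyadicDilates E) G x ≤ H x) ∧ powNorm s H ≤ A * powNorm s G := by
    intro s hs hs2
    obtain ⟨A, hA, hb⟩ := exists_dilBound hR0 hR hb0 hb1 hν hE hEb hs hs2
    refine ⟨A * 2, ENNReal.mul_ne_top hA (by simp), fun G hG hGt => ?_⟩
    obtain ⟨H, h1, h2, h3⟩ :=
      hb.exists_majorant hac (fun s hs => dyadicDilates_pos hE hs) hs.le hG hGt
    exact ⟨H, h1, h2, by rwa [mul_assoc]⟩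
  intro s hs
  rcases lt_or_ge s 2 with hs2 | hs2
  · exact hlow s hs hs2
  obtain ⟨A, hA, hmaj⟩ := hlow (3 / 2) (by norm_num) (by norm_num)
  set q : ℝ := s / (3 / 2) with hq
  have hq1 : 1 < q := by rw [hq, lt_div_iff₀ (by norm_num)]; linarith
  have hq0 : 0 < q := by linarith
  have hsq : 3 / 2 * q = s := by rw [hq]; ring
  set c : ℝ≥0∞ := ν univ ^ (q - 1) with hc
  have hct : c ≠ ∞ := ENNReal.rpow_ne_top_of_nonneg (by linarith) (measure_ne_top ν univ)
  refine ⟨(c * A) ^ (1 / q), ENNReal.rpow_ne_top_of_nonneg (by positivity)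
    (ENNReal.mul_ne_top hct hA), fun G hG hGt => ?_⟩
  have hGq : powNorm (3 / 2) (fun x => G x ^ q) = powNorm s G ^ q := by
    rw [powNorm_rpow_comp (by norm_num) hq0, hsq]
  obtain ⟨H, hHm, hH, hHN⟩ := hmaj (fun x => G x ^ q) (hG.pow_const q)
    (by rw [hGq]; exact ENNReal.rpow_ne_top_of_nonneg hq0.le hGt)
  refine ⟨fun x => (c * H x) ^ (1 / q), (hHm.const_mul c).pow_const _, fun x => ?_, ?_⟩
  · refine iSup₂_le fun t ht => ?_
    rw [one_div, ENNReal.le_rpow_inv_iff hq0]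
    refine (lintegral_rpow_le_measure_univ_rpow_mul hq1.le
      (aemeasurable_comp_sub_smul hac (dyadicDilates_pos hE ht) hG x)).trans ?_
    gcongr
    refine le_trans ?_ (hH x)
    exact le_iSup₂_of_le (f := fun s _ => ∫⁻ v, G (x - s • v) ^ q ∂ν) t ht le_rfl
  · rw [powNorm_rpow_comp (by linarith) (by positivity), mul_one_div,
      show s / q = 3 / 2 by rw [hq]; field_simp, powNorm_const_mul (by norm_num) hct]
    calc _ ≤ (c * (A * powNorm s G ^ q)) ^ (1 / q) := by
          gcongr
          rwa [hGq] at hHN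
      _ = _ := by
          rw [← mul_assoc, ENNReal.mul_rpow_of_nonneg _ _ (by positivity), ← ENNReal.rpow_mul,
            mul_one_div_cancel hq0.ne', ENNReal.rpow_one]

variable {μ : Measure (V × V)} {D₁ D₂ : Set ℝ}

theorem lintegral_le_essSup_mul (h1 : μ.map Prod.fst ≪ volume) (h2 : μ.map Prod.snd ≪ volume)
    {s t : ℝ} (hs : 0 < s) (ht : 0 < t) {F G : V → ℝ≥0∞} (hG : AEMeasurable G) (x : V) :
    ∫⁻ w, F (x - s • w.1) * G (x - t • w.2) ∂μ ≤
      eLpNorm F ∞ volume * ∫⁻ v, G (x - t • v) ∂(μ.map Prod.snd) := by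
  have hF : ∀ᵐ y, F y ≤ eLpNorm F ∞ volume := by
    rw [eLpNorm_exponent_top]
    exact ae_le_eLpNormEssSup
  have hF' : ∀ᵐ w ∂μ, F (x - s • w.1) ≤ eLpNorm F ∞ volume :=
    ae_of_ae_map measurable_fst.aemeasurable (ae_comp_sub_smul h1 hs hF x)
  have hG' := aemeasurable_comp_sub_smul h2 ht hG x
  have hG2 : AEMeasurable (fun w : V × V => G (x - t • w.2)) μ := hG'.comp_measurable measurable_snd
  rw [lintegral_map' hG' measurable_snd.aemeasurable, ← lintegral_const_mul'' _ hG2]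
  refine lintegral_mono_ae ?_
  filter_upwards [hF'] with w hw
  gcongr

/-- Majorants for the bilinear maximal function at Hölder exponents. -/
theorem exists_bilinear_majorant [IsFiniteMeasure μ]
    (h1 : μ.map Prod.fst ≪ volume) (h2 : μ.map Prod.snd ≪ volume)
    (hD₁ : ∀ s ∈ D₁, 0 < s) (hD₂ : ∀ s ∈ D₂, 0 < s)
    (hb₁ : DilMaxBounded (μ.map Prod.fst) D₁) (hb₂ : DilMaxBounded (μ.map Prod.snd) D₂)
    {p q r : ℝ≥0∞} (hp : 1 < p) (hq : 1 < q) (hr : r⁻¹ = p⁻¹ + q⁻¹) (hr1 : r⁻¹ < 1) :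
    ∃ A : ℝ≥0∞, A ≠ ∞ ∧ ∀ F G : V → ℝ≥0∞, AEMeasurable F → AEMeasurable G →
      eLpNorm F p volume ≠ ∞ → eLpNorm G q volume ≠ ∞ → ∃ P : V → ℝ≥0∞, Measurable P ∧
        (∀ x, ∀ s ∈ D₁, ∀ t ∈ D₂, ∫⁻ w, F (x - s • w.1) * G (x - t • w.2) ∂μ ≤ P x) ∧
        eLpNorm P r volume ≤ A * eLpNorm F p volume * eLpNorm G q volume := by
  have hreal : ∀ u : ℝ≥0∞, 1 < u → u ≠ ∞ → ∃ v : ℝ, 1 < v ∧ u = ENNReal.ofReal v := by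
    intro u hu hut
    refine ⟨u.toReal, ?_, (ENNReal.ofReal_toReal hut).symm⟩
    rwa [← ENNReal.toReal_one, ENNReal.toReal_lt_toReal (by simp) hut]
  -- Exchanging the two factors reduces the case `q = ∞` to the one-sided sup bound for the first
  -- factor.
  have hswap : ∀ (F G : V → ℝ≥0∞) (x : V) (s t : ℝ), ∫⁻ w, F (x - s • w.1) * G (x - t • w.2) ∂μ =
      ∫⁻ w, G (x - t • w.1) * F (x - s • w.2) ∂(μ.map Prod.swap) := by
    intro F G x s t
    have h := lintegral_map_equiv (μ := μ) (fun w : V × V => G (x - t • w.1) * F (x - s • w.2))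
      (MeasurableEquiv.prodComm : V × V ≃ᵐ V × V)
    refine Eq.trans ?_ h.symm
    exact lintegral_congr fun w => mul_comm _ _
  have hfst : (μ.map Prod.swap).map Prod.fst = μ.map Prod.snd := by
    rw [Measure.map_map measurable_fst measurable_swap]; rfl
  have hsnd : (μ.map Prod.swap).map Prod.snd = μ.map Prod.fst := by
    rw [Measure.map_map measurable_snd measurable_swap]; rfl
  rcases eq_or_ne p ∞ with rfl | hpt <;> rcases eq_or_ne q ∞ with rfl | hqt
  · have hr' : r = ∞ := by simpa using hr
    subst hr'
    refine ⟨μ univ, measure_ne_top μ univ, fun F G hF hG hFt hGt =>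
      ⟨fun _ => μ univ * eLpNorm F ∞ volume * eLpNorm G ∞ volume, measurable_const, ?_, ?_⟩⟩
    · intro x s hs t ht
      refine (lintegral_le_essSup_mul h1 h2 (hD₁ s hs) (hD₂ t ht) hG x).trans ?_
      have hG' : ∀ᵐ y, G y ≤ eLpNorm G ∞ volume := by
        rw [eLpNorm_exponent_top]
        exact ae_le_eLpNormEssSup
      calc _ ≤ eLpNorm F ∞ volume * ∫⁻ _, eLpNorm G ∞ volume ∂(μ.map Prod.snd) := by
            gcongr 1
            exact lintegral_mono_ae (ae_comp_sub_smul h2 (hD₂ t ht) hG' x)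
        _ = _ := by
            rw [lintegral_const, Measure.map_apply measurable_snd .univ, preimage_univ]
            ring
    · rw [eLpNorm_exponent_top]
      exact eLpNormEssSup_le_of_ae_enorm_bound (Eventually.of_forall fun x => by simp)
  · have hr' : r = q := by simpa using hr
    subst hr'
    obtain ⟨q', hq1, rfl⟩ := hreal _ hq hqt
    have hq0 : 0 < q' := by linarith
    obtain ⟨A, hA, hmaj⟩ := hb₂ q' hq1
    refine ⟨A, hA, fun F G hF hG hFt hGt => ?_⟩
    have eG : eLpNorm G (ENNReal.ofReal q') volume = powNorm q' G := eLpNorm_eq_powNorm hq0 G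
    rw [eG] at hGt ⊢
    obtain ⟨H, hHm, hH, hHN⟩ := hmaj G hG hGt
    refine ⟨fun x => eLpNorm F ∞ volume * H x, hHm.const_mul _, fun x s hs t ht => ?_, ?_⟩
    · refine (lintegral_le_essSup_mul h1 h2 (hD₁ s hs) (hD₂ t ht) hG x).trans ?_
      beta_reduce
      gcongr
      exact le_trans (le_iSup₂_of_le t ht le_rfl) (hH x)
    · rw [eLpNorm_eq_powNorm hq0]
      simp only [enorm_eq_self]
      rw [powNorm_const_mul hq0 hFt, mul_comm A, mul_assoc]
      gcongr
  · have hr' : r = p := by simpa using hr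
    subst hr'
    obtain ⟨p', hp1, rfl⟩ := hreal _ hp hpt
    have hp0 : 0 < p' := by linarith
    obtain ⟨A, hA, hmaj⟩ := hb₁ p' hp1
    refine ⟨A, hA, fun F G hF hG hFt hGt => ?_⟩
    have eF : eLpNorm F (ENNReal.ofReal p') volume = powNorm p' F := eLpNorm_eq_powNorm hp0 F
    rw [eF] at hFt ⊢
    obtain ⟨H, hHm, hH, hHN⟩ := hmaj F hF hFt
    refine ⟨fun x => eLpNorm G ∞ volume * H x, hHm.const_mul _, fun x s hs t ht => ?_, ?_⟩
    · rw [hswap]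
      refine (lintegral_le_essSup_mul (hfst ▸ h2) (hsnd ▸ h1) (hD₂ t ht) (hD₁ s hs) hF x).trans ?_
      rw [hsnd]
      beta_reduce
      gcongr
      exact le_trans (le_iSup₂_of_le s hs le_rfl) (hH x)
    · rw [eLpNorm_eq_powNorm hp0]
      simp only [enorm_eq_self]
      rw [powNorm_const_mul hp0 hGt, mul_comm _ (eLpNorm G ∞ volume)]
      gcongr
  · have hrt : r ≠ ∞ := by
      rintro rfl
      rw [ENNReal.inv_top] at hr
      have := (add_eq_zero.1 hr.symm).1
      exact hpt (ENNReal.inv_eq_zero.1 this)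
    obtain ⟨r', hr1', rfl⟩ := hreal r (ENNReal.inv_lt_one.1 hr1) hrt
    obtain ⟨p', hp1, rfl⟩ := hreal _ hp hpt
    obtain ⟨q', hq1, rfl⟩ := hreal _ hq hqt
    have hp0 : 0 < p' := by linarith
    have hq0 : 0 < q' := by linarith
    have hr0 : 0 < r' := by linarith
    have hrr : r'⁻¹ = p'⁻¹ + q'⁻¹ := by
      rw [← ENNReal.ofReal_inv_of_pos hr0, ← ENNReal.ofReal_inv_of_pos hp0,
        ← ENNReal.ofReal_inv_of_pos hq0, ← ENNReal.ofReal_add (by positivity) (by positivity)] at hr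
      exact (ENNReal.ofReal_eq_ofReal_iff (by positivity) (by positivity)).1 hr
    -- The relation `1/r = 1/p + 1/q` says exactly that `p/r` and `q/r` are conjugate. Then `F^a`
    -- and `G^b` lie in `Lʳ`, so both linear bounds are used at the same exponent `r > 1`.
    obtain ⟨a, ha⟩ : ∃ a : ℝ, a = p' / r' := ⟨_, rfl⟩
    obtain ⟨b, hb⟩ : ∃ b : ℝ, b = q' / r' := ⟨_, rfl⟩
    have ha0 : 0 < a := by rw [ha]; positivity
    have hb0 : 0 < b := by rw [hb]; positivity
    have hab : a.HolderConjugate b := by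
      have : a⁻¹ + b⁻¹ = 1 := by
        rw [ha, hb, inv_div, inv_div, div_eq_mul_inv, div_eq_mul_inv, ← mul_add, ← hrr,
          mul_inv_cancel₀ hr0.ne']
      exact (Real.holderConjugate_iff.2 ⟨by
        have hb' : 0 < b⁻¹ := by positivity
        have : a⁻¹ < 1 := by linarith
        exact (inv_lt_one₀ ha0).1 this, this⟩)
    have hra : r' * a = p' := by rw [ha]; field_simp
    have hrb : r' * b = q' := by rw [hb]; field_simp
    obtain ⟨A₁, hA₁, hmaj₁⟩ := hb₁ r' hr1'
    obtain ⟨A₂, hA₂, hmaj₂⟩ := hb₂ r' hr1'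
    refine ⟨A₁ ^ (1 / a) * A₂ ^ (1 / b), ENNReal.mul_ne_top
      (ENNReal.rpow_ne_top_of_nonneg (by positivity) hA₁)
      (ENNReal.rpow_ne_top_of_nonneg (by positivity) hA₂), fun F G hF hG hFt hGt => ?_⟩
    have eF : eLpNorm F (ENNReal.ofReal p') volume = powNorm p' F := eLpNorm_eq_powNorm hp0 F
    have eG : eLpNorm G (ENNReal.ofReal q') volume = powNorm q' G := eLpNorm_eq_powNorm hq0 G
    rw [eF] at hFt ⊢
    rw [eG] at hGt ⊢
    have hFa : powNorm r' (fun x => F x ^ a) = powNorm p' F ^ a := by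
      rw [powNorm_rpow_comp hr0 ha0, hra]
    have hGb : powNorm r' (fun x => G x ^ b) = powNorm q' G ^ b := by
      rw [powNorm_rpow_comp hr0 hb0, hrb]
    obtain ⟨H₁, hH₁m, hH₁, hH₁N⟩ := hmaj₁ (fun x => F x ^ a) (hF.pow_const a)
      (by rw [hFa]; exact ENNReal.rpow_ne_top_of_nonneg ha0.le hFt)
    obtain ⟨H₂, hH₂m, hH₂, hH₂N⟩ := hmaj₂ (fun x => G x ^ b) (hG.pow_const b)
      (by rw [hGb]; exact ENNReal.rpow_ne_top_of_nonneg hb0.le hGt)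
    refine ⟨fun x => H₁ x ^ (1 / a) * H₂ x ^ (1 / b),
      (hH₁m.pow_const _).mul (hH₂m.pow_const _), fun x s hs t ht => ?_, ?_⟩
    · have hm1 := aemeasurable_comp_sub_smul h1 (hD₁ s hs) hF x
      have hm2 := aemeasurable_comp_sub_smul h2 (hD₂ t ht) hG x
      refine (ENNReal.lintegral_mul_le_Lp_mul_Lq μ hab
        (f := fun w => F (x - s • w.1)) (g := fun w => G (x - t • w.2))
        (hm1.comp_measurable measurable_fst) (hm2.comp_measurable measurable_snd)).trans ?_
      have e1 : ∫⁻ w, F (x - s • w.1) ^ a ∂μ = ∫⁻ v, F (x - s • v) ^ a ∂(μ.map Prod.fst) := by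
        rw [lintegral_map' (hm1.pow_const a) measurable_fst.aemeasurable]
      have e2 : ∫⁻ w, G (x - t • w.2) ^ b ∂μ = ∫⁻ v, G (x - t • v) ^ b ∂(μ.map Prod.snd) := by
        rw [lintegral_map' (hm2.pow_const b) measurable_snd.aemeasurable]
      rw [e1, e2]
      beta_reduce
      gcongr
      · exact le_trans (le_iSup₂_of_le (f := fun s _ => ∫⁻ v, F (x - s • v) ^ a ∂(μ.map Prod.fst))
          s hs le_rfl) (hH₁ x)
      · exact le_trans (le_iSup₂_of_le (f := fun s _ => ∫⁻ v, G (x - s • v) ^ b ∂(μ.map Prod.snd))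
          t ht le_rfl) (hH₂ x)
    · rw [eLpNorm_eq_powNorm hr0]
      simp only [enorm_eq_self]
      have hhol : powNorm r' (fun x => H₁ x ^ (1 / a) * H₂ x ^ (1 / b)) ≤
          powNorm r' H₁ ^ (1 / a) * powNorm r' H₂ ^ (1 / b) := by
        have h := ENNReal.lintegral_mul_le_Lp_mul_Lq volume hab
          (f := fun x => (H₁ x ^ (1 / a)) ^ r') (g := fun x => (H₂ x ^ (1 / b)) ^ r')
          ((hH₁m.pow_const _).pow_const _).aemeasurable ((hH₂m.pow_const _).pow_const _).aemeasurable
        have ea : ∀ x, ((H₁ x ^ (1 / a)) ^ r') ^ a = H₁ x ^ r' := by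
          intro x
          rw [← ENNReal.rpow_mul, ← ENNReal.rpow_mul]
          congr 1
          field_simp
        have eb : ∀ x, ((H₂ x ^ (1 / b)) ^ r') ^ b = H₂ x ^ r' := by
          intro x
          rw [← ENNReal.rpow_mul, ← ENNReal.rpow_mul]
          congr 1
          field_simp
        simp_rw [ea, eb, Pi.mul_apply, ← ENNReal.mul_rpow_of_nonneg _ _ hr0.le] at h
        unfold powNorm
        rw [← ENNReal.rpow_mul, ← ENNReal.rpow_mul, mul_comm (1 / r') (1 / a),
          mul_comm (1 / r') (1 / b), ENNReal.rpow_mul, ENNReal.rpow_mul _ (1 / b),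
          ← ENNReal.mul_rpow_of_nonneg _ _ (by positivity)]
        exact ENNReal.rpow_le_rpow h (by positivity)
      refine hhol.trans ?_
      calc _ ≤ (A₁ * powNorm p' F ^ a) ^ (1 / a) * (A₂ * powNorm q' G ^ b) ^ (1 / b) := by
            gcongr
            · rwa [hFa] at hH₁N
            · rwa [hGb] at hH₂N
        _ = _ := by
            rw [ENNReal.mul_rpow_of_nonneg _ _ (by positivity),
              ENNReal.mul_rpow_of_nonneg _ _ (by positivity), ← ENNReal.rpow_mul,
              ← ENNReal.rpow_mul, mul_one_div_cancel ha0.ne', mul_one_div_cancel hb0.ne',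
              ENNReal.rpow_one, ENNReal.rpow_one]
            ring

end Majorants

end

/-! ### Convergence, measurability and boundedness of the bilinear operator. -/

noncomputable section

section Bilinear

open Module Metric

variable {d : ℕ} {μ : Measure (EuclideanSpace ℝ (Fin d) × EuclideanSpace ℝ (Fin d))}

theorem aestronglyMeasurable_averageIntegrand (h1 : μ.map Prod.fst ≪ volume)
    (h2 : μ.map Prod.snd ≪ volume) {s t : ℝ} (hs : 0 < s) (ht : 0 < t)
    {f g : EuclideanSpace ℝ (Fin d) → ℂ} (hf : AEStronglyMeasurable f volume)
    (hg : AEStronglyMeasurable g volume) (x : EuclideanSpace ℝ (Fin d)) :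
    AEStronglyMeasurable (averageIntegrand s t f g x) μ := by
  have hf' : AEMeasurable (fun w : EuclideanSpace ℝ (Fin d) × EuclideanSpace ℝ (Fin d) =>
      f (x - s • w.1)) μ :=
    (aemeasurable_comp_sub_smul h1 hs hf.aemeasurable x).comp_measurable measurable_fst
  have hg' : AEMeasurable (fun w : EuclideanSpace ℝ (Fin d) × EuclideanSpace ℝ (Fin d) =>
      g (x - t • w.2)) μ :=
    (aemeasurable_comp_sub_smul h2 ht hg.aemeasurable x).comp_measurable measurable_snd
  exact (hf'.mul hg').aestronglyMeasurable

theorem measurable_bilinearMaximal_of_continuous [IsFiniteMeasure μ] (S : Set (ℝ × ℝ))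
    {f g : EuclideanSpace ℝ (Fin d) → ℂ} (hf : Continuous f) (hg : Continuous g)
    (hfs : HasCompactSupport f) (hgs : HasCompactSupport g) :
    Measurable (bilinearMaximal μ S f g) := by
  obtain ⟨M, hM⟩ := hf.bounded_above_of_compact_support hfs
  obtain ⟨N, hN⟩ := hg.bounded_above_of_compact_support hgs
  have hM0 : 0 ≤ M := (norm_nonneg _).trans (hM 0)
  refine (lowerSemicontinuous_biSup fun τ _ => Continuous.lowerSemicontinuous
    (Continuous.enorm ?_)).measurable
  unfold averageIntegrand
  refine continuous_of_dominated (bound := fun _ => M * N) (fun x => ?_)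
    (fun x => Eventually.of_forall fun w => ?_) (integrable_const _)
    (Eventually.of_forall fun w => ?_)
  · exact ((hf.comp (by fun_prop)).mul (hg.comp (by fun_prop))).aestronglyMeasurable
  · rw [norm_mul]
    exact mul_le_mul (hM _) (hN _) (norm_nonneg _) hM0
  · exact (hf.comp (by fun_prop)).mul (hg.comp (by fun_prop))

theorem enorm_averageIntegrand (s t : ℝ) (f g : EuclideanSpace ℝ (Fin d) → ℂ)
    (x : EuclideanSpace ℝ (Fin d)) (w : EuclideanSpace ℝ (Fin d) × EuclideanSpace ℝ (Fin d)) :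
    ‖averageIntegrand s t f g x w‖ₑ = ‖f (x - s • w.1)‖ₑ * ‖g (x - t • w.2)‖ₑ := by
  rw [averageIntegrand, enorm_mul]

variable {D₁ D₂ : Set ℝ} {S : Set (ℝ × ℝ)}

theorem enorm_integral_le_bilinearMaximal {τ : ℝ × ℝ} (hτ : τ ∈ S)
    (f g : EuclideanSpace ℝ (Fin d) → ℂ) (x : EuclideanSpace ℝ (Fin d)) :
    ‖∫ w, averageIntegrand τ.1 τ.2 f g x w ∂μ‖ₑ ≤ bilinearMaximal μ S f g x := by
  unfold bilinearMaximal
  exact le_iSup₂ (f := fun (τ : ℝ × ℝ) (_ : τ ∈ S) =>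
    ‖∫ w, averageIntegrand τ.1 τ.2 f g x w ∂μ‖ₑ) τ hτ

theorem integrable_averageIntegrand_of_lt_top (h1 : μ.map Prod.fst ≪ volume)
    (h2 : μ.map Prod.snd ≪ volume) {s t : ℝ} (hs : 0 < s) (ht : 0 < t)
    {f g : EuclideanSpace ℝ (Fin d) → ℂ} (hf : AEStronglyMeasurable f volume)
    (hg : AEStronglyMeasurable g volume) {x : EuclideanSpace ℝ (Fin d)}
    (h : ∫⁻ w, ‖f (x - s • w.1)‖ₑ * ‖g (x - t • w.2)‖ₑ ∂μ < ∞) :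
    Integrable (averageIntegrand s t f g x) μ := by
  refine ⟨aestronglyMeasurable_averageIntegrand h1 h2 hs ht hf hg x, ?_⟩
  simpa only [HasFiniteIntegral, enorm_averageIntegrand] using h

/-- From `f g - f' g' = (f - f') g + f' (g - g')`, uniformly over dilations. Both directions are
stated because subtraction is truncated in `[0, ∞]`. -/
theorem bilinearMaximal_le_add (h1 : μ.map Prod.fst ≪ volume) (h2 : μ.map Prod.snd ≪ volume)
    (hD₁ : ∀ s ∈ D₁, 0 < s) (hD₂ : ∀ s ∈ D₂, 0 < s) (hS : S ⊆ D₁ ×ˢ D₂)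
    {f g f' g' : EuclideanSpace ℝ (Fin d) → ℂ} (hf : AEStronglyMeasurable f volume)
    (hg : AEStronglyMeasurable g volume) (hf' : AEStronglyMeasurable f' volume) {x : EuclideanSpace ℝ (Fin d)} {P Q : ℝ≥0∞}
    (hi : ∀ τ ∈ S, Integrable (averageIntegrand τ.1 τ.2 f g x) μ)
    (hi' : ∀ τ ∈ S, Integrable (averageIntegrand τ.1 τ.2 f' g' x) μ)
    (hP : ∀ s ∈ D₁, ∀ t ∈ D₂, ∫⁻ w, ‖f (x - s • w.1) - f' (x - s • w.1)‖ₑ *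
      ‖g (x - t • w.2)‖ₑ ∂μ ≤ P)
    (hQ : ∀ s ∈ D₁, ∀ t ∈ D₂, ∫⁻ w, ‖f' (x - s • w.1)‖ₑ *
      ‖g (x - t • w.2) - g' (x - t • w.2)‖ₑ ∂μ ≤ Q) :
    bilinearMaximal μ S f g x ≤ bilinearMaximal μ S f' g' x + (P + Q) ∧
      bilinearMaximal μ S f' g' x ≤ bilinearMaximal μ S f g x + (P + Q) := by
  have hdiff : ∀ τ ∈ S, ∫⁻ w, ‖averageIntegrand τ.1 τ.2 f g x w -
      averageIntegrand τ.1 τ.2 f' g' x w‖ₑ ∂μ ≤ P + Q := by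
    intro τ hτ
    obtain ⟨hτ1, hτ2⟩ := hS hτ
    have hm : AEMeasurable (fun w : EuclideanSpace ℝ (Fin d) × EuclideanSpace ℝ (Fin d) =>
        ‖f (x - τ.1 • w.1) - f' (x - τ.1 • w.1)‖ₑ * ‖g (x - τ.2 • w.2)‖ₑ) μ := by
      have e1 : AEMeasurable (fun w : EuclideanSpace ℝ (Fin d) × EuclideanSpace ℝ (Fin d) =>
          f (x - τ.1 • w.1) - f' (x - τ.1 • w.1)) μ :=
        (aemeasurable_comp_sub_smul h1 (hD₁ _ hτ1)
          (hf.aemeasurable.sub hf'.aemeasurable) x).comp_measurable measurable_fst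
      have e2 : AEMeasurable (fun w : EuclideanSpace ℝ (Fin d) × EuclideanSpace ℝ (Fin d) =>
          g (x - τ.2 • w.2)) μ :=
        (aemeasurable_comp_sub_smul h2 (hD₂ _ hτ2) hg.aemeasurable x).comp_measurable
          measurable_snd
      exact e1.enorm.mul e2.enorm
    calc _ ≤ ∫⁻ w, (‖f (x - τ.1 • w.1) - f' (x - τ.1 • w.1)‖ₑ * ‖g (x - τ.2 • w.2)‖ₑ +
          ‖f' (x - τ.1 • w.1)‖ₑ * ‖g (x - τ.2 • w.2) - g' (x - τ.2 • w.2)‖ₑ) ∂μ := by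
          refine lintegral_mono fun w => ?_
          rw [← enorm_mul, ← enorm_mul]
          refine le_trans (le_of_eq ?_) (enorm_add_le _ _)
          congr 1
          simp only [averageIntegrand]
          ring
      _ ≤ P + Q := by
          rw [lintegral_add_left' hm]
          exact add_le_add (hP _ hτ1 _ hτ2) (hQ _ hτ1 _ hτ2)
  constructor
  · refine iSup₂_le fun τ hτ => ?_
    have e : ∫ w, averageIntegrand τ.1 τ.2 f g x w ∂μ =
        (∫ w, averageIntegrand τ.1 τ.2 f' g' x w ∂μ) + ∫ w, (averageIntegrand τ.1 τ.2 f g x w -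
          averageIntegrand τ.1 τ.2 f' g' x w) ∂μ := by
      rw [integral_sub (hi τ hτ) (hi' τ hτ)]; ring
    rw [e]
    exact (enorm_add_le _ _).trans (add_le_add (enorm_integral_le_bilinearMaximal hτ f' g' x)
      ((enorm_integral_le_lintegral_enorm _).trans (hdiff τ hτ)))
  · refine iSup₂_le fun τ hτ => ?_
    have e : ∫ w, averageIntegrand τ.1 τ.2 f' g' x w ∂μ =
        (∫ w, averageIntegrand τ.1 τ.2 f g x w ∂μ) - ∫ w, (averageIntegrand τ.1 τ.2 f g x w -
          averageIntegrand τ.1 τ.2 f' g' x w) ∂μ := by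
      rw [integral_sub (hi τ hτ) (hi' τ hτ)]; ring
    rw [e]
    exact enorm_sub_le.trans (add_le_add (enorm_integral_le_bilinearMaximal hτ f g x)
      ((enorm_integral_le_lintegral_enorm _).trans (hdiff τ hτ)))

theorem bilinearMaximal_le_majorant (hS : S ⊆ D₁ ×ˢ D₂) {f g : EuclideanSpace ℝ (Fin d) → ℂ}
    {x : EuclideanSpace ℝ (Fin d)} {P : ℝ≥0∞}
    (hP : ∀ s ∈ D₁, ∀ t ∈ D₂, ∫⁻ w, ‖f (x - s • w.1)‖ₑ * ‖g (x - t • w.2)‖ₑ ∂μ ≤ P) :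
    bilinearMaximal μ S f g x ≤ P := by
  refine iSup₂_le fun τ hτ => (enorm_integral_le_lintegral_enorm _).trans ?_
  simp_rw [enorm_averageIntegrand]
  exact hP _ (hS hτ).1 _ (hS hτ).2

/-- For finite exponents `f` and `g` are limits of continuous compactly supported functions, whose
maximal functions are measurable. The bilinear majorants of the differences force almost everywhere
convergence. -/
theorem aemeasurable_bilinearMaximal_of_ne_top [IsFiniteMeasure μ]
    (h1 : μ.map Prod.fst ≪ volume) (h2 : μ.map Prod.snd ≪ volume)
    (hD₁ : ∀ s ∈ D₁, 0 < s) (hD₂ : ∀ s ∈ D₂, 0 < s)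
    (hb₁ : DilMaxBounded (μ.map Prod.fst) D₁) (hb₂ : DilMaxBounded (μ.map Prod.snd) D₂)
    (hS : S ⊆ D₁ ×ˢ D₂) {p q r : ℝ≥0∞} (hp : 1 < p) (hq : 1 < q) (hpt : p ≠ ∞) (hqt : q ≠ ∞)
    (hr : r⁻¹ = p⁻¹ + q⁻¹) (hr1 : r⁻¹ < 1) {f g : EuclideanSpace ℝ (Fin d) → ℂ}
    (hf : MemLp f p volume) (hg : MemLp g q volume) :
    AEMeasurable (bilinearMaximal μ S f g) volume := by
  obtain ⟨A, hA, hmaj⟩ := exists_bilinear_majorant h1 h2 hD₁ hD₂ hb₁ hb₂ hp hq hr hr1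
  have hrt : r ≠ ∞ := by
    rintro rfl
    rw [ENNReal.inv_top] at hr
    exact hpt (ENNReal.inv_eq_zero.1 (add_eq_zero.1 hr.symm).1)
  have hr1' : 1 < r := ENNReal.inv_lt_one.1 hr1
  set ρ := r.toReal with hρ
  have hρ1 : 1 < ρ := by rwa [hρ, ← ENNReal.toReal_one, ENNReal.toReal_lt_toReal (by simp) hrt]
  have hρ0 : 0 < ρ := by linarith
  have hrρ : r = ENNReal.ofReal ρ := (ENNReal.ofReal_toReal hrt).symm
  have hε : ∀ n : ℕ, (2 : ℝ≥0∞)⁻¹ ^ n ≠ 0 := fun n => pow_ne_zero _ (by simp)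
  choose F hFs hFε hFc hFL using fun n => hf.exists_hasCompactSupport_eLpNorm_sub_le hpt (hε n)
  choose G hGs hGε hGc hGL using fun n => hg.exists_hasCompactSupport_eLpNorm_sub_le hqt (hε n)
  have hFsub : ∀ n, AEStronglyMeasurable (f - F n) volume := fun n => hf.1.sub (hFL n).1
  have hGsub : ∀ n, AEStronglyMeasurable (g - G n) volume := fun n => hg.1.sub (hGL n).1
  have hhalf : ∀ n : ℕ, (2 : ℝ≥0∞)⁻¹ ^ n ≤ 1 := fun n => pow_le_one₀ zero_le (by simp)
  have hFle : ∀ n, eLpNorm (F n) p volume ≤ eLpNorm f p volume + 1 := by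
    intro n
    have := eLpNorm_sub_le hf.1 (hFsub n) hp.le
    rw [sub_sub_cancel] at this
    exact this.trans (add_le_add_right ((hFε n).trans (hhalf n)) _)
  obtain ⟨P₀, hP₀m, hP₀, hP₀N⟩ := hmaj (fun x => ‖f x‖ₑ) (fun x => ‖g x‖ₑ) hf.1.enorm hg.1.enorm
    (by rw [eLpNorm_enorm]; exact hf.2.ne) (by rw [eLpNorm_enorm]; exact hg.2.ne)
  choose P hPm hP hPN using fun n => hmaj (fun x => ‖f x - F n x‖ₑ) (fun x => ‖g x‖ₑ)
    (hFsub n).enorm hg.1.enorm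
    (by
      have := eLpNorm_enorm (f - F n) (p := p) (μ := volume)
      simp only [Pi.sub_apply] at this
      rw [this]
      exact (hf.sub (hFL n)).2.ne) (by rw [eLpNorm_enorm]; exact hg.2.ne)
  choose Q hQm hQ hQN using fun n => hmaj (fun x => ‖F n x‖ₑ) (fun x => ‖g x - G n x‖ₑ)
    (hFL n).1.enorm (hGsub n).enorm (by rw [eLpNorm_enorm]; exact (hFL n).2.ne)
    (by
      have := eLpNorm_enorm (g - G n) (p := q) (μ := volume)
      simp only [Pi.sub_apply] at this
      rw [this]
      exact (hg.sub (hGL n)).2.ne)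
  have hfin : ∀ᵐ x, P₀ x < ∞ := by
    have hN : eLpNorm P₀ r volume ≠ ∞ := by
      refine ne_top_of_le_ne_top ?_ hP₀N
      rw [eLpNorm_enorm, eLpNorm_enorm]
      exact ENNReal.mul_ne_top (ENNReal.mul_ne_top hA hf.2.ne) hg.2.ne
    rw [hrρ, eLpNorm_eq_powNorm hρ0] at hN
    have : ∫⁻ x, P₀ x ^ ρ ≠ ∞ := by
      rw [← powNorm_rpow hρ0]
      exact ENNReal.rpow_ne_top_of_nonneg hρ0.le hN
    filter_upwards [ae_lt_top (hP₀m.pow_const ρ) this] with x hx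
    rw [lt_top_iff_ne_top] at hx ⊢
    rintro h
    rw [h, ENNReal.top_rpow_of_pos hρ0] at hx
    exact hx rfl
  -- The approximation errors are at most `2^(-n)`, so the majorants have summable `Lʳ` norms; their
  -- sum is finite almost everywhere and its terms tend to zero without passing to a subsequence.
  have hlim : ∀ᵐ x, Tendsto (fun n => P n x + Q n x) atTop (𝓝 0) := by
    have hPm' : ∀ n, Measurable fun x => P n x + Q n x := fun n => (hPm n).add (hQm n)
    set L : ℝ≥0∞ := A * eLpNorm g q volume + A * (eLpNorm f p volume + 1) with hL
    have hLt : L ≠ ∞ := ENNReal.add_ne_top.2 ⟨ENNReal.mul_ne_top hA hg.2.ne,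
      ENNReal.mul_ne_top hA (ENNReal.add_ne_top.2 ⟨hf.2.ne, by simp⟩)⟩
    have hn : ∀ n, powNorm ρ (fun x => P n x + Q n x) ≤ L * 2⁻¹ ^ n := by
      intro n
      refine (powNorm_add_le hρ1.le (hPm n).aemeasurable (hQm n).aemeasurable).trans ?_
      rw [hL, add_mul]
      have e1 : eLpNorm (P n) r volume = powNorm ρ (P n) := by
        rw [hrρ]; exact eLpNorm_eq_powNorm hρ0 _
      have e2 : eLpNorm (Q n) r volume = powNorm ρ (Q n) := by
        rw [hrρ]; exact eLpNorm_eq_powNorm hρ0 _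
      rw [← e1, ← e2]
      refine add_le_add ((hPN n).trans ?_) ((hQN n).trans ?_)
      · have := eLpNorm_enorm (f - F n) (p := p) (μ := volume)
        simp only [Pi.sub_apply] at this
        rw [this, eLpNorm_enorm, mul_right_comm]
        gcongr
        exact hFε n
      · have := eLpNorm_enorm (g - G n) (p := q) (μ := volume)
        simp only [Pi.sub_apply] at this
        rw [this, eLpNorm_enorm]
        gcongr
        · exact hFle n
        · exact hGε n
    have hsum : powNorm ρ (fun x => ∑' n, (P n x + Q n x)) ≠ ∞ := by
      refine ne_top_of_le_ne_top ?_
        (lintegral_rpow_tsum_le hρ1.le fun n => (hPm' n).aemeasurable)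
      refine ne_top_of_le_ne_top ?_ (ENNReal.tsum_le_tsum hn)
      rw [ENNReal.tsum_mul_left, ENNReal.tsum_geometric, ENNReal.one_sub_inv_two, inv_inv]
      exact ENNReal.mul_ne_top hLt (by simp)
    have hsum' : ∫⁻ x, (∑' n, (P n x + Q n x)) ^ ρ ≠ ∞ := by
      rw [← powNorm_rpow hρ0 (fun x => ∑' n, (P n x + Q n x))]
      exact ENNReal.rpow_ne_top_of_nonneg hρ0.le hsum
    filter_upwards [ae_lt_top ((Measurable.tsum hPm').pow_const ρ) hsum'] with x hx
    refine ENNReal.tendsto_atTop_zero_of_tsum_ne_top ?_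
    rintro h
    rw [h, ENNReal.top_rpow_of_pos hρ0] at hx
    exact hx.ne rfl
  refine aemeasurable_of_tendsto_metrizable_ae atTop
    (fun n => (measurable_bilinearMaximal_of_continuous (μ := μ) S (hFc n) (hGc n) (hFs n)
      (hGs n)).aemeasurable) ?_
  filter_upwards [hfin, hlim] with x hx0 hx
  have hi : ∀ τ ∈ S, Integrable (averageIntegrand τ.1 τ.2 f g x) μ := fun τ hτ =>
    integrable_averageIntegrand_of_lt_top h1 h2 (hD₁ _ (hS hτ).1) (hD₂ _ (hS hτ).2) hf.1 hg.1
      ((hP₀ x _ (hS hτ).1 _ (hS hτ).2).trans_lt hx0)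
  have hi' : ∀ n, ∀ τ ∈ S, Integrable (averageIntegrand τ.1 τ.2 (F n) (G n) x) μ := by
    intro n τ hτ
    obtain ⟨M, hM⟩ := (hFc n).bounded_above_of_compact_support (hFs n)
    obtain ⟨N, hN⟩ := (hGc n).bounded_above_of_compact_support (hGs n)
    have hM0 : 0 ≤ M := (norm_nonneg _).trans (hM 0)
    refine Integrable.of_bound (aestronglyMeasurable_averageIntegrand h1 h2 (hD₁ _ (hS hτ).1)
      (hD₂ _ (hS hτ).2) (hFL n).1 (hGL n).1 x) (M * N) (Eventually.of_forall fun w => ?_)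
    rw [averageIntegrand, norm_mul]
    exact mul_le_mul (hM _) (hN _) (norm_nonneg _) hM0
  have hcomp := fun n => bilinearMaximal_le_add h1 h2 hD₁ hD₂ hS hf.1 hg.1 (hFL n).1
    hi (hi' n) (hP n x) (hQ n x)
  have hMt : bilinearMaximal μ S f g x ≠ ∞ :=
    ((bilinearMaximal_le_majorant hS (hP₀ x)).trans_lt hx0).ne
  refine tendsto_of_tendsto_of_tendsto_of_le_of_le
    (g := fun n => bilinearMaximal μ S f g x - (P n x + Q n x))
    (h := fun n => bilinearMaximal μ S f g x + (P n x + Q n x)) ?_ ?_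
    (fun n => tsub_le_iff_right.2 (hcomp n).1) (fun n => (hcomp n).2)
  · simpa using ENNReal.Tendsto.sub (tendsto_const_nhds (x := bilinearMaximal μ S f g x)) hx
      (Or.inl hMt)
  · simpa using hx.const_add (bilinearMaximal μ S f g x)

/-- Both reciprocals are raised by a quarter of the slack `1 - 1/p - 1/q`, making them positive
while half of the slack remains. -/
theorem exists_finite_exponents {p q : ℝ≥0∞} (h : p⁻¹ + q⁻¹ < 1) :
    ∃ p' q' r' : ℝ≥0∞, 1 < p' ∧ 1 < q' ∧ p' ≠ ∞ ∧ q' ≠ ∞ ∧ p' ≤ p ∧ q' ≤ q ∧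
      r'⁻¹ = p'⁻¹ + q'⁻¹ ∧ r'⁻¹ < 1 := by
  have hpt : p⁻¹ ≠ ∞ := (lt_of_le_of_lt le_self_add h).ne_top
  have hqt : q⁻¹ ≠ ∞ := (lt_of_le_of_lt le_add_self h).ne_top
  obtain ⟨u, hu, hpu⟩ : ∃ u : ℝ, 0 ≤ u ∧ p⁻¹ = ENNReal.ofReal u :=
    ⟨_, ENNReal.toReal_nonneg, (ENNReal.ofReal_toReal hpt).symm⟩
  obtain ⟨v, hv, hqv⟩ : ∃ v : ℝ, 0 ≤ v ∧ q⁻¹ = ENNReal.ofReal v :=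
    ⟨_, ENNReal.toReal_nonneg, (ENNReal.ofReal_toReal hqt).symm⟩
  rw [hpu, hqv, ← ENNReal.ofReal_add hu hv, ENNReal.ofReal_lt_one] at h
  obtain ⟨ε, hε⟩ : ∃ ε : ℝ, ε = (1 - u - v) / 4 := ⟨_, rfl⟩
  have hε0 : 0 < ε := by linarith
  refine ⟨(ENNReal.ofReal (u + ε))⁻¹, (ENNReal.ofReal (v + ε))⁻¹,
    (ENNReal.ofReal (u + ε) + ENNReal.ofReal (v + ε))⁻¹, ?_, ?_, ?_, ?_, ?_, ?_, ?_, ?_⟩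
  · rw [ENNReal.one_lt_inv, ENNReal.ofReal_lt_one]; linarith
  · rw [ENNReal.one_lt_inv, ENNReal.ofReal_lt_one]; linarith
  · rw [ENNReal.inv_ne_top, Ne, ENNReal.ofReal_eq_zero]; linarith
  · rw [ENNReal.inv_ne_top, Ne, ENNReal.ofReal_eq_zero]; linarith
  · rw [ENNReal.inv_le_iff_inv_le, hpu]
    exact ENNReal.ofReal_le_ofReal (by linarith)
  · rw [ENNReal.inv_le_iff_inv_le, hqv]
    exact ENNReal.ofReal_le_ofReal (by linarith)
  · simp only [inv_inv]
  · rw [inv_inv, ← ENNReal.ofReal_add (by linarith) (by linarith), ENNReal.ofReal_lt_one]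
    linarith

theorem MeasureTheory.MemLp.indicator_closedBall_of_le {p p' : ℝ≥0∞} (h : p' ≤ p)
    {f : EuclideanSpace ℝ (Fin d) → ℂ} (hf : MemLp f p volume) (ρ : ℝ) :
    MemLp ((closedBall 0 ρ).indicator f) p' volume :=
  (hf.indicator measurableSet_closedBall).mono_exponent_of_measure_support_ne_top
    (s := closedBall 0 ρ) (fun _ hx => indicator_of_notMem hx f)
    measure_closedBall_lt_top.ne h

/-- Infinite exponents have no density of continuous compactly supported functions. For `x` in a
ball and bounded dilations, compact support of `μ` makes only bounded parts of `f` and `g` relevant,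
and these lie in smaller, finite Lebesgue spaces; countable exhaustions finish. -/
theorem aemeasurable_bilinearMaximal [IsFiniteMeasure μ] {R : ℝ}
    (hR1 : (μ.map Prod.fst) (closedBall 0 R)ᶜ = 0) (hR2 : (μ.map Prod.snd) (closedBall 0 R)ᶜ = 0)
    (h1 : μ.map Prod.fst ≪ volume) (h2 : μ.map Prod.snd ≪ volume)
    (hD₁ : ∀ s ∈ D₁, 0 < s) (hD₂ : ∀ s ∈ D₂, 0 < s)
    (hb₁ : DilMaxBounded (μ.map Prod.fst) D₁) (hb₂ : DilMaxBounded (μ.map Prod.snd) D₂)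
    (hS : S ⊆ D₁ ×ˢ D₂) {p q : ℝ≥0∞} (hpq : p⁻¹ + q⁻¹ < 1)
    {f g : EuclideanSpace ℝ (Fin d) → ℂ} (hf : MemLp f p volume) (hg : MemLp g q volume) :
    AEMeasurable (bilinearMaximal μ S f g) volume := by
  obtain ⟨p', q', r', hp, hq, hpt, hqt, hpp, hqq, hr, hr1⟩ := exists_finite_exponents hpq
  let T : ℕ → Set (ℝ × ℝ) := fun L => {τ ∈ S | τ.1 ≤ L ∧ τ.2 ≤ L}
  have hsup : bilinearMaximal μ S f g = fun x => ⨆ L, bilinearMaximal μ (T L) f g x := by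
    funext x
    refine le_antisymm (iSup₂_le fun τ hτ => ?_) (iSup_le fun L => biSup_mono fun τ hτ => hτ.1)
    obtain ⟨L, hL⟩ := exists_nat_ge (max τ.1 τ.2)
    have hτL : τ ∈ T L := ⟨hτ, (le_max_left _ _).trans hL, (le_max_right _ _).trans hL⟩
    exact le_iSup_of_le L (enorm_integral_le_bilinearMaximal hτL f g x)
  rw [hsup]
  refine AEMeasurable.iSup fun L => ?_
  have hcov : (⋃ n : ℕ, closedBall (0 : EuclideanSpace ℝ (Fin d)) n) = univ :=
    iUnion_closedBall_nat 0
  rw [← Measure.restrict_univ (μ := volume), ← hcov, aemeasurable_iUnion_iff]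
  intro n
  have hTS : T L ⊆ D₁ ×ˢ D₂ := fun τ hτ => hS hτ.1
  have hae1 : ∀ᵐ w ∂μ, w.1 ∈ closedBall (0 : EuclideanSpace ℝ (Fin d)) R :=
    ae_of_ae_map measurable_fst.aemeasurable (ae_iff.2 hR1)
  have hae2 : ∀ᵐ w ∂μ, w.2 ∈ closedBall (0 : EuclideanSpace ℝ (Fin d)) R :=
    ae_of_ae_map measurable_snd.aemeasurable (ae_iff.2 hR2)
  have hmem : ∀ (x v : EuclideanSpace ℝ (Fin d)) (s : ℝ), x ∈ closedBall 0 (n : ℝ) → 0 < s → s ≤ L →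
      v ∈ closedBall 0 R → x - s • v ∈ closedBall 0 (n + L * R) := by
    intro x v s hx hs hsL hv
    rw [mem_closedBall_zero_iff] at hx hv ⊢
    refine (norm_sub_le _ _).trans (add_le_add hx ?_)
    rw [norm_smul, Real.norm_of_nonneg hs.le]
    exact mul_le_mul hsL hv (norm_nonneg _) (by positivity)
  refine (aemeasurable_bilinearMaximal_of_ne_top h1 h2 hD₁ hD₂ hb₁ hb₂ hTS hp hq hpt hqt hr hr1
    (hf.indicator_closedBall_of_le hpp (n + L * R))
    (hg.indicator_closedBall_of_le hqq (n + L * R))).restrict.congr ?_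
  refine (ae_restrict_iff' measurableSet_closedBall).2 (Eventually.of_forall fun x hx => ?_)
  refine iSup_congr fun τ => iSup_congr fun hτ => ?_
  congr 1
  refine integral_congr_ae ?_
  filter_upwards [hae1, hae2] with w hw1 hw2
  rw [averageIntegrand, averageIntegrand, indicator_of_mem
    (hmem x w.1 τ.1 hx (hD₁ _ (hTS hτ).1) hτ.2.1 hw1), indicator_of_mem
    (hmem x w.2 τ.2 hx (hD₂ _ (hTS hτ).2) hτ.2.2 hw2)]

/-- One majorant `P` serves both claims: its finiteness almost everywhere gives absolute convergence
for all dilations simultaneously, and its norm bounds the maximal function. -/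
theorem holderBanachBounded_of_dilMaxBounded [IsFiniteMeasure μ] {R : ℝ}
    (hR1 : (μ.map Prod.fst) (closedBall 0 R)ᶜ = 0) (hR2 : (μ.map Prod.snd) (closedBall 0 R)ᶜ = 0)
    (h1 : μ.map Prod.fst ≪ volume) (h2 : μ.map Prod.snd ≪ volume)
    (hD₁ : ∀ s ∈ D₁, 0 < s) (hD₂ : ∀ s ∈ D₂, 0 < s)
    (hb₁ : DilMaxBounded (μ.map Prod.fst) D₁) (hb₂ : DilMaxBounded (μ.map Prod.snd) D₂)
    (hS : S ⊆ D₁ ×ˢ D₂) : HolderBanachBounded μ S := by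
  intro p q r hp hq hr hr1
  obtain ⟨A, hA, hmaj⟩ := exists_bilinear_majorant h1 h2 hD₁ hD₂ hb₁ hb₂ hp hq hr hr1
  refine ⟨A.toNNReal, fun f g hf hg => ?_⟩
  obtain ⟨P, hPm, hP, hPN⟩ := hmaj (fun x => ‖f x‖ₑ) (fun x => ‖g x‖ₑ) hf.1.enorm hg.1.enorm
    (by rw [eLpNorm_enorm]; exact hf.2.ne) (by rw [eLpNorm_enorm]; exact hg.2.ne)
  rw [eLpNorm_enorm, eLpNorm_enorm] at hPN
  have hPt : eLpNorm P r volume < ∞ :=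
    hPN.trans_lt (ENNReal.mul_ne_top (ENNReal.mul_ne_top hA hf.2.ne) hg.2.ne).lt_top
  have hfin : ∀ᵐ x, P x < ∞ := by
    have hr0 : r ≠ 0 := by
      rintro rfl
      simp at hr1
    rcases eq_or_ne r ∞ with rfl | hrt
    · rw [eLpNorm_exponent_top] at hPt
      filter_upwards [ae_le_eLpNormEssSup (f := P) (μ := volume)] with x hx
      exact lt_of_le_of_lt hx hPt
    · rw [eLpNorm_eq_lintegral_rpow_enorm_toReal hr0 hrt] at hPt
      have hρ0 : 0 < r.toReal := ENNReal.toReal_pos hr0 hrt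
      have hint : ∫⁻ x, P x ^ r.toReal ≠ ∞ := by
        rintro h
        simp only [enorm_eq_self] at hPt
        rw [h, ENNReal.top_rpow_of_pos (by positivity)] at hPt
        exact hPt.ne rfl
      filter_upwards [ae_lt_top (hPm.pow_const _) hint] with x hx
      rw [lt_top_iff_ne_top] at hx ⊢
      rintro h
      rw [h, ENNReal.top_rpow_of_pos hρ0] at hx
      exact hx rfl
  refine ⟨?_, aemeasurable_bilinearMaximal hR1 hR2 h1 h2 hD₁ hD₂ hb₁ hb₂ hS (hr ▸ hr1) hf hg, ?_⟩
  · filter_upwards [hfin] with x hx τ hτ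
    exact integrable_averageIntegrand_of_lt_top h1 h2 (hD₁ _ (hS hτ).1) (hD₂ _ (hS hτ).2) hf.1 hg.1
      ((hP x _ (hS hτ).1 _ (hS hτ).2).trans_lt hx)
  · rw [ENNReal.coe_toNNReal hA]
    refine le_trans (eLpNorm_mono_enorm fun x => ?_) hPN
    simp only [enorm_eq_self]
    exact bilinearMaximal_le_majorant hS (hP x)

end Bilinear

end

/-! ### From Minkowski dimension to nets. -/

section CoveringNumbers

theorem exists_cover_of_subset_Icc {E : Set ℝ} (hE : E ⊆ Icc 1 2) {δ : ℝ} (hδ : 0 < δ) :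
    ∃ c : Fin (⌊1 / δ⌋₊ + 1) → ℝ, E ⊆ ⋃ i, Icc (c i) (c i + δ) := by
  refine ⟨fun i => 1 + i * δ, fun t ht => mem_iUnion.2 ?_⟩
  obtain ⟨h1, h2⟩ := hE ht
  have h0 : 0 ≤ (t - 1) / δ := div_nonneg (by linarith) hδ.le
  have hle : ⌊(t - 1) / δ⌋₊ ≤ ⌊1 / δ⌋₊ := Nat.floor_mono (by gcongr; linarith)
  have h3 := Nat.floor_le h0
  have h4 := Nat.lt_floor_add_one ((t - 1) / δ)
  rw [le_div_iff₀ hδ] at h3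
  rw [div_lt_iff₀ hδ] at h4
  refine ⟨⟨⌊(t - 1) / δ⌋₊, Nat.lt_succ_of_le hle⟩, ?_, ?_⟩
  · change 1 + (⌊(t - 1) / δ⌋₊ : ℝ) * δ ≤ t
    linarith
  · change t ≤ 1 + (⌊(t - 1) / δ⌋₊ : ℝ) * δ + δ
    linarith

theorem intervalCoveringNumber_le {E : Set ℝ} (hE : E ⊆ Icc 1 2) {δ : ℝ} (hδ : 0 < δ)
    (hδ1 : δ ≤ 1) : (intervalCoveringNumber E δ : ℝ) ≤ 2 * δ⁻¹ := by
  have h : intervalCoveringNumber E δ ≤ ⌊1 / δ⌋₊ + 1 := Nat.sInf_le (exists_cover_of_subset_Icc hE hδ)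
  have h2 := Nat.floor_le (show 0 ≤ 1 / δ by positivity)
  have h3 : (1 : ℝ) ≤ δ⁻¹ := (one_le_inv₀ hδ).2 hδ1
  calc (intervalCoveringNumber E δ : ℝ) ≤ ⌊1 / δ⌋₊ + 1 := by exact_mod_cast h
    _ ≤ 2 * δ⁻¹ := by rw [one_div] at h2 ⊢; linarith

/-- One point of `E` is chosen from each interval of an optimal cover that meets `E`, so the net
lies inside `E` as the bootstrap requires. -/
theorem exists_net_card_le {E : Set ℝ} (hE : E ⊆ Icc 1 2) {δ : ℝ} (hδ : 0 < δ) :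
    ∃ D : Finset ℝ, ↑D ⊆ E ∧ (∀ t ∈ E, ∃ t' ∈ D, |t - t'| ≤ δ) ∧
      D.card ≤ intervalCoveringNumber E δ := by
  classical
  have hmem : intervalCoveringNumber E δ ∈
      {n : ℕ | ∃ c : Fin n → ℝ, E ⊆ ⋃ i, Icc (c i) (c i + δ)} :=
    Nat.sInf_mem ⟨_, exists_cover_of_subset_Icc hE hδ⟩
  obtain ⟨c, hc⟩ := hmem
  let J : Finset (Fin (intervalCoveringNumber E δ)) :=
    Finset.univ.filter fun i => (E ∩ Icc (c i) (c i + δ)).Nonempty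
  let u : Fin (intervalCoveringNumber E δ) → ℝ := fun i =>
    if h : (E ∩ Icc (c i) (c i + δ)).Nonempty then h.some else 0
  have hu : ∀ i, (E ∩ Icc (c i) (c i + δ)).Nonempty → u i ∈ E ∩ Icc (c i) (c i + δ) := by
    intro i h
    simp only [u, dif_pos h]
    exact h.some_mem
  refine ⟨J.image u, ?_, ?_, ?_⟩
  · intro t ht
    obtain ⟨i, hi, rfl⟩ := Finset.mem_image.1 (Finset.mem_coe.1 ht)
    exact (hu i (Finset.mem_filter.1 hi).2).1
  · intro t ht
    obtain ⟨i, hi⟩ := mem_iUnion.1 (hc ht)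
    have hne : (E ∩ Icc (c i) (c i + δ)).Nonempty := ⟨t, ht, hi⟩
    refine ⟨u i, Finset.mem_image_of_mem u (Finset.mem_filter.2 ⟨Finset.mem_univ i, hne⟩), ?_⟩
    have h2 := (hu i hne).2
    rw [abs_le]
    constructor <;> linarith [hi.1, hi.2, h2.1, h2.2]
  · calc (J.image u).card ≤ J.card := Finset.card_image_le
      _ ≤ (Finset.univ : Finset (Fin (intervalCoveringNumber E δ))).card :=
        Finset.card_le_card (Finset.filter_subset _ _)
      _ = _ := by simp

theorem eventually_intervalCoveringNumber_le {E : Set ℝ} (hE : E ⊆ Icc 1 2) {β : ℝ}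
    (hβ : upperMinkowskiDim E < β) :
    ∀ᶠ δ in 𝓝[>] (0 : ℝ), (intervalCoveringNumber E δ : ℝ) ≤ δ ^ (-β) := by
  have hsmall : ∀ᶠ δ in 𝓝[>] (0 : ℝ), δ ∈ Ioo (0 : ℝ) (1 / 2) :=
    Ioo_mem_nhdsGT (by norm_num)
  have hlog : ∀ δ ∈ Ioo (0 : ℝ) (1 / 2), Real.log 2 ≤ Real.log (1 / δ) := by
    intro δ hδ
    refine Real.log_le_log two_pos ?_
    rw [le_div_iff₀ hδ.1]
    linarith [hδ.2]
  have hl2 : 0 < Real.log 2 := Real.log_pos one_lt_two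
  -- A real-valued limsup controls eventual values only for functions bounded above; the trivial
  -- cover gives the bound `2` when `δ < 1/2`.
  have hbdd : IsBoundedUnder (· ≤ ·) (𝓝[>] (0 : ℝ))
      (fun δ : ℝ => Real.log (intervalCoveringNumber E δ) / Real.log (1 / δ)) := by
    refine isBoundedUnder_of_eventually_le (a := 2) ?_
    filter_upwards [hsmall] with δ hδ
    have h1 := hlog δ hδ
    rw [div_le_iff₀ (by linarith)]
    rcases Nat.eq_zero_or_pos (intervalCoveringNumber E δ) with h0 | h0
    · rw [h0]
      simp only [Nat.cast_zero, Real.log_zero]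
      linarith
    · have h2 := intervalCoveringNumber_le hE hδ.1 (by linarith [hδ.2])
      have h3 := Real.log_le_log (by exact_mod_cast h0) h2
      have hδ0 : δ⁻¹ ≠ 0 := inv_ne_zero hδ.1.ne'
      rw [Real.log_mul two_ne_zero hδ0, ← one_div] at h3
      linarith
  filter_upwards [hsmall, eventually_lt_of_limsup_lt hβ hbdd] with δ hδ h
  have h1 := hlog δ hδ
  rcases Nat.eq_zero_or_pos (intervalCoveringNumber E δ) with h0 | h0
  · rw [h0, Nat.cast_zero]
    exact Real.rpow_nonneg hδ.1.le _
  · rw [div_lt_iff₀ (by linarith), one_div, Real.log_inv] at h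
    rw [← Real.log_le_log_iff (by exact_mod_cast h0) (Real.rpow_pos_of_pos hδ.1 _),
      Real.log_rpow hδ.1]
    linarith

/-- Below dimension `1` the limsup controls small `δ`, and the loss `ε` makes the inequality strict.
The cap at `1` comes from covering the whole interval trivially. -/
theorem hasNets_of_upperMinkowskiDim_le {E : Set ℝ} (hE : E ⊆ Icc 1 2) {β : ℝ} (hβ0 : 0 < β)
    (hβ : upperMinkowskiDim E ≤ β) : HasNets E (min β 1) := by
  intro ε hε
  suffices h : ∃ K : ℝ, ∀ δ : ℝ, 0 < δ → δ ≤ 1 →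
      (intervalCoveringNumber E δ : ℝ) ≤ K * δ ^ (-(min β 1 + ε)) by
    obtain ⟨K, hK⟩ := h
    refine ⟨K, fun δ hδ hδ1 => ?_⟩
    obtain ⟨D, h1, h2, h3⟩ := exists_net_card_le hE hδ
    exact ⟨D, h1, h2, (Nat.cast_le.2 h3).trans (hK δ hδ hδ1)⟩
  rcases le_total 1 β with h1 | h1
  · refine ⟨2, fun δ hδ hδ1 => (intervalCoveringNumber_le hE hδ hδ1).trans ?_⟩
    rw [min_eq_right h1, ← Real.rpow_neg_one]
    gcongr 2 * ?_
    exact Real.rpow_le_rpow_of_exponent_ge hδ hδ1 (by linarith)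
  · rw [min_eq_left h1]
    have hev := eventually_intervalCoveringNumber_le hE (show upperMinkowskiDim E < β + ε by linarith)
    -- The limsup says nothing for `δ ≥ δ₀`; there the covering number is bounded by `2/δ₀`, which
    -- goes into the constant.
    obtain ⟨δ₀, hδ₀, hδ₀'⟩ := mem_nhdsGT_iff_exists_Ioo_subset.1 hev
    have hδ₀0 : 0 < δ₀ := hδ₀
    refine ⟨max 1 (2 * δ₀⁻¹), fun δ hδ hδ1 => ?_⟩
    rcases lt_or_ge δ δ₀ with hlt | hge
    · refine (hδ₀' ⟨hδ, hlt⟩ : (intervalCoveringNumber E δ : ℝ) ≤ _).trans ?_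
      exact le_mul_of_one_le_left (Real.rpow_nonneg hδ.le _) (le_max_left _ _)
    · have hone : (1 : ℝ) ≤ δ ^ (-(β + ε)) :=
        Real.one_le_rpow_of_pos_of_le_one_of_nonpos hδ hδ1 (by linarith)
      calc _ ≤ 2 * δ⁻¹ := intervalCoveringNumber_le hE hδ hδ1
        _ ≤ 2 * δ₀⁻¹ := by gcongr
        _ ≤ max 1 (2 * δ₀⁻¹) * 1 := by rw [mul_one]; exact le_max_right _ _
        _ ≤ _ := by gcongr

end CoveringNumbers

/-! ### Marginals of `μ` and conclusion. -/

section Main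

open Module Metric

variable {d : ℕ} {μ : Measure (EuclideanSpace ℝ (Fin d) × EuclideanSpace ℝ (Fin d))}

theorem fourierMeasure_map_fst (ξ : EuclideanSpace ℝ (Fin d)) :
    fourierMeasure (μ.map Prod.fst) ξ = measureFourier μ ξ 0 := by
  rw [fourierMeasure, integral_map measurable_fst.aemeasurable
    (measurable_fourierKernel ξ).aestronglyMeasurable, measureFourier]
  refine integral_congr_ae (Eventually.of_forall fun w => ?_)
  simp only [fourierKernel, inner_zero_right, add_zero]
  congr 1
  push_cast
  ring

theorem fourierMeasure_map_snd (ξ : EuclideanSpace ℝ (Fin d)) :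
    fourierMeasure (μ.map Prod.snd) ξ = measureFourier μ 0 ξ := by
  rw [fourierMeasure, integral_map measurable_snd.aemeasurable
    (measurable_fourierKernel ξ).aestronglyMeasurable, measureFourier]
  refine integral_congr_ae (Eventually.of_forall fun w => ?_)
  simp only [fourierKernel, inner_zero_right, zero_add]
  congr 1
  push_cast
  ring

theorem exists_marginals_decay {a b : ℝ} (ha : IsAdmissibleMeasure μ a) (hb : (d + b) / 2 ≤ a) :
    ∃ C : ℝ, (∀ ξ, ‖fourierMeasure (μ.map Prod.fst) ξ‖ ≤ C * (1 + ‖ξ‖) ^ (-((d + b) / 2))) ∧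
      ∀ ξ, ‖fourierMeasure (μ.map Prod.snd) ξ‖ ≤ C * (1 + ‖ξ‖) ^ (-((d + b) / 2)) := by
  obtain ⟨-, C, hC⟩ := ha
  have hmono : ∀ ξ : EuclideanSpace ℝ (Fin d),
      C * (1 + ‖ξ‖) ^ (-a) ≤ |C| * (1 + ‖ξ‖) ^ (-((d + b) / 2)) := by
    intro ξ
    refine mul_le_mul (le_abs_self C) (Real.rpow_le_rpow_of_exponent_le ?_ (by linarith))
      (by positivity) (abs_nonneg C)
    linarith [norm_nonneg ξ]
  refine ⟨|C|, fun ξ => ?_, fun ξ => ?_⟩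
  · rw [fourierMeasure_map_fst]
    have := hC ξ 0
    rw [norm_zero, add_zero] at this
    exact this.trans (hmono ξ)
  · rw [fourierMeasure_map_snd]
    have := hC 0 ξ
    rw [norm_zero, add_zero] at this
    exact this.trans (hmono ξ)

theorem exists_marginals_closedBall (hμ : IsCompact μ.support) :
    ∃ R : ℝ, 0 ≤ R ∧ (μ.map Prod.fst) (closedBall 0 R)ᶜ = 0 ∧
      (μ.map Prod.snd) (closedBall 0 R)ᶜ = 0 := by
  obtain ⟨R, hR⟩ := hμ.isBounded.subset_closedBall 0
  have hsub : μ.support ⊆ closedBall 0 |R| := hR.trans (closedBall_subset_closedBall (le_abs_self R))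
  refine ⟨|R|, abs_nonneg R, ?_, ?_⟩
  · rw [Measure.map_apply measurable_fst measurableSet_closedBall.compl]
    refine measure_mono_null ?_ Measure.measure_compl_support
    intro w hw hws
    have := hsub hws
    rw [mem_closedBall_zero_iff] at this
    exact hw (mem_closedBall_zero_iff.2 ((norm_fst_le w).trans this))
  · rw [Measure.map_apply measurable_snd measurableSet_closedBall.compl]
    refine measure_mono_null ?_ Measure.measure_compl_support
    intro w hw hws
    have := hsub hws
    rw [mem_closedBall_zero_iff] at this
    exact hw (mem_closedBall_zero_iff.2 ((norm_snd_le w).trans this))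

/-- All three operators use dilations from a product of dyadic dilates, so a single statement for
subsets of the product covers them. -/
theorem holderBanachBounded_of_subset (hd : 1 ≤ d) [IsFiniteMeasure μ] (hμ : IsCompact μ.support)
    {a : ℝ} (ha : IsAdmissibleMeasure μ a) {E₁ E₂ : Set ℝ} (hE₁ : E₁ ⊆ Icc 1 2)
    (hE₂ : E₂ ⊆ Icc 1 2) (h₁ : d + upperMinkowskiDim E₁ ≤ 2 * a)
    (h₂ : d + upperMinkowskiDim E₂ ≤ 2 * a) {S : Set (ℝ × ℝ)}
    (hS : S ⊆ dyadicDilates E₁ ×ˢ dyadicDilates E₂) : HolderBanachBounded μ S := by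
  have hfr : finrank ℝ (EuclideanSpace ℝ (Fin d)) = d := finrank_euclideanSpace_fin
  have hnt : Nontrivial (EuclideanSpace ℝ (Fin d)) :=
    nontrivial_of_finrank_pos (R := ℝ) (by rw [hfr]; exact hd)
  have hβ : 0 < 2 * a - d := by linarith [ha.1]
  -- Capping at `1` loses nothing, since subsets of `[1, 2]` always have nets of exponent `1`.
  -- Admissibility makes `b` positive even when the dimension of `E` is zero.
  set b := min (2 * a - d) 1 with hb
  have hb0 : 0 < b := lt_min hβ one_pos
  have hb1 : b ≤ 1 := min_le_right _ _
  obtain ⟨C, hC1, hC2⟩ := exists_marginals_decay ha (b := b)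
    (by linarith [min_le_left (2 * a - d) 1])
  obtain ⟨R, hR0, hR1, hR2⟩ := exists_marginals_closedBall hμ
  have hda : (finrank ℝ (EuclideanSpace ℝ (Fin d)) : ℝ) < 2 * ((d + b) / 2) := by
    rw [hfr]; linarith
  refine holderBanachBounded_of_dilMaxBounded hR1 hR2
    (absolutelyContinuous_of_fourierMeasure_le hR1 hC1 hda)
    (absolutelyContinuous_of_fourierMeasure_le hR2 hC2 hda)
    (fun s hs => dyadicDilates_pos hE₁ hs) (fun s hs => dyadicDilates_pos hE₂ hs)
    (dilMaxBounded_dyadicDilates hR0 hR1 hb0 hb1 (by rwa [hfr]) hE₁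
      (hasNets_of_upperMinkowskiDim_le hE₁ hβ (by linarith)))
    (dilMaxBounded_dyadicDilates hR0 hR2 hb0 hb1 (by rwa [hfr]) hE₂
      (hasNets_of_upperMinkowskiDim_le hE₂ hβ (by linarith))) hS

theorem oneParamDilations_subset (E : Set ℝ) :
    oneParamDilations E ⊆ dyadicDilates E ×ˢ dyadicDilates E := by
  rintro _ ⟨l, t, ht, rfl⟩
  exact ⟨⟨l, t, ht, rfl⟩, ⟨l, t, ht, rfl⟩⟩

theorem commonScaleDilations_subset (E₁ E₂ : Set ℝ) :
    commonScaleDilations E₁ E₂ ⊆ dyadicDilates E₁ ×ˢ dyadicDilates E₂ := by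
  rintro _ ⟨l, t₁, ht₁, t₂, ht₂, rfl⟩
  exact ⟨⟨l, t₁, ht₁, rfl⟩, ⟨l, t₂, ht₂, rfl⟩⟩

theorem biparamDilations_subset (E₁ E₂ : Set ℝ) :
    biparamDilations E₁ E₂ ⊆ dyadicDilates E₁ ×ˢ dyadicDilates E₂ := by
  rintro _ ⟨k, l, t₁, ht₁, t₂, ht₂, rfl⟩
  exact ⟨⟨k, t₁, ht₁, rfl⟩, ⟨l, t₂, ht₂, rfl⟩⟩

end Main

theorem proposition6p1 (d : ℕ) (hd : 1 ≤ d)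
    (μ : Measure (EuclideanSpace ℝ (Fin d) × EuclideanSpace ℝ (Fin d))) [IsFiniteMeasure μ]
    (hμ : IsCompact μ.support) (a : ℝ) (ha : IsAdmissibleMeasure μ a) :
    (∀ E : Set ℝ, E ⊆ Icc 1 2 → E.Nonempty → d + upperMinkowskiDim E ≤ 2 * a →
      HolderBanachBounded μ (oneParamDilations E)) ∧
    (∀ E₁ E₂ : Set ℝ, E₁ ⊆ Icc 1 2 → E₁.Nonempty → E₂ ⊆ Icc 1 2 → E₂.Nonempty →
      d + max (upperMinkowskiDim E₁) (upperMinkowskiDim E₂) ≤ 2 * a →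
      HolderBanachBounded μ (commonScaleDilations E₁ E₂) ∧
      HolderBanachBounded μ (biparamDilations E₁ E₂)) := by
  refine ⟨fun E hE _ h => ?_, fun E₁ E₂ hE₁ _ hE₂ _ h => ?_⟩
  · exact holderBanachBounded_of_subset hd hμ ha hE hE h h (oneParamDilations_subset E)
  · have h₁ : d + upperMinkowskiDim E₁ ≤ 2 * a := by
      linarith [le_max_left (upperMinkowskiDim E₁) (upperMinkowskiDim E₂)]
    have h₂ : d + upperMinkowskiDim E₂ ≤ 2 * a := by
      linarith [le_max_right (upperMinkowskiDim E₁) (upperMinkowskiDim E₂)]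
    exact ⟨holderBanachBounded_of_subset hd hμ ha hE₁ hE₂ h₁ h₂ (commonScaleDilations_subset E₁ E₂),
      holderBanachBounded_of_subset hd hμ ha hE₁ hE₂ h₁ h₂ (biparamDilations_subset E₁ E₂)⟩
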